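/- **Setting.** Let $\Omega=\prod_{i=1}^d(\alpha_i,\beta_i)$ be a bounded box with periodic boundary conditions, $\varepsilon>0$, $C_0\ge 0$, $F\in C^\infty(\mathbb R)$, and let $\mathcal G=-I$ (Allen–Cahn) or $\mathcal G=\Delta$ (Cahn–Hilliard). Write $\langle\cdot,\cdot\rangle$, $\|\cdot\|$ for the inner product and norm of $L^2(\Omega)$, and $$L(u)=\mathcal G(-\varepsilon^2\Delta u),\quad N(u,r)=\mathcal G\Big(\tfrac{r}{\sqrt{\int_\Omega F(u)\,dx+C_0}}\,F'(u)\Big),\quad \tilde N(u,r)=\frac{\langle F'(u),\,L(u)+N(u,r)\rangle}{2\sqrt{\int_\Omega F(u)\,dx+C_0}} .$$ Let $(u,r)$ be a smooth $\Omega$-periodic solution on $[0,T_0]$, $T_0>0$, of the scalar auxiliary variable system $$u_t=L(u)+N(u,r),\qquad r_t=\tilde N(u,r),$$ with $\int_\Omega F(u(t))\,dx+C_0>0$ for all $t\in[0,T_0]$, which is at no time in a steady state: $u_t(\cdot,t)\not\equiv0$ for every $t\in[0,T_0]$. **Scheme.** Let $(A,b)$, $(\bar A,\bar b)$ be the double Butcher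 tableau of an $s$-stage diagonally IMEX RK method: $a_{ij}=0$ for $j>i$, $\bar a_{ij}=0$ for $j\ge i$, $\sum_i b_i=\sum_i\bar b_i=1$, and $a_{ii}\ge0$. It has order $p$ if for every smooth split ordinary differential system $y'=f(y)+g(y)$ in a finite-dimensional space, one step of size $\tau$, implicit in $f$ and explicit in $g$, started on an exact solution has error $O(\tau^{p+1})$ as $\tau\to0^+$. One step of size $\tau$ of the IMEX RRK scheme from $(u^n_\gamma,r^n_\gamma)$ is $$U_{ni}=u^n_\gamma+\tau\sum_{j\le i}a_{ij}L_{nj}+\tau\sum_{j<i}\bar a_{ij}N_{nj},\qquad R_{ni}=r^n_\gamma+\tau\sum_{j<i}\bar a_{ij}\tilde N_{nj},\quad 1\le i\le s,$$ $$u^{n+1}_\gamma=u^n_\gamma+\gamma_n\tau\, d_u,\quad r^{n+1}_\gamma=r^n_\gamma+\gamma_n\tau\, d_r,\qquad d_u=\sum_i(b_iL_{ni}+\bar b_iN_{ni}),\quad d_r=\sum_i\bar b_i\tilde N_{ni},$$ with smooth periodic stages $U_{ni}$, $L_{nj}=L(U_{nj})$, $N_{nj}=N(U_{nj},R_{nj})$,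 $\tilde N_{nj}=\tilde N(U_{nj},R_{nj})$, and $$\gamma_n=\frac{\sum_i\big[\varepsilon^2\langle u^n_\gamma-U_{ni},\Delta(b_iL_{ni}+\bar b_iN_{ni})\rangle-2(r^n_\gamma-R_{ni})\bar b_i\tilde N_{ni}\big]}{\tau\big[\frac{\varepsilon^2}{2}\|\nabla d_u\|^2+d_r^2\big]}$$ if $\frac{\varepsilon^2}{2}\|\nabla d_u\|^2+d_r^2\ne0$, and $\gamma_n=1$ otherwise. **Theorem.** Suppose that the IMEX RK method has order $p\ge2$. Then there are constants $C$ and $\tau_0>0$ such that for every $\hat t_n\in[0,T_0]$ and every $0<\tau\le\tau_0$, one step of size $\tau$ of the IMEX RRK scheme from the exact values $u^n_\gamma=u(\hat t_n)$, $r^n_\gamma=r(\hat t_n)$ satisfies: 1. (Incremental direction technique, $\hat t_{n+1}=\hat t_n+\tau$.) If $\hat t_n+\tau\le T_0$, then $$\sup_{x}|u(x,\hat t_n+\tau)-u^{n+1}_\gamma(x)|\le C\tau^{p},\qquad |r(\hat t_n+\tau)-r^{n+1}_\gamma|\le C\tau^{p},$$ that is, the scheme has order $p-1$. 2. (Relaxation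 technique, $\hat t_{n+1}=\hat t_n+\gamma_n\tau$.) If $\hat t_n+\gamma_n\tau\le T_0$, then $$\sup_{x}|u(x,\hat t_n+\gamma_n\tau)-u^{n+1}_\gamma(x)|\le C\tau^{p+1},\qquad |r(\hat t_n+\gamma_n\tau)-r^{n+1}_\gamma|\le C\tau^{p+1},$$ that is, the scheme has order $p$. -/

import Mathlib

open Set Filter Topology MeasureTheory
open scoped ContDiff

noncomputable section

/-- An `s`-stage diagonally implicit-explicit Runge-Kutta method, given by its double Butcher
tableau: `A`, `b` for the implicit part, `Abar`, `bbar` for the explicit part. -/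
structure IMEXTableau (s : ℕ) where
  A : Matrix (Fin s) (Fin s) ℝ
  Abar : Matrix (Fin s) (Fin s) ℝ
  b : Fin s → ℝ
  bbar : Fin s → ℝ
  A_eq_zero : ∀ i j, i < j → A i j = 0
  Abar_eq_zero : ∀ i j, i ≤ j → Abar i j = 0
  sum_b : ∑ i, b i = 1
  sum_bbar : ∑ i, bbar i = 1

/-- The IMEX Runge-Kutta method has (at least) order `p`: for every split system
`y' = f y + g y` with smooth `f`, `g` (on an open subset `O` of a finite-dimensional space), treated
implicitly in `f` and explicitly in `g`, one step of size `τ` started on the exact solution has an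
error `O(τ ^ (p + 1))` as `τ → 0+`. The stages are those that tend to the initial value. -/
def IMEXTableau.HasOrder {s : ℕ} (M : IMEXTableau s) (p : ℕ) : Prop :=
  ∀ (E : Type) [NormedAddCommGroup E] [NormedSpace ℝ E] [FiniteDimensional ℝ E]
    (f g : E → E) (O : Set E) (h : ℝ) (y : ℝ → E) (Y : ℝ → Fin s → E),
    IsOpen O → ContDiffOn ℝ ∞ f O → ContDiffOn ℝ ∞ g O → 0 < h →
    (∀ t ∈ Icc 0 h, y t ∈ O ∧ HasDerivWithinAt y (f (y t) + g (y t)) (Icc 0 h) t) →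
    (∀ i, Tendsto (fun τ => Y τ i) (𝓝[>] 0) (𝓝 (y 0))) →
    (∀ᶠ τ in 𝓝[>] (0 : ℝ), ∀ i,
      Y τ i = y 0 + τ • (∑ j, M.A i j • f (Y τ j)) + τ • (∑ j, M.Abar i j • g (Y τ j))) →
    (fun τ => y τ -
        (y 0 + τ • (∑ i, M.b i • f (Y τ i)) + τ • (∑ i, M.bbar i • g (Y τ i))))
      =O[𝓝[>] 0] fun τ => τ ^ (p + 1)

/-- The two mobility operators: `-I` (Allen-Cahn) and the Laplacian (Cahn-Hilliard). -/
inductive Mobility where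
  | allenCahn
  | cahnHilliard

/-- The operator `𝒢`. -/
def Mobility.op {d : ℕ} :
    Mobility → (EuclideanSpace ℝ (Fin d) → ℝ) → EuclideanSpace ℝ (Fin d) → ℝ
  | .allenCahn, v => fun x => -v x
  | .cahnHilliard, v => Laplacian.laplacian v

/-- The data of the Allen-Cahn or Cahn-Hilliard gradient flow of the energy
`∫_Ω ε² / 2 |∇u|² + F u` on the box `Ω = ∏ (lo i, hi i)`, with periodic boundary conditions, and the
constant `C0` of the scalar auxiliary variable. -/
structure PhaseField (d : ℕ) where
  lo : Fin d → ℝ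
  hi : Fin d → ℝ
  lo_lt_hi : ∀ i, lo i < hi i
  mobility : Mobility
  ε : ℝ
  ε_pos : 0 < ε
  F : ℝ → ℝ
  F_smooth : ContDiff ℝ ∞ F
  C0 : ℝ
  C0_nonneg : 0 ≤ C0

namespace PhaseField

variable {d : ℕ} (P : PhaseField d)

/-- The box `Ω`. -/
def Ω : Set (EuclideanSpace ℝ (Fin d)) := {x | ∀ i, x i ∈ Ioo (P.lo i) (P.hi i)}

/-- The function `v` is `Ω`-periodic. -/
def IsPeriodic (v : EuclideanSpace ℝ (Fin d) → ℝ) : Prop :=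
  ∀ x i, v (x + EuclideanSpace.single i (P.hi i - P.lo i)) = v x

/-- The `L²` inner product on `Ω`. -/
def ip (v w : EuclideanSpace ℝ (Fin d) → ℝ) : ℝ := ∫ x in P.Ω, v x * w x

/-- The squared `L²` norm of the gradient. -/
def gradNormSq (v : EuclideanSpace ℝ (Fin d) → ℝ) : ℝ := ∫ x in P.Ω, ‖gradient v x‖ ^ 2

/-- The quantity `∫_Ω F v + C0` under the square root. -/
def shiftedEnergy (v : EuclideanSpace ℝ (Fin d) → ℝ) : ℝ := (∫ x in P.Ω, P.F (v x)) + P.C0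

/-- The linear part `L v = 𝒢 (-ε² Δ v)`. -/
def L (v : EuclideanSpace ℝ (Fin d) → ℝ) : EuclideanSpace ℝ (Fin d) → ℝ :=
  P.mobility.op fun x => -P.ε ^ 2 * Laplacian.laplacian v x

/-- The nonlinear part `N (v, r) = 𝒢 (r / √(∫_Ω F v + C0) * F' v)`. -/
def N (v : EuclideanSpace ℝ (Fin d) → ℝ) (r : ℝ) : EuclideanSpace ℝ (Fin d) → ℝ :=
  P.mobility.op fun x => r / √(P.shiftedEnergy v) * deriv P.F (v x)

/-- The right-hand side `Ñ (v, r) = ⟨F' v, L v + N (v, r)⟩ / (2 √(∫_Ω F v + C0))` of the equation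
for the auxiliary variable. -/
def Ntilde (v : EuclideanSpace ℝ (Fin d) → ℝ) (r : ℝ) : ℝ :=
  1 / (2 * √(P.shiftedEnergy v)) * P.ip (fun x => deriv P.F (v x)) fun x => P.L v x + P.N v r x

/-- The pair `(u, r)` is a smooth periodic solution on `[0, T]` of the gradient flow in its scalar
auxiliary variable form `u_t = L u + N (u, r)`, `r_t = Ñ (u, r)`, with a positive quantity under the
square root. -/
structure IsSolution (T : ℝ) (u : ℝ → EuclideanSpace ℝ (Fin d) → ℝ) (r : ℝ → ℝ) : Prop where
  smooth : ContDiffOn ℝ ∞ (fun z : ℝ × EuclideanSpace ℝ (Fin d) => u z.1 z.2) (Icc 0 T ×ˢ univ)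
  periodic : ∀ t ∈ Icc 0 T, P.IsPeriodic (u t)
  shiftedEnergy_pos : ∀ t ∈ Icc 0 T, 0 < P.shiftedEnergy (u t)
  u_eq : ∀ t ∈ Icc 0 T, ∀ x,
    HasDerivWithinAt (fun t' => u t' x) (P.L (u t) x + P.N (u t) (r t) x) (Icc 0 T) t
  r_eq : ∀ t ∈ Icc 0 T, HasDerivWithinAt r (P.Ntilde (u t) (r t)) (Icc 0 T) t

variable {s : ℕ} (M : IMEXTableau s)

/-- The functions `U i` and numbers `R i` are the internal stages of one step of size `τ` started at
`(u₀, r₀)`. -/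
structure IsStages (τ : ℝ) (u₀ : EuclideanSpace ℝ (Fin d) → ℝ) (r₀ : ℝ)
    (U : Fin s → EuclideanSpace ℝ (Fin d) → ℝ) (R : Fin s → ℝ) : Prop where
  smooth : ∀ i, ContDiff ℝ ∞ (U i)
  periodic : ∀ i, P.IsPeriodic (U i)
  U_eq : ∀ i x, U i x =
    u₀ x + τ * ∑ j, M.A i j * P.L (U j) x + τ * ∑ j, M.Abar i j * P.N (U j) (R j) x
  R_eq : ∀ i, R i = r₀ + τ * ∑ j, M.Abar i j * P.Ntilde (U j) (R j)

/-- The increment `∑ i, (b i * L (U i) + bbar i * N (U i, R i))` of `u`. -/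
def dirU (U : Fin s → EuclideanSpace ℝ (Fin d) → ℝ) (R : Fin s → ℝ) :
    EuclideanSpace ℝ (Fin d) → ℝ :=
  fun x => ∑ i, M.b i * P.L (U i) x + ∑ i, M.bbar i * P.N (U i) (R i) x

/-- The increment `∑ i, bbar i * Ñ (U i, R i)` of `r`. -/
def dirR (U : Fin s → EuclideanSpace ℝ (Fin d) → ℝ) (R : Fin s → ℝ) : ℝ :=
  ∑ i, M.bbar i * P.Ntilde (U i) (R i)

/-- The bracket in the denominator of the relaxation coefficient. -/
def relaxDen (U : Fin s → EuclideanSpace ℝ (Fin d) → ℝ) (R : Fin s → ℝ) : ℝ :=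
  P.ε ^ 2 / 2 * P.gradNormSq (P.dirU M U R) + P.dirR M U R ^ 2

/-- The numerator of the relaxation coefficient. -/
def relaxNum (u₀ : EuclideanSpace ℝ (Fin d) → ℝ) (r₀ : ℝ)
    (U : Fin s → EuclideanSpace ℝ (Fin d) → ℝ) (R : Fin s → ℝ) : ℝ :=
  ∑ i, (P.ε ^ 2 * P.ip (fun x => u₀ x - U i x)
      (Laplacian.laplacian fun x => M.b i * P.L (U i) x + M.bbar i * P.N (U i) (R i) x)
    - 2 * (r₀ - R i) * (M.bbar i * P.Ntilde (U i) (R i)))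

open Classical in
/-- The relaxation coefficient `γ_n`. -/
def relaxCoeff (τ : ℝ) (u₀ : EuclideanSpace ℝ (Fin d) → ℝ) (r₀ : ℝ)
    (U : Fin s → EuclideanSpace ℝ (Fin d) → ℝ) (R : Fin s → ℝ) : ℝ :=
  if P.relaxDen M U R ≠ 0 then P.relaxNum M u₀ r₀ U R / (τ * P.relaxDen M U R) else 1

/-- The relaxed update of `u`. -/
def stepU (τ : ℝ) (u₀ : EuclideanSpace ℝ (Fin d) → ℝ) (r₀ : ℝ)
    (U : Fin s → EuclideanSpace ℝ (Fin d) → ℝ) (R : Fin s → ℝ) :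
    EuclideanSpace ℝ (Fin d) → ℝ :=
  fun x => u₀ x + P.relaxCoeff M τ u₀ r₀ U R * τ * P.dirU M U R x

/-- The relaxed update of `r`. -/
def stepR (τ : ℝ) (u₀ : EuclideanSpace ℝ (Fin d) → ℝ) (r₀ : ℝ)
    (U : Fin s → EuclideanSpace ℝ (Fin d) → ℝ) (R : Fin s → ℝ) : ℝ :=
  r₀ + P.relaxCoeff M τ u₀ r₀ U R * τ * P.dirR M U R

end PhaseField

end

/-! ### Smooth periodic functions and their derivatives -/

noncomputable section

/-! Energy argument. Let `B` be the bilinear form of the modified energy `E = ε²/2 ‖∇u‖² + r²`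
(`energyForm`). Augment the unknowns `(u, r)` by a third one, `e`, with `e' = 2 B(v, v')`, split
into an implicit and an explicit part like `v'` itself. The augmented system is again a split
system, and along its solutions `e = E` persists. For a method of order `p` the third component of
the unrelaxed update therefore differs from the energy of its first two components by `O(τ^(p+1))`.
Expanding the quadratic form, this defect is exactly `τ · num - τ² · den` (`energy_defect`), that is
`τ² · den · (γ - 1)`. The factor `den` stays away from zero, because it tends to `B(v_t, v_t)`,
which is positive off the steady states (`IsSolution.dissipation_pos`). Hence `γ - 1 = O(τ^(p-1))`
(`isO_relaxCoeff_sub_one`).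

The two claims follow. The relaxed and the unrelaxed update differ by `(γ - 1) τ D = O(τ^p)`, where
`D` is the increment; this limits the incremental direction technique (`isO_incremental`). For the
relaxation technique let `∑ c_k τ^k` be the expansion of the solution, so that `τ D = ∑_{k ≥ 1} c_k
τ^k + O(τ^(p+1))`. Then `γ τ D` and the increment of the solution over the time `γ τ` differ by
terms `(γ^k - γ) τ^k c_k`, which vanish for `k = 1` and are `O(τ^(p-1) · τ²)` for `k ≥ 2`
(`isO_poly_rescale`, `isO_relaxation`).

Transfer of the order to the partial differential equation. The order is assumed only for ordinary
differential equations in finite dimension, with constants that may depend on the system. Solution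
and stages have formal expansions in `τ` whose coefficients are smooth periodic functions. For one
initial state only finitely many coefficients up to order `p` occur; interpolation at finitely many
points that reproduces them turns the equation into an ordinary one with the same expansions, so the
coefficients of solution and update agree (`poly_sub_poly_isO`, `exists_formal_step`). This
agreement is an identity without constants, and so it holds for all starting times simultaneously.

Analysis. All estimates are made in `IsO`, which controls every spatial derivative, so that
unbounded operators lose nothing; the operators that occur are `Tame`. A step of unknown stages is
controlled a priori by the dissipativity of `L`, through a resolvent estimate in Sobolev form
(`IsO.resolvent`, `isO_stage_sub`). After that, every passage through the stage equations, or
through the differential equation, gains one power of `τ` (`isO_update_sub_poly`,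
`IsSolution.isO_sub_poly`). Uniformity in starting times and stages is carried by filters that only
see `τ`. -/

/-- The Euclidean space `ℝ ^ d`. -/
abbrev Euc (d : ℕ) := EuclideanSpace ℝ (Fin d)

namespace PhaseField

variable {d : ℕ} (P : PhaseField d)

/-- The algebra of smooth `Ω`-periodic functions. -/
def smoothPeriodic : Subalgebra ℝ (Euc d → ℝ) where
  carrier := {v | ContDiff ℝ ∞ v ∧ P.IsPeriodic v}
  mul_mem' := fun ⟨ha, pa⟩ ⟨hb, pb⟩ =>
    ⟨ha.mul hb, fun x i => by simp only [Pi.mul_apply, pa x i, pb x i]⟩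
  add_mem' := fun ⟨ha, pa⟩ ⟨hb, pb⟩ =>
    ⟨ha.add hb, fun x i => by simp only [Pi.add_apply, pa x i, pb x i]⟩
  algebraMap_mem' := fun r => ⟨contDiff_const, fun _ _ => rfl⟩

instance : CoeFun P.smoothPeriodic fun _ => Euc d → ℝ := ⟨fun v => v.1⟩

variable {P}

lemma contDiff_coe (v : P.smoothPeriodic) : ContDiff ℝ ∞ (v : Euc d → ℝ) := v.2.1

lemma isPeriodic_coe (v : P.smoothPeriodic) : P.IsPeriodic (v : Euc d → ℝ) := v.2.2

lemma continuous_coe (v : P.smoothPeriodic) : Continuous (v : Euc d → ℝ) := (contDiff_coe v).continuous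

lemma differentiable_coe (v : P.smoothPeriodic) : Differentiable ℝ (v : Euc d → ℝ) :=
  (contDiff_coe v).differentiable (by simp)

@[ext] lemma smoothPeriodic_ext {v w : P.smoothPeriodic} (h : ∀ x, v x = w x) : v = w :=
  Subtype.ext (funext h)

@[simp] lemma coe_add_apply (v w : P.smoothPeriodic) (x : Euc d) : (v + w) x = v x + w x := rfl
@[simp] lemma coe_sub_apply (v w : P.smoothPeriodic) (x : Euc d) : (v - w) x = v x - w x := rfl
@[simp] lemma coe_neg_apply (v : P.smoothPeriodic) (x : Euc d) : (-v) x = -v x := rfl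
@[simp] lemma coe_mul_apply (v w : P.smoothPeriodic) (x : Euc d) : (v * w) x = v x * w x := rfl
@[simp] lemma coe_smul_apply (c : ℝ) (v : P.smoothPeriodic) (x : Euc d) : (c • v) x = c * v x := rfl
@[simp] lemma coe_zero_apply (x : Euc d) : (0 : P.smoothPeriodic) x = 0 := rfl
@[simp] lemma coe_one_apply (x : Euc d) : (1 : P.smoothPeriodic) x = 1 := rfl
@[simp] lemma coe_pow_apply (v : P.smoothPeriodic) (n : ℕ) (x : Euc d) : (v ^ n) x = v x ^ n := rfl
@[simp] lemma coe_algebraMap_apply (c : ℝ) (x : Euc d) :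
    (algebraMap ℝ P.smoothPeriodic c) x = c := rfl

@[simp] lemma coe_sum_apply {κ : Type*} (s : Finset κ) (v : κ → P.smoothPeriodic) (x : Euc d) :
    (∑ k ∈ s, v k) x = ∑ k ∈ s, v k x := by
  rw [AddSubmonoidClass.coe_finsetSum, Finset.sum_apply]

variable (P) in
/-- The partial derivative in direction `i`. -/
def pderiv (i : Fin d) : P.smoothPeriodic →ₗ[ℝ] P.smoothPeriodic where
  toFun v := ⟨fun x => fderiv ℝ v x (EuclideanSpace.single i 1),
    ((contDiff_coe v).fderiv_right (by simp)).clm_apply contDiff_const, fun x j => by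
      have h : (v : Euc d → ℝ) = fun x => v (x + EuclideanSpace.single j (P.hi j - P.lo j)) :=
        funext fun x => (isPeriodic_coe v x j).symm
      change fderiv ℝ v (x + _) _ = fderiv ℝ v x _
      conv_rhs => rw [h]
      rw [fderiv_comp_add_right]⟩
  map_add' v w := by
    ext x
    change fderiv ℝ ((v : Euc d → ℝ) + (w : Euc d → ℝ)) x _ = _
    rw [fderiv_add (differentiable_coe v x) (differentiable_coe w x)]; rfl
  map_smul' c v := by
    ext x
    change fderiv ℝ (c • (v : Euc d → ℝ)) x _ = _
    rw [fderiv_const_smul (differentiable_coe v x)]; rfl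

lemma pderiv_apply (i : Fin d) (v : P.smoothPeriodic) (x : Euc d) :
    P.pderiv i v x = fderiv ℝ v x (EuclideanSpace.single i 1) := rfl

lemma pderiv_mul (i : Fin d) (v w : P.smoothPeriodic) :
    P.pderiv i (v * w) = P.pderiv i v * w + v * P.pderiv i w := by
  ext x
  change fderiv ℝ ((v : Euc d → ℝ) * (w : Euc d → ℝ)) x _ = _
  rw [fderiv_mul (differentiable_coe v x) (differentiable_coe w x)]
  simp [pderiv_apply]; ring

@[simp] lemma pderiv_algebraMap (i : Fin d) (c : ℝ) :
    P.pderiv i (algebraMap ℝ P.smoothPeriodic c) = 0 := by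
  ext x
  change fderiv ℝ (fun _ : Euc d => c) x _ = _
  simp

@[simp] lemma pderiv_one (i : Fin d) : P.pderiv i 1 = 0 := by
  simpa using pderiv_algebraMap (P := P) i 1

lemma pderiv_comm (i j : Fin d) (v : P.smoothPeriodic) :
    P.pderiv i (P.pderiv j v) = P.pderiv j (P.pderiv i v) := by
  have key : ∀ (i j : Fin d) (x : Euc d), P.pderiv i (P.pderiv j v) x =
      fderiv ℝ (fderiv ℝ v) x (EuclideanSpace.single i 1) (EuclideanSpace.single j 1) := by
    intro i j x
    rw [pderiv_apply]
    change fderiv ℝ (fun x => fderiv ℝ v x (EuclideanSpace.single j 1)) x _ = _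
    rw [fderiv_clm_apply _ (differentiableAt_const _)]
    · simp
    · exact ((contDiff_coe v).fderiv_right (m := ∞) (by simp)).differentiable (by simp) x
  ext x
  rw [key, key]
  have : IsSymmSndFDerivAt ℝ (v : Euc d → ℝ) x :=
    (contDiff_coe v).contDiffAt.isSymmSndFDerivAt
      (by rw [minSmoothness_of_isRCLikeNormedField]; exact WithTop.coe_le_coe.2 (le_top : (2 : ℕ∞) ≤ ⊤))
  exact this _ _

variable (P) in
/-- The Laplacian on smooth periodic functions. -/
def lap : P.smoothPeriodic →ₗ[ℝ] P.smoothPeriodic := ∑ i, P.pderiv i ∘ₗ P.pderiv i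

lemma lap_eq (v : P.smoothPeriodic) : P.lap v = ∑ i, P.pderiv i (P.pderiv i v) := by
  simp [lap]

lemma laplacian_coe (v : P.smoothPeriodic) : Laplacian.laplacian (v : Euc d → ℝ) = P.lap v := by
  rw [InnerProductSpace.laplacian_eq_iteratedFDeriv_orthonormalBasis _
    (EuclideanSpace.basisFun (Fin d) ℝ)]
  ext x
  rw [lap_eq, coe_sum_apply]
  refine Finset.sum_congr rfl fun i _ => ?_
  rw [iteratedFDeriv_two_apply, pderiv_apply]
  change _ = fderiv ℝ (fun x => fderiv ℝ v x (EuclideanSpace.single i 1)) x _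
  rw [fderiv_clm_apply _ (differentiableAt_const _)]
  · simp
  · exact ((contDiff_coe v).fderiv_right (m := ∞) (by simp)).differentiable (by simp) x

lemma lap_pderiv (i : Fin d) (v : P.smoothPeriodic) :
    P.lap (P.pderiv i v) = P.pderiv i (P.lap v) := by
  rw [lap_eq, lap_eq, map_sum]
  refine Finset.sum_congr rfl fun j _ => ?_
  rw [pderiv_comm j i, pderiv_comm j i]

lemma norm_gradient_sq (v : P.smoothPeriodic) (x : Euc d) :
    ‖gradient (v : Euc d → ℝ) x‖ ^ 2 = (∑ i, P.pderiv i v * P.pderiv i v : P.smoothPeriodic) x := by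
  rw [EuclideanSpace.norm_sq_eq, coe_sum_apply]
  refine Finset.sum_congr rfl fun i _ => ?_
  have : gradient (v : Euc d → ℝ) x i = P.pderiv i v x := by
    rw [pderiv_apply, ← inner_gradient_left, real_inner_comm, EuclideanSpace.inner_single_left]
    simp
  rw [this, Real.norm_eq_abs, sq_abs, coe_mul_apply, sq]

/-- The composition of a smooth real function with a smooth periodic function. -/
def comp (G : ℝ → ℝ) (hG : ContDiff ℝ ∞ G) (v : P.smoothPeriodic) : P.smoothPeriodic :=
  ⟨fun x => G (v x), hG.comp (contDiff_coe v), fun x i => congrArg G (isPeriodic_coe v x i)⟩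

@[simp] lemma comp_apply (G : ℝ → ℝ) (hG : ContDiff ℝ ∞ G) (v : P.smoothPeriodic) (x : Euc d) :
    comp G hG v x = G (v x) := rfl

lemma contDiff_deriv {G : ℝ → ℝ} (hG : ContDiff ℝ ∞ G) : ContDiff ℝ ∞ (deriv G) :=
  (contDiff_infty_iff_deriv.1 hG).2

lemma pderiv_comp (i : Fin d) (G : ℝ → ℝ) (hG : ContDiff ℝ ∞ G) (v : P.smoothPeriodic) :
    P.pderiv i (comp G hG v) = comp (deriv G) (contDiff_deriv hG) v * P.pderiv i v := by
  ext x
  have h1 := ((hG.differentiable (by simp) (v x)).hasDerivAt.comp_hasFDerivAt x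
    (differentiable_coe v x).hasFDerivAt).fderiv
  rw [pderiv_apply]
  change fderiv ℝ (G ∘ v) x _ = _
  rw [h1]
  simp [pderiv_apply]

lemma apply_add_sum_single {v : Euc d → ℝ} (hv : P.IsPeriodic v) (n : Fin d → ℤ)
    (s : Finset (Fin d)) (x : Euc d) :
    v (x + ∑ i ∈ s, n i • EuclideanSpace.single i (P.hi i - P.lo i)) = v x := by
  classical
  induction s using Finset.induction_on generalizing x with
  | empty => simp
  | insert i s hi ih =>
    rw [Finset.sum_insert hi, ← add_assoc, ih]
    have : Function.Periodic v (EuclideanSpace.single i (P.hi i - P.lo i)) := fun x => hv x i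
    exact this.zsmul (n i) x

variable (P) in
/-- The closed box. -/
def closedBox : Set (Euc d) := {x | ∀ i, x i ∈ Icc (P.lo i) (P.hi i)}

variable (P) in
lemma isCompact_closedBox : IsCompact P.closedBox := by
  have : P.closedBox =
      (EuclideanSpace.equiv (Fin d) ℝ).toHomeomorph ⁻¹' (Set.pi univ fun i => Icc (P.lo i) (P.hi i)) := by
    ext x; simp [closedBox, Pi.le_def, forall_and]
  rw [this, Homeomorph.isCompact_preimage]
  exact isCompact_univ_pi fun i => isCompact_Icc

-- Each coordinate is shifted by an integer multiple of its period.
variable (P) in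
lemma exists_mem_closedBox (x : Euc d) :
    ∃ y ∈ P.closedBox, ∀ v : Euc d → ℝ, P.IsPeriodic v → v x = v y := by
  refine ⟨x + ∑ i, (-⌊(x i - P.lo i) / (P.hi i - P.lo i)⌋) •
    EuclideanSpace.single i (P.hi i - P.lo i), fun i => ?_, fun v hv => ?_⟩
  · have hl : 0 < P.hi i - P.lo i := sub_pos.2 (P.lo_lt_hi i)
    have h1 := Int.floor_le ((x i - P.lo i) / (P.hi i - P.lo i))
    have h2 := Int.lt_floor_add_one ((x i - P.lo i) / (P.hi i - P.lo i))
    rw [le_div_iff₀ hl] at h1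
    rw [div_lt_iff₀ hl] at h2
    have : (x + ∑ i, (-⌊(x i - P.lo i) / (P.hi i - P.lo i)⌋) •
        EuclideanSpace.single i (P.hi i - P.lo i) : Euc d) i =
        x i - ⌊(x i - P.lo i) / (P.hi i - P.lo i)⌋ * (P.hi i - P.lo i) := by
      simp [Pi.single_apply, sub_eq_add_neg]
    rw [this]
    constructor <;> nlinarith
  · rw [apply_add_sum_single hv]

lemma exists_bound {v : Euc d → ℝ} (hc : Continuous v) (hv : P.IsPeriodic v) :
    ∃ C, ∀ x, ‖v x‖ ≤ C := by
  obtain ⟨C, hC⟩ := P.isCompact_closedBox.exists_bound_of_continuousOn hc.continuousOn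
  refine ⟨C, fun x => ?_⟩
  obtain ⟨y, hy, h⟩ := P.exists_mem_closedBox x
  rw [h v hv]; exact hC y hy

variable (P) in
/-- A smooth periodic function as a bounded continuous function. -/
def toBCF : P.smoothPeriodic →ₐ[ℝ] BoundedContinuousFunction (Euc d) ℝ where
  toFun v := BoundedContinuousFunction.ofNormedAddCommGroup v (continuous_coe v)
    (exists_bound (continuous_coe v) (isPeriodic_coe v)).choose
    (exists_bound (continuous_coe v) (isPeriodic_coe v)).choose_spec
  map_one' := by ext; rfl
  map_mul' _ _ := by ext; rfl
  map_zero' := by ext; rfl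
  map_add' _ _ := by ext; rfl
  commutes' _ := by ext; rfl

@[simp] lemma toBCF_apply (v : P.smoothPeriodic) (x : Euc d) : P.toBCF v x = v x := rfl

end PhaseField

end

/-! ### Families bounded together with all derivatives, and Taylor remainders -/

noncomputable section

namespace PhaseField

variable {d : ℕ} {P : PhaseField d} {ι : Type*} {l : Filter ι} {g g₁ g₂ : ι → ℝ}

/-- All partial derivatives of order at most `m` of the family `v` are `O(g)`, uniformly in
space. -/
def IsOm (l : Filter ι) (g : ι → ℝ) : ℕ → (ι → P.smoothPeriodic) → Prop
  | 0, v => (fun i => P.toBCF (v i)) =O[l] g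
  | m + 1, v => ((fun i => P.toBCF (v i)) =O[l] g) ∧
      ∀ j, IsOm l g m fun i => P.pderiv j (v i)

/-- All partial derivatives of the family `v` are `O(g)`, uniformly in space. -/
def IsO (l : Filter ι) (g : ι → ℝ) (v : ι → P.smoothPeriodic) : Prop := ∀ m, IsOm l g m v

namespace IsOm

variable {m : ℕ} {v w : ι → P.smoothPeriodic}

lemma of_succ (h : IsOm l g (m + 1) v) : IsOm l g m v := by
  induction m generalizing v with
  | zero => exact h.1
  | succ m ih => exact ⟨h.1, fun j => ih (h.2 j)⟩

lemma congr' (h : IsOm l g m v) (hvw : v =ᶠ[l] w) : IsOm l g m w := by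
  induction m generalizing v w with
  | zero => exact Asymptotics.IsBigO.congr' h (hvw.mono fun i hi => by simp only [hi]) .rfl
  | succ m ih =>
    exact ⟨h.1.congr' (hvw.mono fun i hi => by simp only [hi]) .rfl,
      fun j => ih (h.2 j) (hvw.mono fun i hi => by simp only [hi])⟩

lemma trans (h : IsOm l g₁ m v) (hg : g₁ =O[l] g₂) : IsOm l g₂ m v := by
  induction m generalizing v with
  | zero => exact Asymptotics.IsBigO.trans h hg
  | succ m ih => exact ⟨h.1.trans hg, fun j => ih (h.2 j)⟩

lemma zero : IsOm l g m fun _ => (0 : P.smoothPeriodic) := by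
  have h0 : (fun _ : ι => P.toBCF (0 : P.smoothPeriodic)) =O[l] g := by
    simpa only [map_zero] using Asymptotics.isBigO_zero g l
  induction m with
  | zero => exact h0
  | succ m ih => exact ⟨h0, fun j => by simpa only [map_zero] using ih⟩

lemma add (hv : IsOm l g m v) (hw : IsOm l g m w) : IsOm l g m fun i => v i + w i := by
  induction m generalizing v w with
  | zero => simpa only [IsOm, map_add] using Asymptotics.IsBigO.add hv hw
  | succ m ih =>
    exact ⟨by simpa only [map_add] using hv.1.add hw.1,
      fun j => by simpa only [map_add] using ih (hv.2 j) (hw.2 j)⟩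

lemma smul {c : ι → ℝ} (hc : c =O[l] g₁) (hv : IsOm l g₂ m v) :
    IsOm l (fun i => g₁ i * g₂ i) m fun i => c i • v i := by
  induction m generalizing v with
  | zero => simp only [IsOm, map_smul]; exact Asymptotics.IsBigO.smul hc hv
  | succ m ih =>
    exact ⟨by simp only [map_smul]; exact hc.smul hv.1,
      fun j => by simpa only [map_smul] using ih (hv.2 j)⟩

lemma mul (hv : IsOm l g₁ m v) (hw : IsOm l g₂ m w) :
    IsOm l (fun i => g₁ i * g₂ i) m fun i => v i * w i := by
  induction m generalizing v w with
  | zero => simpa only [IsOm, map_mul] using Asymptotics.IsBigO.mul hv hw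
  | succ m ih =>
    refine ⟨by simpa only [map_mul] using hv.1.mul hw.1, fun j => ?_⟩
    simp only [pderiv_mul]
    exact (ih (hv.2 j) hw.of_succ).add (ih hv.of_succ (hw.2 j))

lemma comp_tendsto {κ : Type*} {l' : Filter κ} {k : κ → ι} (h : IsOm l g m v)
    (hk : Tendsto k l' l) : IsOm l' (g ∘ k) m (v ∘ k) := by
  induction m generalizing v with
  | zero => exact Asymptotics.IsBigO.comp_tendsto h hk
  | succ m ih => exact ⟨h.1.comp_tendsto hk, fun j => ih (h.2 j)⟩

end IsOm

namespace IsO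

variable {v w : ι → P.smoothPeriodic}

lemma base (h : IsO l g v) : (fun i => P.toBCF (v i)) =O[l] g := h 0

lemma pderiv (h : IsO l g v) (j : Fin d) : IsO l g fun i => P.pderiv j (v i) :=
  fun m => (h (m + 1)).2 j

lemma congr' (h : IsO l g v) (hvw : v =ᶠ[l] w) : IsO l g w := fun m => (h m).congr' hvw

lemma trans (h : IsO l g₁ v) (hg : g₁ =O[l] g₂) : IsO l g₂ v := fun m => (h m).trans hg

lemma zero : IsO l g fun _ => (0 : P.smoothPeriodic) := fun _ => IsOm.zero

lemma add (hv : IsO l g v) (hw : IsO l g w) : IsO l g fun i => v i + w i :=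
  fun m => (hv m).add (hw m)

lemma smul {c : ι → ℝ} (hc : c =O[l] g₁) (hv : IsO l g₂ v) :
    IsO l (fun i => g₁ i * g₂ i) fun i => c i • v i := fun m => (hv m).smul hc

lemma const_smul (c : ℝ) (hv : IsO l g v) : IsO l g fun i => c • v i := by
  simpa using hv.smul (Asymptotics.isBigO_const_const c (one_ne_zero (α := ℝ)) l)

lemma neg (hv : IsO l g v) : IsO l g fun i => -v i := by
  simpa using hv.const_smul (-1)

lemma sub (hv : IsO l g v) (hw : IsO l g w) : IsO l g fun i => v i - w i := by
  simpa only [sub_eq_add_neg] using hv.add hw.neg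

lemma sum {κ : Type*} (s : Finset κ) {v : κ → ι → P.smoothPeriodic}
    (hv : ∀ k ∈ s, IsO l g (v k)) : IsO l g fun i => ∑ k ∈ s, v k i := by
  classical
  induction s using Finset.induction_on with
  | empty => simpa using zero
  | insert k s hk ih =>
    simp only [Finset.sum_insert hk]
    exact (hv k (by simp)).add (ih fun k hk => hv k (by simp [hk]))

lemma mul (hv : IsO l g₁ v) (hw : IsO l g₂ w) :
    IsO l (fun i => g₁ i * g₂ i) fun i => v i * w i := fun m => (hv m).mul (hw m)

lemma mul_bdd (hv : IsO l g v) (hw : IsO l (fun _ => (1 : ℝ)) w) : IsO l g fun i => v i * w i := by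
  simpa using hv.mul hw

lemma comp_tendsto {κ : Type*} {l' : Filter κ} {k : κ → ι} (h : IsO l g v)
    (hk : Tendsto k l' l) : IsO l' (g ∘ k) (v ∘ k) := fun m => (h m).comp_tendsto hk

lemma mono {l' : Filter ι} (h : IsO l g v) (hl : l' ≤ l) : IsO l' g v :=
  h.comp_tendsto (k := id) hl

lemma of_base (h0 : (fun i => P.toBCF (v i)) =O[l] g)
    (h1 : ∀ j, IsO l g fun i => P.pderiv j (v i)) : IsO l g v
  | 0 => h0
  | m + 1 => ⟨h0, fun j => h1 j m⟩

lemma algebraMap {c : ι → ℝ} (hc : c =O[l] g) :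
    IsO l g fun i => algebraMap ℝ P.smoothPeriodic (c i) := by
  refine of_base ?_ fun j => by simpa only [pderiv_algebraMap] using zero
  simp only [AlgHom.commutes]
  exact (Asymptotics.isBigO_of_le _ fun i => by rw [norm_algebraMap']).trans hc

lemma const (v : P.smoothPeriodic) : IsO l (fun _ => (1 : ℝ)) fun _ => v := by
  intro m
  induction m generalizing v with
  | zero => exact Asymptotics.isBigO_const_const _ one_ne_zero l
  | succ m ih => exact ⟨Asymptotics.isBigO_const_const _ one_ne_zero l, fun j => ih _⟩

lemma lap (hv : IsO l g v) : IsO l g fun i => P.lap (v i) := by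
  simp only [lap_eq]
  exact sum _ fun j _ => (hv.pderiv j).pderiv j

lemma apply (hv : IsO l g v) (x : ι → Euc d) : (fun i => v i (x i)) =O[l] g :=
  (Asymptotics.isBigO_of_le _ fun i => (P.toBCF (v i)).norm_coe_le_norm (x i)).trans hv.base

end IsO

lemma contDiff_iteratedDeriv {G : ℝ → ℝ} (hG : ContDiff ℝ ∞ G) (k : ℕ) :
    ContDiff ℝ ∞ (iteratedDeriv k G) := by
  induction k generalizing G with
  | zero => simpa using hG
  | succ k ih => rw [iteratedDeriv_succ']; exact ih (contDiff_deriv hG)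

/-- The `b`-derivative of the remainder of order `q + 1` of `G` is the remainder of order `q` of
`G'`, and the remainder vanishes at `b = 0`; the mean value inequality then raises the power of
`|b|` by one. Since `K` depends on `a` and `b` only through `B`, the bound is uniform in space. -/
lemma exists_taylor_bound (q : ℕ) (G : ℝ → ℝ) (hG : ContDiff ℝ ∞ G) (B : ℝ) :
    ∃ K, 0 ≤ K ∧ ∀ a b, |a| ≤ B → |b| ≤ B →
      |G (a + b) - ∑ k ∈ Finset.range q, (k.factorial : ℝ)⁻¹ * (iteratedDeriv k G a * b ^ k)|
        ≤ K * |b| ^ q := by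
  induction q generalizing G with
  | zero =>
    obtain ⟨K, hK⟩ := (isCompact_Icc (a := -(B + B)) (b := B + B)).exists_bound_of_continuousOn
      hG.continuous.continuousOn
    refine ⟨|K|, abs_nonneg K, fun a b ha hb => ?_⟩
    rw [abs_le] at ha hb
    simpa using (hK (a + b) ⟨by linarith, by linarith⟩).trans (le_abs_self K)
  | succ q ih =>
    obtain ⟨K, hK0, hK⟩ := ih (deriv G) (contDiff_deriv hG)
    refine ⟨K, hK0, fun a b ha hb => ?_⟩
    have hder : ∀ s, HasDerivAt (fun s => G (a + s) - ∑ k ∈ Finset.range (q + 1),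
        (k.factorial : ℝ)⁻¹ * (iteratedDeriv k G a * s ^ k))
        (deriv G (a + s) - ∑ k ∈ Finset.range q,
        (k.factorial : ℝ)⁻¹ * (iteratedDeriv k (deriv G) a * s ^ k)) s := by
      intro s
      have h1 : HasDerivAt (fun s => G (a + s)) (deriv G (a + s)) s :=
        ((hG.differentiable (by simp) (a + s)).hasDerivAt).comp_const_add a s
      refine h1.sub ?_
      have h2 : HasDerivAt (fun s => ∑ k ∈ Finset.range (q + 1),
          (k.factorial : ℝ)⁻¹ * (iteratedDeriv k G a * s ^ k))
          (∑ k ∈ Finset.range (q + 1), (k.factorial : ℝ)⁻¹ *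
            (iteratedDeriv k G a * (k * s ^ (k - 1)))) s :=
        HasDerivAt.fun_sum fun k _ => ((hasDerivAt_pow k s).const_mul _).const_mul _
      refine h2.congr_deriv ?_
      rw [Finset.sum_range_succ']
      simp only [Nat.cast_zero, zero_mul, mul_zero, add_zero, Nat.add_sub_cancel]
      refine Finset.sum_congr rfl fun k _ => ?_
      rw [iteratedDeriv_succ', Nat.factorial_succ]
      have : (k.factorial : ℝ) ≠ 0 := by positivity
      have : ((k : ℝ) + 1) ≠ 0 := by positivity
      push_cast
      field_simp
    have hb0 : b ∈ Icc (-|b|) |b| := ⟨neg_abs_le b, le_abs_self b⟩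
    have h00 : (0 : ℝ) ∈ Icc (-|b|) |b| := ⟨by simp, abs_nonneg b⟩
    have := (convex_Icc (-|b|) |b|).norm_image_sub_le_of_norm_hasDerivWithin_le (C := K * |b| ^ q)
      (fun s _ => (hder s).hasDerivWithinAt) (fun s hs => ?_) h00 hb0
    · have h0 : ∑ k ∈ Finset.range (q + 1),
          (k.factorial : ℝ)⁻¹ * (iteratedDeriv k G a * (0 : ℝ) ^ k) = G a := by
        rw [Finset.sum_range_succ']; simp
      rw [h0] at this
      simpa [pow_succ, mul_assoc] using this
    · have hs' : |s| ≤ |b| := abs_le.2 hs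
      exact (hK a s ha (hs'.trans hb)).trans (by gcongr)

/-- The remainder of the Taylor expansion of order `q` of `G (c + h)` at `c`. -/
def taylorRem (q : ℕ) (G : ℝ → ℝ) (hG : ContDiff ℝ ∞ G) (c h : P.smoothPeriodic) :
    P.smoothPeriodic :=
  comp G hG (c + h) - ∑ k ∈ Finset.range q, (k.factorial : ℝ)⁻¹ •
    (comp (iteratedDeriv k G) (contDiff_iteratedDeriv hG k) c * h ^ k)

lemma pderiv_pow_succ (j : Fin d) (h : P.smoothPeriodic) (k : ℕ) :
    P.pderiv j (h ^ (k + 1)) = (k + 1 : ℝ) • (h ^ k * P.pderiv j h) := by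
  induction k with
  | zero => simp
  | succ k ih =>
    rw [pow_succ, pderiv_mul, ih]
    ext x
    simp
    ring

lemma pderiv_taylorRem_zero (j : Fin d) (G : ℝ → ℝ) (hG : ContDiff ℝ ∞ G)
    (c h : P.smoothPeriodic) :
    P.pderiv j (taylorRem 0 G hG c h) =
      taylorRem 0 (deriv G) (contDiff_deriv hG) c h * (P.pderiv j c + P.pderiv j h) := by
  simp [taylorRem, pderiv_comp]

/-- A derivative lowers the order of the remainder only in the term that carries the factor `∂h`.
When `h` is `O(g)`, that factor restores the lost power of `g`, which closes the induction in
`IsO.taylorRem`. -/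
lemma pderiv_taylorRem_succ (j : Fin d) (q : ℕ) (G : ℝ → ℝ) (hG : ContDiff ℝ ∞ G)
    (c h : P.smoothPeriodic) :
    P.pderiv j (taylorRem (q + 1) G hG c h) =
      taylorRem (q + 1) (deriv G) (contDiff_deriv hG) c h * P.pderiv j c +
      taylorRem q (deriv G) (contDiff_deriv hG) c h * P.pderiv j h := by
  have h1 : ∑ k ∈ Finset.range (q + 1), P.pderiv j ((k.factorial : ℝ)⁻¹ •
      (comp (iteratedDeriv k G) (contDiff_iteratedDeriv hG k) c * h ^ k)) =
      (∑ k ∈ Finset.range (q + 1), (k.factorial : ℝ)⁻¹ •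
      (comp (iteratedDeriv k (deriv G)) (contDiff_iteratedDeriv (contDiff_deriv hG) k) c * h ^ k)) *
        P.pderiv j c +
      (∑ k ∈ Finset.range q, (k.factorial : ℝ)⁻¹ •
      (comp (iteratedDeriv k (deriv G)) (contDiff_iteratedDeriv (contDiff_deriv hG) k) c * h ^ k)) *
        P.pderiv j h := by
    rw [Finset.sum_range_succ', Finset.sum_range_succ' (n := q)]
    rw [add_mul, Finset.sum_mul, Finset.sum_mul, add_right_comm, ← Finset.sum_add_distrib]
    congr 1
    · refine Finset.sum_congr rfl fun k _ => ?_
      rw [map_smul, pderiv_mul, pderiv_pow_succ, pderiv_comp]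
      ext x
      simp only [coe_smul_apply, coe_add_apply, coe_mul_apply, comp_apply, coe_pow_apply,
        Nat.factorial_succ, ← iteratedDeriv_succ, ← iteratedDeriv_succ']
      have : (k.factorial : ℝ) ≠ 0 := by positivity
      have : ((k : ℝ) + 1) ≠ 0 := by positivity
      push_cast
      field_simp
    · rw [map_smul, pderiv_mul, pderiv_comp]
      ext x
      simp
  simp only [taylorRem, map_sub, map_sum, h1, pderiv_comp, map_add]
  ring

lemma IsO.taylorRem {c h : ι → P.smoothPeriodic} (q : ℕ) {G : ℝ → ℝ} (hG : ContDiff ℝ ∞ G)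
    (hc : IsO l (fun _ => (1 : ℝ)) c) (hh : IsO l g h) (hg : g =O[l] fun _ => (1 : ℝ)) :
    IsO l (fun i => g i ^ q) fun i => taylorRem q G hG (c i) (h i) := by
  have hh1 := hh.trans hg
  have base : ∀ (q : ℕ) (G : ℝ → ℝ) (hG : ContDiff ℝ ∞ G),
      (fun i => P.toBCF (PhaseField.taylorRem q G hG (c i) (h i))) =O[l] fun i => g i ^ q := by
    intro q G hG
    obtain ⟨B₁, hB₁⟩ := hc.base.bound
    obtain ⟨B₂, hB₂⟩ := hh1.base.bound
    obtain ⟨K, hK0, hK⟩ := exists_taylor_bound q G hG (max B₁ B₂)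
    have : (fun i => P.toBCF (PhaseField.taylorRem q G hG (c i) (h i))) =O[l]
        fun i => ‖P.toBCF (h i)‖ ^ q := by
      refine Asymptotics.IsBigO.of_bound K ?_
      filter_upwards [hB₁, hB₂] with i h1 h2
      rw [BoundedContinuousFunction.norm_le (by positivity)]
      intro x
      have hx1 := (P.toBCF (c i)).norm_coe_le_norm x
      have hx2 := (P.toBCF (h i)).norm_coe_le_norm x
      simp only [norm_one, mul_one, toBCF_apply, Real.norm_eq_abs] at h1 h2 hx1 hx2
      have := hK (c i x) (h i x) ((hx1.trans h1).trans (le_max_left _ _))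
        ((hx2.trans h2).trans (le_max_right _ _))
      rw [norm_pow, norm_norm]
      refine le_trans ?_ (this.trans (by gcongr))
      simp [PhaseField.taylorRem]
    exact this.trans (hh.base.norm_left.pow q)
  intro m
  induction m generalizing q G with
  | zero => exact base q G hG
  | succ m ih =>
    refine ⟨base q G hG, fun j => ?_⟩
    cases q with
    | zero =>
      simp only [pderiv_taylorRem_zero]
      simpa using (ih 0 (contDiff_deriv hG)).mul (((hc.pderiv j).add (hh1.pderiv j)) m)
    | succ q =>
      simp only [pderiv_taylorRem_succ]
      refine IsOm.add ?_ ?_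
      · simpa using (ih (q + 1) (contDiff_deriv hG)).mul (hc.pderiv j m)
      · simpa only [pow_succ] using (ih q (contDiff_deriv hG)).mul (hh.pderiv j m)

lemma IsO.comp {v : ι → P.smoothPeriodic} {G : ℝ → ℝ} (hG : ContDiff ℝ ∞ G)
    (hv : IsO l (fun _ => (1 : ℝ)) v) : IsO l (fun _ => (1 : ℝ)) fun i => comp G hG (v i) := by
  simpa [PhaseField.taylorRem] using
    IsO.taylorRem 0 hG hv (zero (g := fun _ => (1 : ℝ))) (Asymptotics.isBigO_refl _ _)

/-- The difference is the Taylor remainder of order one at `w`. -/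
lemma IsO.comp_sub_comp {v w : ι → P.smoothPeriodic} {G : ℝ → ℝ} (hG : ContDiff ℝ ∞ G)
    (hw : IsO l (fun _ => (1 : ℝ)) w) (hg : g =O[l] fun _ => (1 : ℝ))
    (hvw : IsO l g fun i => v i - w i) :
    IsO l g fun i => PhaseField.comp G hG (v i) - PhaseField.comp G hG (w i) := by
  have := IsO.taylorRem 1 hG hw hvw hg
  simp only [pow_one] at this
  refine this.congr' (.of_forall fun i => ?_)
  ext x
  simp [PhaseField.taylorRem]

end PhaseField

end

/-! ### Integration over the box and integration by parts -/

noncomputable section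

namespace PhaseField

variable {d : ℕ} {P : PhaseField d}

variable (P) in
lemma setIntegral_Ω {F : Type*} [NormedAddCommGroup F] [NormedSpace ℝ F] (f : Euc d → F) :
    ∫ x in P.Ω, f x = ∫ y in Set.pi univ fun i => Ioo (P.lo i) (P.hi i), f (WithLp.toLp 2 y) := by
  rw [← (PiLp.volume_preserving_toLp (Fin d)).setIntegral_preimage_emb
    (MeasurableEquiv.toLp 2 (Fin d → ℝ)).measurableEmbedding]
  congr 2
  ext y
  simp [Ω]

variable (P) in
lemma setIntegral_Ω_eq_Icc {F : Type*} [NormedAddCommGroup F] [NormedSpace ℝ F] (f : Euc d → F) :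
    ∫ x in P.Ω, f x = ∫ y in Icc P.lo P.hi, f (WithLp.toLp 2 y) := by
  rw [setIntegral_Ω]
  exact setIntegral_congr_set Measure.univ_pi_Ioo_ae_eq_Icc

lemma measurableSet_Ω : MeasurableSet P.Ω := by
  have : P.Ω = (MeasurableEquiv.toLp 2 (Fin d → ℝ)).symm ⁻¹'
      (Set.pi univ fun i => Ioo (P.lo i) (P.hi i)) := by
    ext x; simp [Ω]
  rw [this]
  exact (MeasurableEquiv.toLp 2 (Fin d → ℝ)).symm.measurable
    (MeasurableSet.univ_pi fun i => measurableSet_Ioo)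

lemma Ω_subset_closedBox : P.Ω ⊆ P.closedBox := fun _ hx i => Ioo_subset_Icc_self (hx i)

lemma integrableOn_Ω {F : Type*} [NormedAddCommGroup F] {f : Euc d → F} (hf : Continuous f) :
    IntegrableOn f P.Ω :=
  (hf.continuousOn.integrableOn_compact P.isCompact_closedBox).mono_set Ω_subset_closedBox

variable (P) in
/-- The integral over the box. -/
def int : P.smoothPeriodic →ₗ[ℝ] ℝ where
  toFun v := ∫ x in P.Ω, v x
  map_add' v w := integral_add (integrableOn_Ω (continuous_coe v)) (integrableOn_Ω (continuous_coe w))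
  map_smul' c _ := integral_const_mul c _

lemma int_apply (v : P.smoothPeriodic) : P.int v = ∫ x in P.Ω, v x := rfl

lemma int_mono {v w : P.smoothPeriodic} (h : ∀ x, v x ≤ w x) : P.int v ≤ P.int w :=
  integral_mono (integrableOn_Ω (continuous_coe v)) (integrableOn_Ω (continuous_coe w)) h

lemma int_nonneg {v : P.smoothPeriodic} (h : ∀ x, 0 ≤ v x) : 0 ≤ P.int v :=
  integral_nonneg h

lemma eq_zero_of_int_eq_zero {v : P.smoothPeriodic} (h0 : ∀ x, 0 ≤ v x) (h : P.int v = 0) :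
    v = 0 := by
  rw [int_apply, setIntegral_Ω_eq_Icc] at h
  have hc : Continuous fun y : Fin d → ℝ => v (WithLp.toLp 2 y) :=
    (continuous_coe v).comp (PiLp.continuous_toLp 2 _)
  have h1 := (integral_eq_zero_iff_of_nonneg (fun y => h0 _)
    (hc.continuousOn.integrableOn_compact isCompact_Icc)).1 h
  have h2 : EqOn (fun y : Fin d → ℝ => v (WithLp.toLp 2 y)) 0 (Icc P.lo P.hi) := by
    -- Almost everywhere zero becomes everywhere zero by continuity, because the closed box is the
    -- closure of its interior.
    refine Measure.eqOn_of_ae_eq h1 hc.continuousOn continuousOn_const ?_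
    rw [← Set.pi_univ_Icc, interior_pi_set finite_univ, closure_pi_set]
    refine Set.pi_mono fun i _ => ?_
    rw [interior_Icc, closure_Ioo (P.lo_lt_hi i).ne]
  ext x
  obtain ⟨y, hy, hxy⟩ := P.exists_mem_closedBox x
  rw [hxy _ (isPeriodic_coe v)]
  exact h2 (x := WithLp.ofLp y) ⟨fun i => (hy i).1, fun i => (hy i).2⟩

/-- Divergence theorem for the field whose only component is `v` in direction `i`: the two faces
orthogonal to `i` are a period apart, so their contributions cancel. -/
lemma int_pderiv (i : Fin d) (v : P.smoothPeriodic) : P.int (P.pderiv i v) = 0 := by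
  cases d with
  | zero => exact i.elim0
  | succ n =>
    rw [int_apply, setIntegral_Ω_eq_Icc]
    let V : (Fin (n + 1) → ℝ) → ℝ := fun y => v (WithLp.toLp 2 y)
    let V' : (Fin (n + 1) → ℝ) → (Fin (n + 1) → ℝ) →L[ℝ] ℝ := fun y =>
      (fderiv ℝ v (WithLp.toLp 2 y)).comp
        (EuclideanSpace.equiv (Fin (n + 1)) ℝ).symm.toContinuousLinearMap
    have hV : ∀ y, HasFDerivAt V (V' y) y := fun y =>
      (differentiable_coe v (WithLp.toLp 2 y)).hasFDerivAt.comp y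
        (EuclideanSpace.equiv (Fin (n + 1)) ℝ).symm.toContinuousLinearMap.hasFDerivAt
    have hVi : ∀ y, V' y (Pi.single i 1) = P.pderiv i v (WithLp.toLp 2 y) := fun y => rfl
    have key := integral_divergence_of_hasFDerivAt_off_countable' P.lo P.hi
      (fun j => (P.lo_lt_hi j).le) (fun j => if j = i then V else 0)
      (fun j => if j = i then V' else 0) ∅ countable_empty
      (fun j => by
        split_ifs
        · exact fun y _ => (hV y).continuousAt.continuousWithinAt
        · exact continuousOn_const)
      (fun y _ j => by
        split_ifs
        · exact hV y
        · exact hasFDerivAt_const 0 y)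
      (by
        have : (fun y => ∑ j, (if j = i then V' else 0) y (Pi.single j 1)) =
            fun y : Fin (n + 1) → ℝ => P.pderiv i v (WithLp.toLp 2 y) := by
          ext y
          rw [Finset.sum_eq_single i (fun j _ hj => by simp [hj]) (by simp), if_pos rfl, hVi]
        rw [this]
        exact ((continuous_coe _).comp (PiLp.continuous_toLp 2 _)).continuousOn.integrableOn_compact
          isCompact_Icc)
    have h1 : (fun y => ∑ j, (if j = i then V' else 0) y (Pi.single j 1)) =
        fun y : Fin (n + 1) → ℝ => P.pderiv i v (WithLp.toLp 2 y) := by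
      ext y
      rw [Finset.sum_eq_single i (fun j _ hj => by simp [hj]) (by simp), if_pos rfl, hVi]
    rw [h1] at key
    rw [key]
    refine Finset.sum_eq_zero fun j _ => ?_
    by_cases hj : j = i
    · subst hj
      simp only [if_true]
      rw [sub_eq_zero]
      refine integral_congr_ae (.of_forall fun y => ?_)
      change v _ = v _
      refine (congrArg (v : Euc (n + 1) → ℝ) ?_).trans
        (isPeriodic_coe v (WithLp.toLp 2 (j.insertNth (P.lo j) y)) j)
      ext k
      by_cases hk : k = j
      · subst hk; simp
      · obtain ⟨k, rfl⟩ := Fin.exists_succAbove_eq hk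
        simp
    · simp [hj]

lemma int_mul_pderiv (i : Fin d) (v w : P.smoothPeriodic) :
    P.int (v * P.pderiv i w) = -P.int (P.pderiv i v * w) := by
  have := int_pderiv i (v * w)
  rw [pderiv_mul, map_add] at this
  linarith

lemma int_mul_lap (v w : P.smoothPeriodic) :
    P.int (v * P.lap w) = -∑ i, P.int (P.pderiv i v * P.pderiv i w) := by
  rw [lap_eq, Finset.mul_sum, map_sum, ← Finset.sum_neg_distrib]
  exact Finset.sum_congr rfl fun i _ => int_mul_pderiv i v _

lemma int_mul_lap_comm (v w : P.smoothPeriodic) : P.int (v * P.lap w) = P.int (P.lap v * w) := by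
  rw [mul_comm (P.lap v), int_mul_lap, int_mul_lap]
  simp only [mul_comm]

/-- The sum of the squares of all partial derivatives of `v` along sublists of a list of
directions. -/
def sumSq : List (Fin d) → P.smoothPeriodic → P.smoothPeriodic
  | [], v => v * v
  | i :: is, v => sumSq is v + sumSq is (P.pderiv i v)

lemma sumSq_nonneg (is : List (Fin d)) (v : P.smoothPeriodic) (x : Euc d) : 0 ≤ sumSq is v x := by
  induction is generalizing v with
  | nil => exact mul_self_nonneg _
  | cons i is ih => exact add_nonneg (ih v) (ih _)

/-- One-dimensional Sobolev inequality along direction `i`. By periodicity the value is attained at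
some `s₀` in the interval. Since `|(v²)'| = 2 |v ∂v| ≤ v² + (∂v)²`, the value of `v²` at `s₀`
exceeds that at any `s` by at most the integral of the right-hand side; averaging over `s` gives the
constant. -/
lemma sq_le_integral (i : Fin d) (v : P.smoothPeriodic) (x : Fin d → ℝ) :
    v (WithLp.toLp 2 x) ^ 2 ≤ (1 + (P.hi i - P.lo i)) / (P.hi i - P.lo i) *
      ∫ s in P.lo i..P.hi i, (v * v + P.pderiv i v * P.pderiv i v : P.smoothPeriodic)
        (WithLp.toLp 2 (Function.update x i s)) := by
  set a := P.lo i
  set b := P.hi i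
  have hab : a < b := P.lo_lt_hi i
  let c : ℝ → Euc d := fun s => WithLp.toLp 2 (Function.update x i s)
  have hcd : ∀ s, HasDerivAt c (EuclideanSpace.single i 1) s := fun s =>
    (EuclideanSpace.equiv (Fin d) ℝ).symm.toContinuousLinearMap.hasFDerivAt.comp_hasDerivAt s
      (hasDerivAt_update x i s)
  have hc : Continuous c := continuous_iff_continuousAt.2 fun s => (hcd s).continuousAt
  have hd : ∀ s, HasDerivAt (fun s => v (c s) ^ 2) (2 * v (c s) * P.pderiv i v (c s)) s := fun s => by
    have h1 : HasDerivAt (fun s => v (c s)) (P.pderiv i v (c s)) s :=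
      (differentiable_coe v (c s)).hasFDerivAt.comp_hasDerivAt s (hcd s)
    exact (h1.pow 2).congr_deriv (by simp)
  set ψ : ℝ → ℝ := fun s => (v * v + P.pderiv i v * P.pderiv i v : P.smoothPeriodic) (c s) with hψ
  have hψ' : ∀ s, ψ s = v (c s) ^ 2 + P.pderiv i v (c s) ^ 2 := fun s => by simp [hψ, sq]
  have hψ0 : ∀ s, 0 ≤ ψ s := fun s => by rw [hψ']; positivity
  have hψc : Continuous ψ := (continuous_coe _).comp hc
  -- a point of the interval with the same value
  obtain ⟨s₀, hs₀, hvs₀⟩ : ∃ s₀ ∈ Icc a b, v (c s₀) = v (WithLp.toLp 2 x) := by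
    have hper : Function.Periodic (fun s => v (c s)) (b - a) := fun s => by
      have : c (s + (b - a)) = c s + EuclideanSpace.single i (b - a) := by
        ext k
        by_cases hk : k = i
        · subst hk; simp [c]
        · simp [c, hk]
      change v (c _) = _
      rw [this]; exact isPeriodic_coe v _ i
    obtain ⟨s₀, hs₀, h⟩ := hper.exists_mem_Ico (sub_pos.2 hab) (x i) a
    refine ⟨s₀, ⟨hs₀.1, by linarith [hs₀.2]⟩, ?_⟩
    rw [← h]; simp [c]
  have hint : ∀ p q, IntervalIntegrable ψ volume p q := fun p q => hψc.intervalIntegrable p q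
  have hv2 : Continuous fun s => v (c s) ^ 2 := ((continuous_coe v).comp hc).pow 2
  have hle : ∀ s ∈ Icc a b, v (c s₀) ^ 2 ≤ v (c s) ^ 2 + ∫ t in a..b, ψ t := by
    intro s hs
    have h1 : ∫ t in s..s₀, 2 * v (c t) * P.pderiv i v (c t) = v (c s₀) ^ 2 - v (c s) ^ 2 :=
      intervalIntegral.integral_eq_sub_of_hasDerivAt (fun t _ => hd t)
        (Continuous.intervalIntegrable (by
          exact ((continuous_const.mul ((continuous_coe v).comp hc))).mul
            ((continuous_coe _).comp hc)) _ _)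
    have h2 : |∫ t in s..s₀, 2 * v (c t) * P.pderiv i v (c t)| ≤ ∫ t in a..b, ψ t := by
      calc _ ≤ |∫ t in s..s₀, ψ t| := by
            rw [← Real.norm_eq_abs]
            refine intervalIntegral.norm_integral_le_abs_of_norm_le (.of_forall fun t => ?_) (hint _ _)
            · rw [hψ', Real.norm_eq_abs, abs_le]
              constructor <;> nlinarith [sq_nonneg (v (c t) + P.pderiv i v (c t)),
                sq_nonneg (v (c t) - P.pderiv i v (c t))]
        _ ≤ |∫ t in a..b, ψ t| := by
            refine intervalIntegral.abs_integral_mono_interval ?_ (.of_forall hψ0) (hint _ _)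
            rw [uIoc_of_le hab.le]
            exact fun t ht => ⟨lt_of_le_of_lt (le_min hs.1 hs₀.1) ht.1, ht.2.trans (max_le hs.2 hs₀.2)⟩
        _ = _ := abs_of_nonneg (intervalIntegral.integral_nonneg hab.le fun t _ => hψ0 t)
    linarith [le_abs_self (∫ t in s..s₀, 2 * v (c t) * P.pderiv i v (c t))]
  have h3 : ∫ s in a..b, v (c s₀) ^ 2 ≤ ∫ s in a..b, (v (c s) ^ 2 + ∫ t in a..b, ψ t) :=
    intervalIntegral.integral_mono_on hab.le (by simp)
      ((hv2.add continuous_const).intervalIntegrable _ _) hle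
  have h4 : ∫ s in a..b, v (c s) ^ 2 ≤ ∫ s in a..b, ψ s :=
    intervalIntegral.integral_mono_on hab.le
      (hv2.intervalIntegrable _ _) (hint _ _)
      fun s _ => by rw [hψ']; nlinarith [sq_nonneg (P.pderiv i v (c s))]
  rw [intervalIntegral.integral_add
    (hv2.intervalIntegrable _ _) (by simp),
    intervalIntegral.integral_const, intervalIntegral.integral_const, smul_eq_mul, smul_eq_mul] at h3
  rw [← hvs₀, div_mul_eq_mul_div, le_div_iff₀ (sub_pos.2 hab)]
  linarith

end PhaseField

end

/-! ### Sobolev inequality and resolvent estimate -/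

noncomputable section

namespace PhaseField

variable {d : ℕ} {P : PhaseField d}

lemma sq_le_lintegral (i : Fin d) : ∃ C : ENNReal, C ≠ ⊤ ∧ ∀ (v : P.smoothPeriodic) (x : Fin d → ℝ),
    ENNReal.ofReal (v (WithLp.toLp 2 x) ^ 2) ≤ C *
      ∫⁻ s, ENNReal.ofReal ((v * v + P.pderiv i v * P.pderiv i v : P.smoothPeriodic)
        (WithLp.toLp 2 (Function.update x i s))) ∂(volume.restrict (Ioo (P.lo i) (P.hi i))) := by
  refine ⟨ENNReal.ofReal ((1 + (P.hi i - P.lo i)) / (P.hi i - P.lo i)), ENNReal.ofReal_ne_top,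
    fun v x => ?_⟩
  have hab : 0 < P.hi i - P.lo i := sub_pos.2 (P.lo_lt_hi i)
  have hc : Continuous fun s => (v * v + P.pderiv i v * P.pderiv i v : P.smoothPeriodic)
      (WithLp.toLp 2 (Function.update x i s)) :=
    (continuous_coe _).comp ((PiLp.continuous_toLp 2 _).comp
      (continuous_const.update i continuous_id))
  rw [← ofReal_integral_eq_lintegral_ofReal, ← ENNReal.ofReal_mul (by positivity)]
  · refine ENNReal.ofReal_le_ofReal ((sq_le_integral i v x).trans_eq ?_)
    rw [intervalIntegral.integral_of_le (P.lo_lt_hi i).le, integral_Ioc_eq_integral_Ioo]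
  · exact (hc.continuousOn.integrableOn_compact isCompact_Icc).mono_set Ioo_subset_Icc_self
  · exact .of_forall fun s => add_nonneg (mul_self_nonneg _) (mul_self_nonneg _)

/-- The one-dimensional inequality is iterated, one direction at a time. Each direction doubles the
number of derivatives, which is how `sumSq` grows. With values in `ENNReal` the iterated integrals
need no integrability. -/
lemma sq_le_lmarginal (is : List (Fin d)) (hn : is.Nodup) : ∃ C : ENNReal, C ≠ ⊤ ∧
    ∀ (v : P.smoothPeriodic) (x : Fin d → ℝ),
    ENNReal.ofReal (v (WithLp.toLp 2 x) ^ 2) ≤ C *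
      lmarginal (fun i => volume.restrict (Ioo (P.lo i) (P.hi i))) is.toFinset
        (fun y => ENNReal.ofReal (sumSq is v (WithLp.toLp 2 y))) x := by
  induction is with
  | nil => exact ⟨1, by simp, fun v x => by simp [sumSq, sq]⟩
  | cons i is ih =>
    obtain ⟨hi, hn⟩ := List.nodup_cons.1 hn
    obtain ⟨C, hC, h⟩ := ih hn
    obtain ⟨C', hC', h'⟩ := sq_le_lintegral (P := P) i
    refine ⟨C' * C, ENNReal.mul_ne_top hC' hC, fun v x => ?_⟩
    have hmeas : ∀ w : P.smoothPeriodic,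
        Measurable fun y : Fin d → ℝ => ENNReal.ofReal (w (WithLp.toLp 2 y)) := fun w =>
      (((continuous_coe w).comp (PiLp.continuous_toLp 2 _)).measurable).ennreal_ofReal
    rw [List.toFinset_cons, lmarginal_insert _ (hmeas _) (by simpa using hi), mul_assoc]
    refine (h' v x).trans ?_
    gcongr C' * ?_
    rw [← lintegral_const_mul' _ _ hC]
    refine lintegral_mono fun s => ?_
    set z := Function.update x i s
    have hadd : ∀ w₁ w₂ : P.smoothPeriodic, (∀ x, 0 ≤ w₁ x) → (∀ x, 0 ≤ w₂ x) →
        lmarginal (fun i => volume.restrict (Ioo (P.lo i) (P.hi i))) is.toFinset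
          (fun y => ENNReal.ofReal ((w₁ + w₂) (WithLp.toLp 2 y))) z =
        lmarginal (fun i => volume.restrict (Ioo (P.lo i) (P.hi i))) is.toFinset
          (fun y => ENNReal.ofReal (w₁ (WithLp.toLp 2 y))) z +
        lmarginal (fun i => volume.restrict (Ioo (P.lo i) (P.hi i))) is.toFinset
          (fun y => ENNReal.ofReal (w₂ (WithLp.toLp 2 y))) z := by
      intro w₁ w₂ h1 h2
      simp only [lmarginal, coe_add_apply, ENNReal.ofReal_add (h1 _) (h2 _)]
      rw [lintegral_add_left]
      exact (hmeas w₁).comp (measurable_updateFinset)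
    change _ ≤ C * lmarginal _ is.toFinset (fun y => ENNReal.ofReal
      ((sumSq is v + sumSq is (P.pderiv i v)) (WithLp.toLp 2 y))) z
    rw [hadd _ _ (sumSq_nonneg is v) (sumSq_nonneg is _), mul_add, coe_add_apply, coe_mul_apply,
      coe_mul_apply, ENNReal.ofReal_add (mul_self_nonneg _) (mul_self_nonneg _)]
    have e1 := h v z
    have e2 := h (P.pderiv i v) z
    rw [sq] at e1 e2
    exact add_le_add e1 e2

-- All directions have been integrated, and the iterated integral is the one over the box. Only
-- mixed derivatives of order at most one in each direction enter.
variable (P) in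
lemma exists_sobolev : ∃ C : ℝ, 0 ≤ C ∧ ∀ (v : P.smoothPeriodic) (x : Euc d),
    v x ^ 2 ≤ C * P.int (sumSq (Finset.univ : Finset (Fin d)).toList v) := by
  obtain ⟨C, hC, h⟩ := sq_le_lmarginal (P := P) (Finset.univ : Finset (Fin d)).toList
    (Finset.nodup_toList _)
  refine ⟨C.toReal, ENNReal.toReal_nonneg, fun v x => ?_⟩
  have h1 := h v (WithLp.ofLp x)
  have hc : Continuous fun y : Fin d → ℝ =>
      sumSq (Finset.univ : Finset (Fin d)).toList v (WithLp.toLp 2 y) :=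
    (continuous_coe _).comp (PiLp.continuous_toLp 2 _)
  rw [Finset.toList_toFinset, lmarginal_univ, ← Measure.restrict_pi_pi,
    ← ofReal_integral_eq_lintegral_ofReal, ← ENNReal.ofReal_toReal hC,
    ← ENNReal.ofReal_mul ENNReal.toReal_nonneg] at h1
  · rw [int_apply, setIntegral_Ω]
    rw [ENNReal.ofReal_le_ofReal_iff] at h1
    · exact h1
    · exact mul_nonneg ENNReal.toReal_nonneg (integral_nonneg fun y => sumSq_nonneg _ _ _)
  · refine (hc.continuousOn.integrableOn_compact (isCompact_Icc (a := P.lo) (b := P.hi))).mono_set ?_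
    rw [← Set.pi_univ_Icc]
    exact Set.pi_mono fun i _ => Ioo_subset_Icc_self
  · exact .of_forall fun y => sumSq_nonneg _ _ _

/-- Pairing the equation with `e`, dissipativity gives `‖e‖² ≤ ⟨e, h⟩`, and `2 ⟨e, h⟩ ≤ ‖e‖² +
‖h‖²`. The bound does not depend on `κ`, so it survives for implicit stages as `τ → 0`. -/
lemma int_mul_self_le {L : P.smoothPeriodic →ₗ[ℝ] P.smoothPeriodic}
    (hL : ∀ v, P.int (v * L v) ≤ 0) {κ : ℝ} (hκ : 0 ≤ κ) {e h : P.smoothPeriodic}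
    (heq : e - κ • L e = h) : P.int (e * e) ≤ P.int (h * h) := by
  have h1 : P.int (e * e) - κ * P.int (e * L e) = P.int (e * h) := by
    rw [← heq, mul_sub, map_sub, mul_smul_comm, map_smul, smul_eq_mul]
  have h2 : 0 ≤ P.int ((e - h) * (e - h)) := int_nonneg fun x => mul_self_nonneg _
  have h3 : P.int ((e - h) * (e - h)) = P.int (e * e) - 2 * P.int (e * h) + P.int (h * h) := by
    rw [show (e - h) * (e - h) = e * e - (2 : ℝ) • (e * h) + h * h by
      ext x; simp; ring]
    simp
  nlinarith [mul_nonneg hκ (neg_nonneg.2 (hL e))]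

lemma pderiv_resolvent {L : P.smoothPeriodic →ₗ[ℝ] P.smoothPeriodic}
    (hc : ∀ i v, L (P.pderiv i v) = P.pderiv i (L v)) {κ : ℝ} {e h : P.smoothPeriodic}
    (heq : e - κ • L e = h) (i : Fin d) :
    P.pderiv i e - κ • L (P.pderiv i e) = P.pderiv i h := by
  rw [← heq, hc, map_sub, map_smul]

/-- Every derivative of `e` solves the resolvent equation with the same derivative of `h`, so the
`L²` bound applies to each summand. -/
lemma int_sumSq_le {L : P.smoothPeriodic →ₗ[ℝ] P.smoothPeriodic}
    (hL : ∀ v, P.int (v * L v) ≤ 0) (hc : ∀ i v, L (P.pderiv i v) = P.pderiv i (L v))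
    {κ : ℝ} (hκ : 0 ≤ κ) (is : List (Fin d)) {e h : P.smoothPeriodic} (heq : e - κ • L e = h) :
    P.int (sumSq is e) ≤ P.int (sumSq is h) := by
  induction is generalizing e h with
  | nil => exact int_mul_self_le hL hκ heq
  | cons i is ih =>
    simp only [sumSq, map_add]
    exact add_le_add (ih heq) (ih (pderiv_resolvent hc heq i))

variable {ι : Type*} {l : Filter ι} {g : ι → ℝ}

lemma norm_int_le (v : P.smoothPeriodic) : |P.int v| ≤ ‖P.toBCF v‖ * P.int 1 := by
  have h : ∀ x, |v x| ≤ ‖P.toBCF v‖ := fun x => (P.toBCF v).norm_coe_le_norm x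
  have h1 : P.int (‖P.toBCF v‖ • 1) = ‖P.toBCF v‖ * P.int 1 := by rw [map_smul, smul_eq_mul]
  rw [← h1, abs_le]
  constructor
  · rw [← map_neg]
    exact int_mono fun x => by simpa using (abs_le.1 (h x)).1
  · exact int_mono fun x => by simpa using (abs_le.1 (h x)).2

lemma IsO.int {v : ι → P.smoothPeriodic} (hv : IsO l g v) : (fun i => P.int (v i)) =O[l] g :=
  (Asymptotics.IsBigO.of_bound (P.int 1) (.of_forall fun i => by
    rw [mul_comm]; exact norm_int_le _)).trans hv.base

lemma IsO.sumSq {v : ι → P.smoothPeriodic} (is : List (Fin d)) (hv : IsO l g v) :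
    IsO l (fun i => g i * g i) fun i => sumSq is (v i) := by
  induction is generalizing v with
  | nil => exact hv.mul hv
  | cons i is ih => exact (ih hv).add (ih (hv.pderiv i))

/-- Uniform bounds for the solutions of `e - κ L e = h`, where `L` is dissipative and commutes with
the partial derivatives. -/
lemma IsO.resolvent {L : P.smoothPeriodic →ₗ[ℝ] P.smoothPeriodic}
    (hL : ∀ v, P.int (v * L v) ≤ 0) (hc : ∀ i v, L (P.pderiv i v) = P.pderiv i (L v))
    {κ : ι → ℝ} {e h : ι → P.smoothPeriodic} (hκ : ∀ᶠ i in l, 0 ≤ κ i)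
    (heq : ∀ᶠ i in l, e i - κ i • L (e i) = h i) (hh : IsO l g h) : IsO l g e := by
  intro m
  have base : ∀ e h : ι → P.smoothPeriodic, (∀ᶠ i in l, e i - κ i • L (e i) = h i) → IsO l g h →
      (fun i => P.toBCF (e i)) =O[l] g := by
    intro e h heq hh
    obtain ⟨C, hC0, hC⟩ := P.exists_sobolev
    obtain ⟨K, hK0, hK⟩ :=
      (hh.sumSq (Finset.univ : Finset (Fin d)).toList).int.exists_nonneg
    refine Asymptotics.IsBigO.of_bound (√(C * K)) ?_
    filter_upwards [heq, hκ, hK.bound] with i h1 h2 h3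
    rw [BoundedContinuousFunction.norm_le (by positivity)]
    intro x
    rw [toBCF_apply, Real.norm_eq_abs, ← Real.sqrt_sq_eq_abs, Real.norm_eq_abs,
      ← Real.sqrt_sq_eq_abs (g i), ← Real.sqrt_mul (by positivity)]
    refine Real.sqrt_le_sqrt ((hC (e i) x).trans ?_)
    rw [mul_assoc]
    gcongr
    refine (int_sumSq_le hL hc h2 _ h1).trans ((le_abs_self _).trans (h3.trans_eq ?_))
    rw [Real.norm_eq_abs, ← sq, abs_of_nonneg (sq_nonneg _)]
  induction m generalizing e h with
  | zero => exact base e h heq hh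
  | succ m ih =>
    exact ⟨base e h heq hh, fun j => ih (heq.mono fun i hi => pderiv_resolvent hc hi j)
      (hh.pderiv j)⟩

end PhaseField

end

/-! ### Asymptotic expansions in the step size -/

noncomputable section

namespace PhaseField

variable {d : ℕ} {P : PhaseField d} {β : Type}

/-- The filter of the pairs `(b, τ)` with `τ → 0+`, uniformly in `b`. -/
def smallStep (β : Type) : Filter (β × ℝ) := comap Prod.snd (𝓝[>] (0 : ℝ))

lemma tendsto_snd_smallStep : Tendsto Prod.snd (smallStep β) (𝓝[>] (0 : ℝ)) := tendsto_comap

lemma eventually_pos : ∀ᶠ z in smallStep β, 0 < z.2 :=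
  tendsto_snd_smallStep.eventually self_mem_nhdsWithin

lemma snd_isBigO_one : (fun z : β × ℝ => z.2) =O[smallStep β] fun _ => (1 : ℝ) := by
  have : Tendsto (fun z : β × ℝ => z.2) (smallStep β) (𝓝 0) :=
    tendsto_snd_smallStep.mono_right nhdsWithin_le_nhds
  exact this.isBigO_one ℝ

lemma snd_pow_isBigO_one (q : ℕ) : (fun z : β × ℝ => z.2 ^ q) =O[smallStep β] fun _ => (1 : ℝ) := by
  simpa using (snd_isBigO_one (β := β)).pow q

lemma snd_pow_isBigO_pow {q r : ℕ} (h : r ≤ q) :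
    (fun z : β × ℝ => z.2 ^ q) =O[smallStep β] fun z => z.2 ^ r := by
  obtain ⟨k, rfl⟩ := Nat.exists_eq_add_of_le h
  simpa [pow_add] using (Asymptotics.isBigO_refl (fun z : β × ℝ => z.2 ^ r) (smallStep β)).mul
    (snd_pow_isBigO_one k)

/-- The family `v` has an asymptotic expansion of order `q` in the step size, with coefficients whose
derivatives are all bounded, uniformly in the parameter. -/
def HasExp : ℕ → (β × ℝ → P.smoothPeriodic) → Prop
  | 0, v => IsO (smallStep β) (fun _ => (1 : ℝ)) v
  | q + 1, v => ∃ (c : β → P.smoothPeriodic) (w : β × ℝ → P.smoothPeriodic),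
      IsO ⊤ (fun _ => (1 : ℝ)) c ∧ HasExp q w ∧ v =ᶠ[smallStep β] fun z => c z.1 + z.2 • w z

namespace HasExp

variable {q : ℕ} {v w : β × ℝ → P.smoothPeriodic}

lemma congr' (h : HasExp q v) (hvw : v =ᶠ[smallStep β] w) : HasExp q w := by
  cases q with
  | zero => exact IsO.congr' h hvw
  | succ q =>
    obtain ⟨c, u, hc, hu, he⟩ := h
    exact ⟨c, u, hc, hu, hvw.symm.trans he⟩

lemma isO_fst {c : β → P.smoothPeriodic} (hc : IsO ⊤ (fun _ => (1 : ℝ)) c) :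
    IsO (smallStep β) (fun _ => (1 : ℝ)) fun z => c z.1 :=
  hc.comp_tendsto (k := Prod.fst) tendsto_top

lemma bdd (h : HasExp q v) : IsO (smallStep β) (fun _ => (1 : ℝ)) v := by
  induction q generalizing v with
  | zero => exact h
  | succ q ih =>
    obtain ⟨c, u, hc, hu, he⟩ := h
    refine IsO.congr' ?_ he.symm
    refine (isO_fst hc).add ?_
    simpa using IsO.smul snd_isBigO_one (ih hu)

lemma of_succ (h : HasExp (q + 1) v) : HasExp q v := by
  induction q generalizing v with
  | zero => exact h.bdd
  | succ q ih =>
    obtain ⟨c, u, hc, hu, he⟩ := h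
    exact ⟨c, u, hc, ih hu, he⟩

lemma zero : HasExp q fun _ : β × ℝ => (0 : P.smoothPeriodic) := by
  induction q with
  | zero => exact IsO.zero
  | succ q ih => exact ⟨fun _ => 0, fun _ => 0, IsO.zero, ih, .of_forall fun z => by simp⟩

lemma const {c : β → P.smoothPeriodic} (hc : IsO ⊤ (fun _ => (1 : ℝ)) c) :
    HasExp q fun z => c z.1 := by
  cases q with
  | zero => exact isO_fst hc
  | succ q => exact ⟨c, fun _ => 0, hc, zero, .of_forall fun z => by simp⟩

lemma add (hv : HasExp q v) (hw : HasExp q w) : HasExp q fun z => v z + w z := by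
  induction q generalizing v w with
  | zero => exact IsO.add hv hw
  | succ q ih =>
    obtain ⟨c, u, hc, hu, he⟩ := hv
    obtain ⟨c', u', hc', hu', he'⟩ := hw
    refine ⟨fun b => c b + c' b, fun z => u z + u' z, hc.add hc', ih hu hu', ?_⟩
    filter_upwards [he, he'] with z h1 h2
    rw [h1, h2, smul_add]; abel

lemma sum {κ : Type*} (s : Finset κ) {v : κ → β × ℝ → P.smoothPeriodic}
    (hv : ∀ k ∈ s, HasExp q (v k)) : HasExp q fun z => ∑ k ∈ s, v k z := by
  classical
  induction s using Finset.induction_on with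
  | empty => simpa using zero
  | insert k s hk ih =>
    simp only [Finset.sum_insert hk]
    exact (hv k (by simp)).add (ih fun k hk => hv k (by simp [hk]))

lemma map (hv : HasExp q v) (T : P.smoothPeriodic →ₗ[ℝ] P.smoothPeriodic)
    (hT : ∀ {ι : Type} {l : Filter ι} {v : ι → P.smoothPeriodic}, IsO l (fun _ => (1 : ℝ)) v →
      IsO l (fun _ => (1 : ℝ)) fun i => T (v i)) : HasExp q fun z => T (v z) := by
  induction q generalizing v with
  | zero => exact hT hv
  | succ q ih =>
    obtain ⟨c, u, hc, hu, he⟩ := hv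
    refine ⟨fun b => T (c b), fun z => T (u z), hT hc, ih hu, he.mono fun z hz => ?_⟩
    simp only [hz, map_add, map_smul]

lemma smul_snd (hv : HasExp q v) : HasExp (q + 1) fun z => z.2 • v z :=
  ⟨fun _ => 0, v, IsO.zero, hv, .of_forall fun z => by simp⟩

lemma smul_snd_pow (hv : HasExp q v) (k : ℕ) : HasExp q fun z => z.2 ^ k • v z := by
  induction k with
  | zero => simpa using hv
  | succ k ih =>
    simp only [pow_succ', mul_smul]
    exact ih.smul_snd.of_succ

lemma mul (hv : HasExp q v) (hw : HasExp q w) : HasExp q fun z => v z * w z := by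
  induction q generalizing v w with
  | zero => exact IsO.mul_bdd hv hw
  | succ q ih =>
    have hv0 := hv.of_succ
    have hw0 := hw.of_succ
    obtain ⟨c, u, hc, hu, he⟩ := hv
    obtain ⟨c', u', hc', hu', he'⟩ := hw
    -- With `w = c' + τ u'`, one has `(c + τ u) w = c c' + τ (c u' + u w)`.
    refine ⟨fun b => c b * c' b, fun z => c z.1 * u' z + u z * w z, hc.mul_bdd hc',
      (ih (const hc) hu').add (ih hu hw0), ?_⟩
    filter_upwards [he, he'] with z h1 h2
    rw [h1, h2]
    ext x
    simp
    ring

lemma pow (hv : HasExp q v) (k : ℕ) : HasExp q fun z => v z ^ k := by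
  induction k with
  | zero => simpa using const (c := fun _ : β => (1 : P.smoothPeriodic)) (IsO.const 1)
  | succ k ih => simpa only [pow_succ] using ih.mul hv

lemma const_smul (a : ℝ) (hv : HasExp q v) : HasExp q fun z => a • v z :=
  hv.map (a • LinearMap.id) fun h => h.const_smul a

/-- Dividing by `τ` lowers the exponent by one; all coefficients are taken to be zero. -/
lemma of_isO (hv : IsO (smallStep β) (fun z => z.2 ^ q) v) : HasExp q v := by
  induction q generalizing v with
  | zero => simpa [HasExp] using hv
  | succ q ih =>
    have h1 : IsO (smallStep β) (fun z => z.2 ^ q) fun z => z.2⁻¹ • v z := by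
      refine (IsO.smul (Asymptotics.isBigO_refl (fun z : β × ℝ => z.2⁻¹) _) hv).trans ?_
      refine Asymptotics.IsBigO.of_bound 1 ?_
      filter_upwards [eventually_pos] with z hz
      rw [pow_succ', inv_mul_cancel_left₀ hz.ne', one_mul]
    refine ((ih h1).smul_snd).congr' ?_
    filter_upwards [eventually_pos] with z hz
    rw [smul_inv_smul₀ hz.ne']

/-- Taylor expansion at the leading coefficient `c` with increment `τ u`. The remainder is
`O(τ^(q+1))`. Each term beyond the first has a factor `τ`, so the expansion of `u` of order `q`
suffices for it. -/
lemma comp {G : ℝ → ℝ} (hG : ContDiff ℝ ∞ G) (hv : HasExp q v) :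
    HasExp q fun z => PhaseField.comp G hG (v z) := by
  cases q with
  | zero => exact IsO.comp hG hv
  | succ q =>
    obtain ⟨c, u, hc, hu, he⟩ := hv
    have hrem : HasExp (q + 1) fun z : β × ℝ => taylorRem (q + 1) G hG (c z.1) (z.2 • u z) := by
      refine of_isO ?_
      have h1 : IsO (smallStep β) (fun z => z.2) fun z => z.2 • u z := by
        simpa using IsO.smul (Asymptotics.isBigO_refl (fun z : β × ℝ => z.2) _) hu.bdd
      exact IsO.taylorRem (q + 1) hG (isO_fst hc) h1 snd_isBigO_one
    have hterm : ∀ k ∈ Finset.range (q + 1), HasExp (q + 1) fun z : β × ℝ =>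
        (k.factorial : ℝ)⁻¹ • (PhaseField.comp (iteratedDeriv k G) (contDiff_iteratedDeriv hG k)
          (c z.1) * (z.2 • u z) ^ k) := by
      intro k _
      refine const_smul _ ?_
      cases k with
      | zero => simpa using const (q := q + 1) (IsO.comp (contDiff_iteratedDeriv hG 0) hc)
      | succ k =>
        have := ((((const (q := q) (IsO.comp (contDiff_iteratedDeriv hG (k + 1)) hc)).mul
          (hu.pow (k + 1)))).smul_snd_pow k).smul_snd
        refine this.congr' (.of_forall fun z => ?_)
        ext x
        simp
        ring
    refine (hrem.add (sum _ hterm)).congr' (he.mono fun z hz => ?_)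
    simp only [hz, taylorRem, sub_add_cancel]

lemma exists_expansion (hv : HasExp q v) : ∃ c : ℕ → β → P.smoothPeriodic,
    (∀ k, IsO ⊤ (fun _ => (1 : ℝ)) (c k)) ∧ IsO (smallStep β) (fun z => z.2 ^ q)
      fun z => v z - ∑ k ∈ Finset.range q, z.2 ^ k • c k z.1 := by
  induction q generalizing v with
  | zero => exact ⟨fun _ _ => 0, fun _ => IsO.zero, by simpa [HasExp] using hv⟩
  | succ q ih =>
    obtain ⟨c, u, hc, hu, he⟩ := hv
    obtain ⟨c', hc', hr⟩ := ih hu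
    refine ⟨fun k => Nat.casesOn k c c', fun k => by cases k <;> simp [hc, hc'], ?_⟩
    have := IsO.smul (Asymptotics.isBigO_refl (fun z : β × ℝ => z.2) _) hr
    simp only [← pow_succ'] at this
    refine this.congr' (he.mono fun z hz => ?_)
    simp only [hz, Finset.sum_range_succ', pow_succ', mul_smul, ← Finset.smul_sum, pow_zero, one_smul, smul_sub]
    change _ = c z.1 + _ - (_ + c z.1)
    abel

end HasExp

end PhaseField

end

/-! ### Smooth dependence on parameters, and tame operators -/

noncomputable section

namespace PhaseField

variable {d : ℕ} {P : PhaseField d}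

lemma continuous_setIntegral_Ω {Y F : Type*} [TopologicalSpace Y] [FirstCountableTopology Y]
    [LocallyCompactSpace Y] [NormedAddCommGroup F] [NormedSpace ℝ F] {f : Y × Euc d → F}
    (hf : Continuous f) : Continuous fun y => ∫ x in P.Ω, f (y, x) := by
  simp only [setIntegral_Ω_eq_Icc]
  exact continuous_parametric_integral_of_continuous
    (f := fun (y : Y) (x : Fin d → ℝ) => f (y, WithLp.toLp 2 x))
    (hf.comp (continuous_fst.prodMk ((PiLp.continuous_toLp 2 _).comp continuous_snd))) isCompact_Icc

/-- Differentiation under the integral, dominated by compactness of the unit ball times the closed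
box. The induction lets the value space `F` vary, because the derivative takes values in `Y →L[ℝ]
F`. -/
lemma contDiff_setIntegral_Ω {Y : Type} [NormedAddCommGroup Y] [NormedSpace ℝ Y]
    [FiniteDimensional ℝ Y] (n : ℕ) {F : Type} [NormedAddCommGroup F] [NormedSpace ℝ F]
    [CompleteSpace F] {f : Y × Euc d → F} (hf : ContDiff ℝ ∞ f) :
    ContDiff ℝ n fun y => ∫ x in P.Ω, f (y, x) := by
  have : ProperSpace Y := FiniteDimensional.proper ℝ Y
  induction n generalizing F with
  | zero => exact contDiff_zero.2 (continuous_setIntegral_Ω hf.continuous)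
  | succ n ih =>
    let f' : Y × Euc d → Y →L[ℝ] F := fun z => (fderiv ℝ f z).comp (.inl ℝ Y (Euc d))
    have hf' : ContDiff ℝ ∞ f' :=
      (hf.fderiv_right (m := ∞) (by simp)).clm_comp contDiff_const
    have hder : ∀ y x, HasFDerivAt (fun y => f (y, x)) (f' (y, x)) y := fun y x =>
      ((hf.differentiable (by simp) (y, x)).hasFDerivAt).comp y (hasFDerivAt_prodMk_left y x)
    have hI : ∀ y, HasFDerivAt (fun y => ∫ x in P.Ω, f (y, x)) (∫ x in P.Ω, f' (y, x)) y := by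
      intro y
      obtain ⟨C, hC⟩ := ((isCompact_closedBall y 1).prod
        P.isCompact_closedBox).exists_bound_of_continuousOn hf'.continuous.continuousOn
      refine hasFDerivAt_integral_of_dominated_of_fderiv_le (F := fun y x => f (y, x))
        (F' := fun y x => f' (y, x)) (bound := fun _ => C) (Metric.closedBall_mem_nhds y one_pos)
        (.of_forall fun y' => ?_) ?_ ?_ ?_ ?_ (.of_forall fun x y' _ => hder y' x)
      · exact (hf.continuous.comp (Continuous.prodMk_right y')).aestronglyMeasurable
      · exact integrableOn_Ω (hf.continuous.comp (Continuous.prodMk_right y))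
      · exact (hf'.continuous.comp (Continuous.prodMk_right y)).aestronglyMeasurable
      · refine (ae_restrict_iff' measurableSet_Ω).2 (.of_forall fun x hx y' hy' => ?_)
        exact hC _ ⟨hy', Ω_subset_closedBox hx⟩
      · exact integrableOn_Ω continuous_const
    push_cast
    rw [contDiff_succ_iff_hasFDerivAt]
    exact ⟨_, ih hf', hI⟩

/-- The family `v` of smooth periodic functions depends smoothly on the finite-dimensional
parameter. -/
def JointlySmooth {n : ℕ} (v : (Fin n → ℝ) → P.smoothPeriodic) : Prop :=
  ContDiff ℝ ∞ fun z : (Fin n → ℝ) × Euc d => v z.1 z.2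

namespace JointlySmooth

variable {n : ℕ} {v w : (Fin n → ℝ) → P.smoothPeriodic}

lemma add (hv : JointlySmooth v) (hw : JointlySmooth w) : JointlySmooth fun y => v y + w y :=
  ContDiff.add hv hw

lemma mul (hv : JointlySmooth v) (hw : JointlySmooth w) : JointlySmooth fun y => v y * w y :=
  ContDiff.mul hv hw

lemma const (v : P.smoothPeriodic) : JointlySmooth fun _ : Fin n → ℝ => v :=
  (contDiff_coe v).comp contDiff_snd

lemma sum {κ : Type*} (s : Finset κ) {v : κ → (Fin n → ℝ) → P.smoothPeriodic}
    (hv : ∀ k ∈ s, JointlySmooth (v k)) : JointlySmooth fun y => ∑ k ∈ s, v k y := by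
  classical
  induction s using Finset.induction_on with
  | empty => simpa using const 0
  | insert k s hk ih =>
    simp only [Finset.sum_insert hk]
    exact (hv k (by simp)).add (ih fun k hk => hv k (by simp [hk]))

lemma smul_const {c : (Fin n → ℝ) → ℝ} (hc : ContDiff ℝ ∞ c) (v : P.smoothPeriodic) :
    JointlySmooth fun y => c y • v :=
  (hc.comp contDiff_fst).mul (const v)

lemma pderiv (hv : JointlySmooth v) (i : Fin d) : JointlySmooth fun y => P.pderiv i (v y) := by
  have h1 : ContDiff ℝ ∞ (Function.uncurry fun (z : (Fin n → ℝ) × Euc d) (x : Euc d) => v z.1 x) :=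
    hv.comp (contDiff_fst.fst.prodMk contDiff_snd)
  have h2 : ContDiff ℝ ∞ fun z : (Fin n → ℝ) × Euc d => fderiv ℝ (v z.1) z.2 :=
    ContDiff.fderiv h1 contDiff_snd (by simp)
  exact h2.clm_apply contDiff_const

lemma comp {G : ℝ → ℝ} (hG : ContDiff ℝ ∞ G) (hv : JointlySmooth v) :
    JointlySmooth fun y => PhaseField.comp G hG (v y) :=
  ContDiff.comp hG hv

lemma int (hv : JointlySmooth v) :
    JointlySmooth fun y => algebraMap ℝ P.smoothPeriodic (P.int (v y)) := by
  have : ContDiff ℝ ∞ fun y => P.int (v y) :=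
    contDiff_infty.2 fun m => contDiff_setIntegral_Ω m hv
  exact this.comp contDiff_fst

lemma contDiff_apply (hv : JointlySmooth v) (x : Euc d) : ContDiff ℝ ∞ fun y => v y x :=
  ContDiff.comp hv (contDiff_id.prodMk contDiff_const)

end JointlySmooth

variable (P) in
/-- States: a smooth periodic function, and two numbers regarded as constant functions. -/
abbrev State := Fin 3 → P.smoothPeriodic

/-- Operators on smooth periodic functions that respect uniform bounds, asymptotic expansions and
smooth dependence on parameters. -/
structure Tame (Ψ : P.State → P.smoothPeriodic) : Prop where
  lip : ∀ {ι : Type} {l : Filter ι} {g : ι → ℝ} {v w : ι → P.State}, (g =O[l] fun _ => (1 : ℝ)) →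
    (∀ c, IsO l (fun _ => (1 : ℝ)) fun i => v i c) → (∀ c, IsO l (fun _ => (1 : ℝ)) fun i => w i c) →
    (∀ c, IsO l g fun i => v i c - w i c) → IsO l g fun i => Ψ (v i) - Ψ (w i)
  exp : ∀ {β : Type} {q : ℕ} {v : β × ℝ → P.State}, (∀ c, HasExp q fun z => v z c) →
    HasExp q fun z => Ψ (v z)
  smooth : ∀ {n : ℕ} {v : (Fin n → ℝ) → P.State}, (∀ c, JointlySmooth fun y => v y c) →
    JointlySmooth fun y => Ψ (v y)

namespace Tame

variable {Ψ Φ : P.State → P.smoothPeriodic}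

lemma bdd (h : Tame Ψ) {ι : Type} {l : Filter ι} {v : ι → P.State}
    (hv : ∀ c, IsO l (fun _ => (1 : ℝ)) fun i => v i c) :
    IsO l (fun _ => (1 : ℝ)) fun i => Ψ (v i) := by
  have := (h.lip (w := fun _ => 0) (Asymptotics.isBigO_refl _ _) hv (fun c => IsO.zero)
    (by simpa using hv)).add (IsO.const (l := l) (Ψ 0))
  simpa using this

lemma proj (c : Fin 3) : Tame fun v : P.State => v c :=
  ⟨fun _ _ _ h => h c, fun h => h c, fun h => h c⟩

lemma const (a : P.smoothPeriodic) : Tame fun _ : P.State => a :=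
  ⟨fun _ _ _ _ => by simpa using IsO.zero, fun _ => HasExp.const (IsO.const a),
    fun _ => JointlySmooth.const a⟩

lemma add (hΨ : Tame Ψ) (hΦ : Tame Φ) : Tame fun v => Ψ v + Φ v where
  lip hg hv hw h := by
    simpa only [add_sub_add_comm] using (hΨ.lip hg hv hw h).add (hΦ.lip hg hv hw h)
  exp h := (hΨ.exp h).add (hΦ.exp h)
  smooth h := (hΨ.smooth h).add (hΦ.smooth h)

lemma mul (hΨ : Tame Ψ) (hΦ : Tame Φ) : Tame fun v => Ψ v * Φ v where
  lip hg hv hw h := by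
    have := ((hΨ.lip hg hv hw h).mul_bdd (hΦ.bdd hv)).add
      ((hΦ.lip hg hv hw h).mul_bdd (hΨ.bdd hw))
    refine this.congr' (.of_forall fun i => ?_)
    ring
  exp h := (hΨ.exp h).mul (hΦ.exp h)
  smooth h := (hΨ.smooth h).mul (hΦ.smooth h)

lemma const_smul (a : ℝ) (hΨ : Tame Ψ) : Tame fun v => a • Ψ v := by
  simpa only [Algebra.smul_def] using (const (algebraMap ℝ P.smoothPeriodic a)).mul hΨ

lemma neg (hΨ : Tame Ψ) : Tame fun v => -Ψ v := by simpa using hΨ.const_smul (-1)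

lemma sum {κ : Type*} (s : Finset κ) {Ψ : κ → P.State → P.smoothPeriodic}
    (h : ∀ k ∈ s, Tame (Ψ k)) : Tame fun v => ∑ k ∈ s, Ψ k v := by
  classical
  induction s using Finset.induction_on with
  | empty => simpa using const 0
  | insert k s hk ih =>
    simp only [Finset.sum_insert hk]
    exact (h k (by simp)).add (ih fun k hk => h k (by simp [hk]))

lemma pderiv (hΨ : Tame Ψ) (i : Fin d) : Tame fun v => P.pderiv i (Ψ v) where
  lip hg hv hw h := by simpa only [map_sub] using (hΨ.lip hg hv hw h).pderiv i
  exp h := (hΨ.exp h).map _ fun h => h.pderiv i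
  smooth h := (hΨ.smooth h).pderiv i

lemma lap (hΨ : Tame Ψ) : Tame fun v => P.lap (Ψ v) := by
  simp only [lap_eq]
  exact sum _ fun i _ => (hΨ.pderiv i).pderiv i

lemma int (hΨ : Tame Ψ) : Tame fun v => algebraMap ℝ P.smoothPeriodic (P.int (Ψ v)) where
  lip hg hv hw h := by
    simpa only [map_sub, RingHom.map_sub] using IsO.algebraMap (hΨ.lip hg hv hw h).int
  exp h := (hΨ.exp h).map ((Algebra.linearMap ℝ P.smoothPeriodic).comp P.int) fun h =>
    IsO.algebraMap h.int
  smooth h := (hΨ.smooth h).int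

lemma comp {G : ℝ → ℝ} (hG : ContDiff ℝ ∞ G) (hΨ : Tame Ψ) :
    Tame fun v => PhaseField.comp G hG (Ψ v) where
  lip hg hv hw h := IsO.comp_sub_comp hG (hΨ.bdd hw) hg (hΨ.lip hg hv hw h)
  exp h := (hΨ.exp h).comp hG
  smooth h := (hΨ.smooth h).comp hG

end Tame

end PhaseField

end

/-! ### Formal solutions of the stage equations and of the differential equation -/

noncomputable section

namespace PhaseField

variable {d : ℕ} {P : PhaseField d} {β : Type}

/-- The filter of the pairs `(b, τ)` with `τ → 0+` and `τ ≤ H b`, uniformly in `b`. -/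
def stepWithin (H : β → ℝ) : Filter (β × ℝ) := smallStep β ⊓ 𝓟 {z | z.2 ≤ H z.1}

lemma smallStep_le_stepWithin_one : smallStep β ≤ stepWithin fun _ => 1 := by
  refine le_inf le_rfl (le_principal_iff.2 ?_)
  exact tendsto_snd_smallStep.eventually
    (mem_nhdsWithin_of_mem_nhds (Iic_mem_nhds one_pos))

lemma eventually_stepWithin {H : β → ℝ} {p : β × ℝ → Prop} :
    (∀ᶠ z in stepWithin H, p z) ↔ ∃ τ₀ > 0, ∀ b, ∀ τ ∈ Ioc 0 τ₀, τ ≤ H b → p (b, τ) := by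
  rw [stepWithin, eventually_inf_principal, smallStep, eventually_comap]
  constructor
  · intro h
    obtain ⟨ε, hε, h⟩ := mem_nhdsGT_iff_exists_Ioc_subset.1 h
    exact ⟨ε, hε, fun b τ hτ hH => h hτ (b, τ) rfl hH⟩
  · rintro ⟨ε, hε, h⟩
    filter_upwards [Ioc_mem_nhdsGT hε] with τ hτ z hz hH
    subst hz
    exact h z.1 z.2 hτ hH

/-- Up to the order `m`, the partial derivatives of `δ'` are the time derivatives of those of `δ`,
on the time intervals `[0, H b]`. -/
def IsTimeDerivOf (H : β → ℝ) : ℕ → (δ δ' : β × ℝ → P.smoothPeriodic) → Prop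
  | 0, δ, δ' => ∀ b, ∀ σ ∈ Icc 0 (H b), ∀ x,
      HasDerivWithinAt (fun s => δ (b, s) x) (δ' (b, σ) x) (Icc 0 (H b)) σ
  | m + 1, δ, δ' => (∀ b, ∀ σ ∈ Icc 0 (H b), ∀ x,
      HasDerivWithinAt (fun s => δ (b, s) x) (δ' (b, σ) x) (Icc 0 (H b)) σ) ∧
      ∀ i, IsTimeDerivOf H m (fun z => P.pderiv i (δ z)) fun z => P.pderiv i (δ' z)

/-- All partial derivatives of `δ'` are the time derivatives of those of `δ`. -/
def IsTimeDeriv (H : β → ℝ) (δ δ' : β × ℝ → P.smoothPeriodic) : Prop :=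
  ∀ m, IsTimeDerivOf H m δ δ'

namespace IsTimeDeriv

variable {H : β → ℝ} {δ δ' ε ε' : β × ℝ → P.smoothPeriodic}

lemma pderiv (h : IsTimeDeriv H δ δ') (i : Fin d) :
    IsTimeDeriv H (fun z => P.pderiv i (δ z)) fun z => P.pderiv i (δ' z) :=
  fun m => (h (m + 1)).2 i

lemma sub (h : IsTimeDeriv H δ δ') (h' : IsTimeDeriv H ε ε') :
    IsTimeDeriv H (fun z => δ z - ε z) fun z => δ' z - ε' z := by
  intro m
  induction m generalizing δ δ' ε ε' with
  | zero => exact fun b σ hσ x => (h 0 b σ hσ x).sub (h' 0 b σ hσ x)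
  | succ m ih =>
    refine ⟨fun b σ hσ x => (h 0 b σ hσ x).sub (h' 0 b σ hσ x), fun i => ?_⟩
    simpa only [map_sub] using ih (h.pderiv i) (h'.pderiv i)

lemma sum_smul {κ : Type*} (s : Finset κ) {a a' : κ → β × ℝ → ℝ}
    (ha : ∀ k ∈ s, ∀ b, ∀ σ ∈ Icc 0 (H b),
      HasDerivWithinAt (fun t => a k (b, t)) (a' k (b, σ)) (Icc 0 (H b)) σ)
    (φ : κ → β → P.smoothPeriodic) :
    IsTimeDeriv H (fun z => ∑ k ∈ s, a k z • φ k z.1) fun z => ∑ k ∈ s, a' k z • φ k z.1 := by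
  have base : ∀ (φ : κ → β → P.smoothPeriodic) b, ∀ σ ∈ Icc 0 (H b), ∀ x,
      HasDerivWithinAt (fun t => (∑ k ∈ s, a k (b, t) • φ k b : P.smoothPeriodic) x)
        ((∑ k ∈ s, a' k (b, σ) • φ k b : P.smoothPeriodic) x) (Icc 0 (H b)) σ := by
    intro φ b σ hσ x
    simp only [coe_sum_apply, coe_smul_apply]
    exact HasDerivWithinAt.fun_sum fun k hk => (ha k hk b σ hσ).mul_const _
  intro m
  induction m generalizing φ with
  | zero => exact base φ
  | succ m ih =>
    refine ⟨base φ, fun i => ?_⟩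
    simpa only [map_sum, map_smul] using ih fun k b => P.pderiv i (φ k b)

/-- Mean value theorem in time. The bound on `δ'` is available at the intermediate time `σ` because
eventual validity along `stepWithin` means validity on a whole interval `(0, τ₀]`, uniformly in the
parameter. -/
lemma isO (h : IsTimeDeriv H δ δ') (h0 : ∀ b, δ (b, 0) = 0) {n : ℕ}
    (hO : IsO (stepWithin H) (fun z => z.2 ^ n) δ') :
    IsO (stepWithin H) (fun z => z.2 ^ (n + 1)) δ := by
  have base : ∀ {δ δ' : β × ℝ → P.smoothPeriodic}, IsTimeDeriv H δ δ' → (∀ b, δ (b, 0) = 0) →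
      IsO (stepWithin H) (fun z => z.2 ^ n) δ' →
      (fun z => P.toBCF (δ z)) =O[stepWithin H] fun z => z.2 ^ (n + 1) := by
    intro δ δ' h h0 hO
    obtain ⟨K, hK0, hK⟩ := hO.base.exists_nonneg
    obtain ⟨τ₀, hτ₀, hb⟩ := eventually_stepWithin.1 hK.bound
    refine Asymptotics.IsBigO.of_bound K (eventually_stepWithin.2 ⟨τ₀, hτ₀, fun b τ hτ hH => ?_⟩)
    rw [BoundedContinuousFunction.norm_le (by positivity)]
    intro x
    obtain ⟨σ, hσ, hσ'⟩ := exists_hasDerivAt_eq_slope (fun s => δ (b, s) x)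
      (fun s => δ' (b, s) x) hτ.1
      (fun s hs => ((h 0 b s ⟨hs.1, hs.2.trans hH⟩ x).continuousWithinAt).mono
        (Icc_subset_Icc_right hH))
      (fun s hs => (h 0 b s ⟨hs.1.le, hs.2.le.trans hH⟩ x).hasDerivAt
        (Icc_mem_nhds hs.1 (hs.2.trans_le hH)))
    simp only [h0, coe_zero_apply, sub_zero] at hσ'
    have h1 : δ (b, τ) x = δ' (b, σ) x * τ := by
      rw [hσ', div_mul_cancel₀ _ hτ.1.ne']
    have h2 : ‖δ' (b, σ) x‖ ≤ K * τ ^ n := by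
      refine ((P.toBCF (δ' (b, σ))).norm_coe_le_norm x).trans
        ((hb b σ ⟨hσ.1, hσ.2.le.trans hτ.2⟩ (hσ.2.le.trans hH)).trans ?_)
      have := hσ.1.le
      rw [norm_pow, Real.norm_of_nonneg this]
      gcongr
      exact hσ.2.le
    have := hτ.1.le
    rw [toBCF_apply, h1, norm_mul, norm_pow, Real.norm_of_nonneg this, pow_succ, ← mul_assoc]
    gcongr
  intro m
  induction m generalizing δ δ' with
  | zero => exact base h h0 hO
  | succ m ih =>
    exact ⟨base h h0 hO, fun i => ih (h.pderiv i) (fun b => by rw [h0, map_zero]) (hO.pderiv i)⟩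

end IsTimeDeriv

/-- The polynomial in the step size with the coefficients `c k`, `k < n`. -/
def poly (n : ℕ) (c : ℕ → β → P.State) (z : β × ℝ) : P.State :=
  ∑ k ∈ Finset.range n, z.2 ^ k • c k z.1

/-- The derivative of `poly (n + 1) c` with respect to the step size. -/
def polyDeriv (n : ℕ) (c : ℕ → β → P.State) (z : β × ℝ) : P.State :=
  ∑ k ∈ Finset.range n, (k + 1 : ℝ) • z.2 ^ k • c (k + 1) z.1

lemma poly_apply (n : ℕ) (c : ℕ → β → P.State) (z : β × ℝ) (j : Fin 3) :
    poly n c z j = ∑ k ∈ Finset.range n, z.2 ^ k • c k z.1 j := by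
  simp [poly]

lemma polyDeriv_apply (n : ℕ) (c : ℕ → β → P.State) (z : β × ℝ) (j : Fin 3) :
    polyDeriv n c z j = ∑ k ∈ Finset.range n, (k + 1 : ℝ) • z.2 ^ k • c (k + 1) z.1 j := by
  simp [polyDeriv]

/-- The coefficients and all their derivatives are bounded, uniformly in the parameter. -/
def BddCoeffs (c : ℕ → β → P.State) : Prop :=
  ∀ k j, IsO ⊤ (fun _ => (1 : ℝ)) fun b => c k b j

lemma BddCoeffs.hasExp {c : ℕ → β → P.State} (hc : BddCoeffs c) (n q : ℕ) (j : Fin 3) :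
    HasExp q fun z => poly n c z j := by
  simp only [poly_apply]
  exact HasExp.sum _ fun k _ => (HasExp.const (hc k j)).smul_snd_pow k

lemma isTimeDeriv_poly (H : β → ℝ) (n : ℕ) (c : ℕ → β → P.State) (j : Fin 3) :
    IsTimeDeriv H (fun z => poly (n + 1) c z j) fun z => polyDeriv n c z j := by
  have := IsTimeDeriv.sum_smul (P := P) (H := H) (Finset.range (n + 1))
    (a := fun k z => z.2 ^ k) (a' := fun k z => k * z.2 ^ (k - 1))
    (fun k _ b σ _ => (hasDerivAt_pow k σ).hasDerivWithinAt) fun k b => c k b j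
  convert this using 2 with z z
  · exact poly_apply _ _ _ _
  · rw [polyDeriv_apply, Finset.sum_range_succ']
    simp [smul_smul]

lemma poly_zero (n : ℕ) (c : ℕ → β → P.State) (b : β) : poly (n + 1) c (b, 0) = c 0 b := by
  simp [poly, Finset.sum_range_succ']

lemma exists_coeffs {q : ℕ} {v : β × ℝ → P.State} (hv : ∀ j, HasExp q fun z => v z j) :
    ∃ c : ℕ → β → P.State, BddCoeffs c ∧
      ∀ j, IsO (smallStep β) (fun z => z.2 ^ q) fun z => v z j - poly q c z j := by
  choose c hc hr using fun j => (hv j).exists_expansion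
  exact ⟨fun k b j => c j k b, fun k j => hc j k, fun j => by simpa only [poly_apply] using hr j⟩

/-- The right-hand side of the stage equations. -/
def stageMap {κ : Type} [Fintype κ] (A A' : κ → κ → ℝ) (f g : P.State → P.State)
    (Y : κ → P.State) (i : κ) : P.State :=
  ∑ k, (A i k • f (Y k) + A' i k • g (Y k))

lemma stageMap_apply {κ : Type} [Fintype κ] (A A' : κ → κ → ℝ) (f g : P.State → P.State)
    (Y : κ → P.State) (i : κ) (j : Fin 3) :
    stageMap A A' f g Y i j = ∑ k, (A i k • f (Y k) j + A' i k • g (Y k) j) := by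
  simp [stageMap]

section

variable {κ : Type} [Fintype κ] {A A' : κ → κ → ℝ} {f g : P.State → P.State}

lemma stageMap_hasExp (hf : ∀ j, Tame fun v => f v j) (hg : ∀ j, Tame fun v => g v j) {q : ℕ}
    {Y : κ → β × ℝ → P.State} (hY : ∀ k j, HasExp q fun z => Y k z j) (i : κ) (j : Fin 3) :
    HasExp q fun z => stageMap A A' f g (fun k => Y k z) i j := by
  simp only [stageMap_apply]
  exact HasExp.sum _ fun k _ => (((hf j).exp (hY k)).const_smul _).add
    (((hg j).exp (hY k)).const_smul _)

lemma stageMap_lip (hf : ∀ j, Tame fun v => f v j) (hg : ∀ j, Tame fun v => g v j)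
    {ι : Type} {l : Filter ι} {γ : ι → ℝ} (hγ : γ =O[l] fun _ => (1 : ℝ))
    {Y Z : κ → ι → P.State} (hY : ∀ k j, IsO l (fun _ => (1 : ℝ)) fun z => Y k z j)
    (hZ : ∀ k j, IsO l (fun _ => (1 : ℝ)) fun z => Z k z j)
    (h : ∀ k j, IsO l γ fun z => Y k z j - Z k z j) (i : κ) (j : Fin 3) :
    IsO l γ fun z => stageMap A A' f g (fun k => Y k z) i j -
      stageMap A A' f g (fun k => Z k z) i j := by
  simp only [stageMap_apply, ← Finset.sum_sub_distrib, add_sub_add_comm, ← smul_sub]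
  exact IsO.sum _ fun k _ => (((hf j).lip hγ (hY k) (hZ k) (h k)).const_smul _).add
    (((hg j).lip hγ (hY k) (hZ k) (h k)).const_smul _)

/-- Polynomials that satisfy the stage equations up to any order. -/
lemma exists_formal_stages (hf : ∀ j, Tame fun v => f v j) (hg : ∀ j, Tame fun v => g v j)
    {z₀ : β → P.State} (hz₀ : ∀ j, IsO ⊤ (fun _ => (1 : ℝ)) fun b => z₀ b j) (n : ℕ) :
    ∃ c : κ → ℕ → β → P.State, (∀ i, BddCoeffs (c i)) ∧ ∀ i j, IsO (smallStep β) (fun z => z.2 ^ n)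
      fun z => poly n (c i) z j -
        (z₀ z.1 j + z.2 • stageMap A A' f g (fun k => poly n (c k) z) i j) := by
  induction n with
  | zero =>
    refine ⟨fun _ _ _ => 0, fun i k j => IsO.zero, fun i j => ?_⟩
    simp only [pow_zero]
    refine (IsO.sub ?_ ((HasExp.isO_fst (hz₀ j)).add ?_))
    · simpa [poly] using IsO.zero
    · simpa using IsO.smul (snd_isBigO_one (β := β)) (stageMap_hasExp (q := 0) hf hg
        (Y := fun k z => poly 0 (fun _ _ => 0) z) (fun k j => by simpa [poly] using HasExp.zero) i j).bdd
  | succ n ih =>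
    obtain ⟨c, hc, hr⟩ := ih
    choose e he hre using fun i => exists_coeffs
      (stageMap_hasExp (A := A) (A' := A') hf hg (Y := fun k z => poly n (c k) z)
        (fun k j => (hc k).hasExp n n j) i)
    -- Picard iteration: the new polynomial is `z₀ + τ` times the expansion of the stage map at the
    -- old one.
    let c' : κ → ℕ → β → P.State := fun i k => Nat.casesOn k z₀ (e i)
    have hc' : ∀ i, BddCoeffs (c' i) := fun i k j => by
      cases k with
      | zero => exact hz₀ j
      | succ k => exact he i k j
    have hpoly : ∀ i z j, poly (n + 1) (c' i) z j = z₀ z.1 j + z.2 • poly n (e i) z j := by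
      intro i z j
      rw [poly_apply, poly_apply, Finset.sum_range_succ', Finset.smul_sum]
      simp only [pow_succ', mul_smul, pow_zero, one_smul]
      rw [add_comm]
      rfl
    have h1 : ∀ i j, IsO (smallStep β) (fun z => z.2 ^ (n + 1)) fun z => poly (n + 1) (c' i) z j -
        (z₀ z.1 j + z.2 • stageMap A A' f g (fun k => poly n (c k) z) i j) := by
      intro i j
      have := (IsO.smul (Asymptotics.isBigO_refl (fun z : β × ℝ => z.2) _) (hre i j)).neg
      simp only [← pow_succ'] at this
      refine this.congr' (.of_forall fun z => ?_)
      simp only [hpoly, smul_sub]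
      abel
    have h2 : ∀ i j, IsO (smallStep β) (fun z => z.2 ^ n) fun z =>
        poly n (c i) z j - poly (n + 1) (c' i) z j := by
      intro i j
      refine ((hr i j).sub ((h1 i j).trans (snd_pow_isBigO_pow n.le_succ))).congr'
        (.of_forall fun z => ?_)
      abel_nf
    refine ⟨c', hc', fun i j => ?_⟩
    -- Old and new polynomials agree up to `τ^n`, hence so do their stage maps; the factor `τ` in
    -- front supplies the missing power.
    have h3 := stageMap_lip (A := A) (A' := A') hf hg (snd_pow_isBigO_one n)
      (Y := fun k z => poly n (c k) z) (Z := fun k z => poly (n + 1) (c' k) z)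
      (fun k j => ((hc k).hasExp n 0 j).bdd) (fun k j => ((hc' k).hasExp (n + 1) 0 j).bdd) h2 i j
    have h4 := IsO.smul (Asymptotics.isBigO_refl (fun z : β × ℝ => z.2) _) h3
    simp only [← pow_succ'] at h4
    refine ((h1 i j).add h4).congr' (.of_forall fun z => ?_)
    simp only [smul_sub]
    abel

/-- Polynomials that satisfy the differential equation up to any order. -/
lemma exists_formal_solution {h : P.State → P.State} (hh : ∀ j, Tame fun v => h v j)
    {z₀ : β → P.State} (hz₀ : ∀ j, IsO ⊤ (fun _ => (1 : ℝ)) fun b => z₀ b j) (n : ℕ) :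
    ∃ c : ℕ → β → P.State, BddCoeffs c ∧ c 0 = z₀ ∧ ∀ j, IsO (smallStep β) (fun z => z.2 ^ n)
      fun z => polyDeriv n c z j - h (poly (n + 1) c z) j := by
  induction n with
  | zero =>
    refine ⟨fun _ => z₀, fun _ => hz₀, rfl, fun j => ?_⟩
    simp only [pow_zero]
    refine IsO.sub (by simpa [polyDeriv] using IsO.zero) ?_
    exact (hh j).bdd fun j => (BddCoeffs.hasExp (fun _ => hz₀) 1 0 j).bdd
  | succ n ih =>
    obtain ⟨c, hc, hc0, hr⟩ := ih
    obtain ⟨e, he, hre⟩ := exists_coeffs (q := n + 1)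
      (v := fun z => h (poly (n + 1) c z)) fun j => (hh j).exp fun j => hc.hasExp _ _ j
    -- The factor `(k + 1)⁻¹` integrates the expansion of `h (poly (n + 1) c)` term by term.
    let c' : ℕ → β → P.State := fun k =>
      Nat.casesOn k z₀ fun k b => (k + 1 : ℝ)⁻¹ • e k b
    have hc' : BddCoeffs c' := fun k j => by
      cases k with
      | zero => exact hz₀ j
      | succ k => exact (he k j).const_smul _
    have hder : ∀ z, polyDeriv (n + 1) c' z = poly (n + 1) e z := by
      intro z
      refine Finset.sum_congr rfl fun k _ => ?_
      change (k + 1 : ℝ) • z.2 ^ k • (k + 1 : ℝ)⁻¹ • e k z.1 = _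
      rw [smul_comm (z.2 ^ k), smul_inv_smul₀ (by positivity)]
    have h1 : ∀ j, IsO (smallStep β) (fun z => z.2 ^ (n + 1)) fun z =>
        polyDeriv (n + 1) c' z j - h (poly (n + 1) c z) j := by
      intro j
      refine (hre j).neg.congr' (.of_forall fun z => ?_)
      simp only [hder]
      abel
    have h2 : ∀ j, IsO (smallStep β) (fun z => z.2 ^ (n + 1)) fun z =>
        poly (n + 2) c' z j - poly (n + 1) c z j := by
      intro j
      -- The two polynomials start at `z₀` and their time derivatives differ by `O(τ^n)`, so
      -- integration gives one more power.
      have hd : IsTimeDeriv (fun _ => 1) (fun z => poly (n + 2) c' z j - poly (n + 1) c z j)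
          fun z => polyDeriv (n + 1) c' z j - polyDeriv n c z j :=
        (isTimeDeriv_poly _ (n + 1) c' j).sub (isTimeDeriv_poly _ n c j)
      have hdO : IsO (smallStep β) (fun z => z.2 ^ n) fun z =>
          polyDeriv (n + 1) c' z j - polyDeriv n c z j :=
        (((h1 j).trans (snd_pow_isBigO_pow n.le_succ)).sub (hr j)).congr'
          (.of_forall fun z => sub_sub_sub_cancel_right _ _ _)
      refine (hd.isO (fun b => ?_) (hdO.mono inf_le_left)).mono smallStep_le_stepWithin_one
      rw [poly_zero, poly_zero, hc0]
      exact sub_self _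
    refine ⟨c', hc', rfl, fun j => ?_⟩
    have h3 := (hh j).lip (snd_pow_isBigO_one (n + 1))
      (v := fun z => poly (n + 2) c' z) (w := fun z => poly (n + 1) c z)
      (fun j => (hc'.hasExp _ 0 j).bdd) (fun j => (hc.hasExp _ 0 j).bdd) h2
    exact ((h1 j).sub h3).congr' (.of_forall fun z => sub_sub_sub_cancel_right _ _ _)

end

end PhaseField

end

/-! ### Interpolation, and solvability of stage equations in finite dimension -/

noncomputable section

/-- On a finite-dimensional space, finitely many functionals of a separating family determine the
vectors linearly. -/
lemma exists_interpolation {X Q : Type*} [AddCommGroup X] [Module ℝ X] (ev : Q → X →ₗ[ℝ] ℝ)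
    (hev : ∀ v, (∀ q, ev q v = 0) → v = 0) (V : Submodule ℝ X) [FiniteDimensional ℝ V] :
    ∃ (n : ℕ) (q : Fin n → Q) (φ : Fin n → X), ∀ v ∈ V, ∑ k, ev (q k) v • φ k = v := by
  induction hN : Module.finrank ℝ V using Nat.strong_induction_on generalizing V with
  | _ N ih =>
  by_cases hV : ∀ v ∈ V, v = 0
  · exact ⟨0, Fin.elim0, Fin.elim0, fun v hv => by simp [hV v hv]⟩
  push Not at hV
  obtain ⟨v₀, hv₀, hne⟩ := hV
  obtain ⟨q₀, hq₀⟩ : ∃ q, ev q v₀ ≠ 0 := by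
    by_contra! hcon
    exact hne (hev v₀ hcon)
  have hlt : V ⊓ LinearMap.ker (ev q₀) < V :=
    lt_of_le_of_ne inf_le_left fun h => hq₀ ((h.symm ▸ hv₀ : v₀ ∈ V ⊓ LinearMap.ker (ev q₀)).2)
  have : FiniteDimensional ℝ (V ⊓ LinearMap.ker (ev q₀) : Submodule ℝ X) :=
    Submodule.finiteDimensional_of_le inf_le_left
  obtain ⟨n, q, φ, h⟩ := ih _ (hN ▸ Submodule.finrank_lt_finrank_of_lt hlt) _ rfl
  set a := ev q₀ v₀
  -- The new vector is `v₀` minus its old interpolant, divided by `ev q₀ v₀`. Subtracting the right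
  -- multiple of `v₀` moves `v` into the kernel of `ev q₀`, where the old interpolation is exact.
  refine ⟨n + 1, Fin.cons q₀ q, Fin.cons (a⁻¹ • (v₀ - ∑ k, ev (q k) v₀ • φ k)) φ,
    fun v hv => ?_⟩
  have hw := h (v - (ev q₀ v * a⁻¹) • v₀) ⟨V.sub_mem hv (V.smul_mem _ hv₀),
    LinearMap.mem_ker.2 (by
      rw [map_sub, map_smul, smul_eq_mul, mul_assoc, inv_mul_cancel₀ hq₀, mul_one, sub_self])⟩
  rw [Fin.sum_univ_succ]
  simp only [Fin.cons_zero, Fin.cons_succ, map_sub, map_smul, smul_eq_mul, sub_smul,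
    Finset.sum_sub_distrib, mul_smul, ← Finset.smul_sum] at hw ⊢
  rw [sub_eq_iff_eq_add] at hw
  rw [hw, smul_sub, smul_sub]
  abel

/-- Implicit stage equations are solvable for small step sizes. -/
lemma exists_small_solution {W : Type*} [NormedAddCommGroup W] [NormedSpace ℝ W] [CompleteSpace W]
    {G : W → W} (hG : ContDiff ℝ ∞ G) (w₀ : W) :
    ∃ Y : ℝ → W, Tendsto Y (𝓝 0) (𝓝 w₀) ∧ ∀ᶠ τ in 𝓝 0, Y τ = w₀ + τ • G (Y τ) := by
  let F : ℝ × W → W := fun u => u.2 - w₀ - u.1 • G u.2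
  have hF : ContDiff ℝ ∞ F :=
    (contDiff_snd.sub contDiff_const).sub (contDiff_fst.smul (hG.comp contDiff_snd))
  -- At `τ = 0` the equation is `w = w₀`, whose derivative in `w` is the identity; the implicit
  -- function theorem applies.
  have hinv : (fderiv ℝ F (0, w₀) ∘L .inr ℝ ℝ W).IsInvertible := by
    have h1 : HasFDerivAt (fun w => F (0, w)) (fderiv ℝ F (0, w₀) ∘L .inr ℝ ℝ W) w₀ :=
      ((hF.differentiable (by simp) (0, w₀)).hasFDerivAt).comp w₀ (hasFDerivAt_prodMk_right 0 w₀)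
    have h2 : HasFDerivAt (fun w => F (0, w)) (ContinuousLinearMap.id ℝ W) w₀ := by
      simpa [F] using (hasFDerivAt_id w₀).sub_const w₀
    rw [h1.unique h2]
    exact ⟨ContinuousLinearEquiv.refl ℝ W, rfl⟩
  have hF' : ContDiffAt ℝ ∞ F (0, w₀) := hF.contDiffAt
  refine ⟨hF'.implicitFunction (by simp) hinv, ?_, ?_⟩
  · have h1 := (hF'.contDiffAt_implicitFunction (by simp) hinv).continuousAt
    have h2 := hF'.implicitFunction_apply_self (by simp) hinv
    rw [ContinuousAt, h2] at h1
    exact h1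
  · filter_upwards [hF'.eventually_apply_implicitFunction (by simp) hinv] with τ hτ
    simp only [F, zero_smul, sub_self] at hτ
    rw [sub_sub, sub_eq_zero] at hτ
    exact hτ

namespace IMEXTableau

variable {s : ℕ} (M : IMEXTableau s)

/-- The implicit coefficients, where the final update is regarded as an additional stage `none`. -/
def fullA : Option (Fin s) → Option (Fin s) → ℝ
  | _, none => 0
  | none, some j => M.b j
  | some i, some j => M.A i j

/-- The explicit coefficients, where the final update is regarded as an additional stage `none`. -/
def fullAbar : Option (Fin s) → Option (Fin s) → ℝ
  | _, none => 0
  | none, some j => M.bbar j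
  | some i, some j => M.Abar i j

end IMEXTableau

end

/-! ### Transfer of the order from finite-dimensional systems -/

noncomputable section

namespace PhaseField

variable {d : ℕ} {P : PhaseField d}

/-- The evaluation of a state at a component and a point. -/
def evalState (q : Fin 3 × Euc d) : P.State →ₗ[ℝ] ℝ where
  toFun v := v q.1 q.2
  map_add' _ _ := rfl
  map_smul' _ _ := rfl

/-- The linear combination of states with given coefficients. -/
def combine {n : ℕ} (φ : Fin n → P.State) : (Fin n → ℝ) →ₗ[ℝ] P.State where
  toFun y := ∑ k, y k • φ k
  map_add' y y' := by simp [add_smul, Finset.sum_add_distrib]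
  map_smul' c y := by simp [mul_smul, Finset.smul_sum]

lemma combine_apply {n : ℕ} (φ : Fin n → P.State) (y : Fin n → ℝ) (j : Fin 3) :
    combine φ y j = ∑ k, y k • φ k j := by
  simp [combine]

/-- The values of a state at finitely many components and points. -/
def sample {n : ℕ} (q : Fin n → Fin 3 × Euc d) : P.State →ₗ[ℝ] Fin n → ℝ :=
  LinearMap.pi fun k => evalState (q k)

section

variable {n : ℕ} {φ : Fin n → P.State} {q : Fin n → Fin 3 × Euc d} {ι : Type} {l : Filter ι}
  {g : ι → ℝ}

lemma isO_combine {y : ι → Fin n → ℝ} (hy : y =O[l] g) (j : Fin 3) :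
    IsO l g fun i => combine φ (y i) j := by
  simp only [combine_apply]
  refine IsO.sum _ fun k _ => ?_
  simpa using IsO.smul ((Asymptotics.isBigO_of_le _ fun i => norm_le_pi_norm (y i) k).trans hy)
    (IsO.const (l := l) (φ k j))

lemma isBigO_sample {v : ι → P.State} (hv : ∀ j, IsO l g fun i => v i j) :
    (fun i => sample q (v i)) =O[l] g :=
  Asymptotics.isBigO_pi.2 fun k => (hv (q k).1).apply fun _ => (q k).2

lemma contDiff_sample {f : P.State → P.State} (hf : ∀ j, Tame fun v => f v j) :
    ContDiff ℝ ∞ fun y => sample q (f (combine φ y)) := by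
  refine contDiff_pi.2 fun k => ?_
  refine ((hf (q k).1).smooth (v := fun y => combine φ y) fun j => ?_).contDiff_apply (q k).2
  simp only [combine_apply]
  exact JointlySmooth.sum _ fun k _ => JointlySmooth.smul_const (contDiff_apply ℝ ℝ k) _

lemma sample_stageMap {κ : Type} [Fintype κ] (A A' : κ → κ → ℝ) (f g : P.State → P.State)
    (Y : κ → P.State) (i : κ) : sample q (stageMap A A' f g Y i) =
      ∑ k, A i k • sample q (f (Y k)) + ∑ k, A' i k • sample q (g (Y k)) := by
  simp [stageMap, map_sum, Finset.sum_add_distrib]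

/-- If the polynomials are fixed by the interpolation, then solutions of the interpolated stage
equations are close to those polynomials that satisfy the stage equations up to a small error. -/
lemma combine_sub_poly_isO {κ : Type} [Fintype κ] {A A' : κ → κ → ℝ} {f g : P.State → P.State}
    (hf : ∀ j, Tame fun v => f v j) (hg : ∀ j, Tame fun v => g v j) {z₀ : P.State}
    {N : ℕ} {c : κ → ℕ → Unit → P.State} (hc : ∀ i, BddCoeffs (c i))
    (hr : ∀ i j, IsO (smallStep Unit) (fun z => z.2 ^ N) fun z => poly N (c i) z j -
        (z₀ j + z.2 • stageMap A A' f g (fun k => poly N (c k) z) i j))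
    (hz₀ : combine φ (sample q z₀) = z₀)
    (hcV : ∀ i, ∀ k < N, combine φ (sample q (c i k ())) = c i k ())
    {Y : ℝ → κ → Fin n → ℝ} (hYb : ∀ i, (fun z : Unit × ℝ => Y z.2 i) =O[smallStep Unit]
      fun _ => (1 : ℝ))
    (hY : ∀ᶠ z in smallStep Unit, ∀ i, Y z.2 i = sample q z₀ +
      z.2 • sample q (stageMap A A' f g (fun k => combine φ (Y z.2 k)) i)) (i : κ) (j : Fin 3) :
    IsO (smallStep Unit) (fun z => z.2 ^ N) fun z => combine φ (Y z.2 i) j - poly N (c i) z j := by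
  have hpV : ∀ i z, combine φ (sample q (poly N (c i) z)) = poly N (c i) z := by
    intro i z
    simp only [poly, map_sum, map_smul]
    exact Finset.sum_congr rfl fun k hk => by rw [hcV i k (Finset.mem_range.1 hk)]
  have hYb' : ∀ i j, IsO (smallStep Unit) (fun _ => (1 : ℝ)) fun z => combine φ (Y z.2 i) j :=
    fun i => isO_combine (hYb i)
  have hpb : ∀ i j, IsO (smallStep Unit) (fun _ => (1 : ℝ)) fun z => poly N (c i) z j :=
    fun i j => ((hc i).hasExp N 0 j).bdd
  -- Bootstrap: the factor `τ` in the stage equations improves the exponent by one in each pass.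
  suffices h : ∀ m ≤ N, ∀ i j, IsO (smallStep Unit) (fun z => z.2 ^ m) fun z =>
      combine φ (Y z.2 i) j - poly N (c i) z j from h N le_rfl i j
  intro m
  induction m with
  | zero => exact fun _ i j => by simpa using (hYb' i j).sub (hpb i j)
  | succ m ih =>
    intro hm i j
    have h1 : ∀ j, IsO (smallStep Unit) (fun z => z.2 ^ m) fun z =>
        (stageMap A A' f g (fun k => combine φ (Y z.2 k)) i -
          stageMap A A' f g (fun k => poly N (c k) z) i) j :=
      stageMap_lip (A := A) (A' := A') hf hg (snd_pow_isBigO_one m)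
        (Y := fun k z => combine φ (Y z.2 k)) (Z := fun k z => poly N (c k) z) hYb' hpb
        (ih (by omega)) i
    have h2 := IsO.smul (Asymptotics.isBigO_refl (fun z : Unit × ℝ => z.2) _)
      -- Sampling needs only a bound on values, and the result is a combination of fixed smooth
      -- states; so interpolation preserves bounds on all derivatives.
      (isO_combine (φ := φ) (isBigO_sample (q := q) h1) j)
    simp only [← pow_succ'] at h2
    have h3 := (isO_combine (φ := φ) (isBigO_sample (q := q) (v := fun z => poly N (c i) z -
      (z₀ + z.2 • stageMap A A' f g (fun k => poly N (c k) z) i)) (hr i)) j).trans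
      (snd_pow_isBigO_pow hm)
    refine (h2.sub h3).congr' ?_
    filter_upwards [hY] with z hz
    have e : combine φ (Y z.2 i) - poly N (c i) z =
        z.2 • combine φ (sample q (stageMap A A' f g (fun k => combine φ (Y z.2 k)) i -
          stageMap A A' f g (fun k => poly N (c k) z) i)) -
        combine φ (sample q (poly N (c i) z -
          (z₀ + z.2 • stageMap A A' f g (fun k => poly N (c k) z) i))) := by
      rw [hz i]
      simp only [map_sub, map_add, map_smul, hpV, hz₀, smul_sub]
      abel
    exact (congrFun e j).symm

/-- The interpolated solution and the polynomial start at the same state. Because interpolation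
fixes the coefficients, the derivative of their difference is the interpolant of a Lipschitz error
minus that of the defect; integration in time gains a power of `τ`, and the argument is repeated. -/
lemma combine_sub_poly_isO_of_hasDeriv {h : P.State → P.State} (hh : ∀ j, Tame fun v => h v j)
    {N : ℕ} {c : ℕ → Unit → P.State} (hc : BddCoeffs c)
    (hr : ∀ j, IsO (smallStep Unit) (fun z => z.2 ^ N) fun z =>
      polyDeriv N c z j - h (poly (N + 1) c z) j)
    (hcV : ∀ k < N + 1, combine φ (sample q (c k ())) = c k ())
    {y : ℝ → Fin n → ℝ} {H : ℝ} (hH : 0 < H) (hy0 : y 0 = sample q (c 0 ()))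
    (hy : ∀ t ∈ Icc 0 H, HasDerivWithinAt y (sample q (h (combine φ (y t)))) (Icc 0 H) t)
    (j : Fin 3) :
    IsO (smallStep Unit) (fun z => z.2 ^ (N + 1)) fun z =>
      combine φ (y z.2) j - poly (N + 1) c z j := by
  let S : Filter (Unit × ℝ) := stepWithin fun _ => H
  have hS : smallStep Unit ≤ S := by
    refine le_inf le_rfl (le_principal_iff.2 ?_)
    exact tendsto_snd_smallStep.eventually (mem_nhdsWithin_of_mem_nhds (Iic_mem_nhds hH))
  have hS' : S ≤ smallStep Unit := inf_le_left
  have hpV : ∀ z, combine φ (sample q (polyDeriv N c z)) = polyDeriv N c z := by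
    intro z
    simp only [polyDeriv, map_sum, map_smul]
    exact Finset.sum_congr rfl fun k hk => by
      rw [hcV (k + 1) (by simpa using Finset.mem_range.1 hk)]
  have hyb : (fun z : Unit × ℝ => y z.2) =O[S] fun _ => (1 : ℝ) := by
    obtain ⟨C, hC⟩ := (isCompact_Icc (a := 0) (b := H)).exists_bound_of_continuousOn
      fun t ht => (hy t ht).continuousWithinAt
    refine Asymptotics.IsBigO.of_bound C (eventually_stepWithin.2 ⟨1, one_pos, fun b τ hτ hτH => ?_⟩)
    simpa using hC τ ⟨hτ.1.le, hτH⟩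
  have hcb : ∀ j, IsO S (fun _ => (1 : ℝ)) fun z => combine φ (y z.2) j := isO_combine hyb
  have hpb : ∀ j, IsO S (fun _ => (1 : ℝ)) fun z => poly (N + 1) c z j :=
    fun j => ((hc.hasExp (N + 1) 0 j).bdd).mono hS'
  have hT : ∀ j, IsTimeDeriv (fun _ => H) (fun z => combine φ (y z.2) j - poly (N + 1) c z j)
      fun z => combine φ (sample q (h (combine φ (y z.2)))) j - polyDeriv N c z j := by
    intro j
    refine IsTimeDeriv.sub ?_ (isTimeDeriv_poly _ N c j)
    simp only [combine_apply]
    refine IsTimeDeriv.sum_smul (β := Unit) Finset.univ (a := fun k z => y z.2 k)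
      (a' := fun k z => sample q (h (combine φ (y z.2))) k) (fun k _ b σ hσ => ?_) fun k _ => φ k j
    exact hasDerivWithinAt_pi.1 (hy σ hσ) k
  suffices H : ∀ m ≤ N + 1, ∀ j, IsO S (fun z => z.2 ^ m) fun z =>
      combine φ (y z.2) j - poly (N + 1) c z j from (H _ le_rfl j).mono hS
  intro m
  induction m with
  | zero => exact fun _ j => by simpa using (hcb j).sub (hpb j)
  | succ m ih =>
    intro hm j
    refine (hT j).isO (fun b => ?_) ?_
    · rw [poly_zero]
      simp only [hy0, hcV 0 (Nat.succ_pos N)]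
      exact sub_self _
    · have h1 : ∀ j, IsO S (fun z => z.2 ^ m) fun z =>
          (h (combine φ (y z.2)) - h (poly (N + 1) c z)) j := fun j =>
        (hh j).lip ((snd_pow_isBigO_one m).mono hS') (v := fun z => combine φ (y z.2))
          (w := fun z => poly (N + 1) c z) hcb hpb (ih (by omega))
      have h2 := isO_combine (φ := φ) (isBigO_sample (q := q) h1) j
      have h3 := ((isO_combine (φ := φ) (isBigO_sample (q := q) (v := fun z => polyDeriv N c z -
        h (poly (N + 1) c z)) hr) j).trans
        (snd_pow_isBigO_pow (Nat.le_of_succ_le_succ hm))).mono hS'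
      refine (h2.sub h3).congr' (.of_forall fun z => ?_)
      have e : combine φ (sample q (h (combine φ (y z.2)))) - polyDeriv N c z =
          combine φ (sample q (h (combine φ (y z.2)) - h (poly (N + 1) c z))) -
          combine φ (sample q (polyDeriv N c z - h (poly (N + 1) c z))) := by
        simp only [map_sub, hpV]
        abel
      exact (congrFun e j).symm

end

/-- The order of the method for ordinary differential equations transfers to the formal
expansions. -/
lemma poly_sub_poly_isO {s : ℕ} {M : IMEXTableau s} {p : ℕ} (hM : M.HasOrder p)
    {f g : P.State → P.State} (hf : ∀ j, Tame fun v => f v j) (hg : ∀ j, Tame fun v => g v j)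
    {z₀ : P.State} {c : ℕ → Unit → P.State} (hc : BddCoeffs c) (hc0 : c 0 () = z₀)
    (hcr : ∀ j, IsO (smallStep Unit) (fun z => z.2 ^ p) fun z =>
      polyDeriv p c z j - (f (poly (p + 1) c z) + g (poly (p + 1) c z)) j)
    {e : Option (Fin s) → ℕ → Unit → P.State} (he : ∀ i, BddCoeffs (e i))
    (her : ∀ i j, IsO (smallStep Unit) (fun z => z.2 ^ (p + 1)) fun z => poly (p + 1) (e i) z j -
        (z₀ j + z.2 • stageMap M.fullA M.fullAbar f g (fun k => poly (p + 1) (e k) z) i j))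
    (j : Fin 3) :
    IsO (smallStep Unit) (fun z => z.2 ^ (p + 1)) fun z =>
      poly (p + 1) (e none) z j - poly (p + 1) c z j := by
  classical
  -- The coefficients that interpolation must reproduce exactly; finiteness of this set is what
  -- allows a reduction to `ℝ ^ n`.
  let S : Set P.State := (⋃ k ∈ Finset.range (p + 1), {c k ()}) ∪
    ⋃ i, ⋃ k ∈ Finset.range (p + 1), {e i k ()}
  have hS : S.Finite := by
    refine Set.Finite.union (Set.Finite.biUnion (Finset.finite_toSet _) fun _ _ => finite_singleton _)
      (Set.finite_iUnion fun i => Set.Finite.biUnion (Finset.finite_toSet _) fun _ _ =>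
        finite_singleton _)
  have : FiniteDimensional ℝ (Submodule.span ℝ S) := FiniteDimensional.span_of_finite ℝ hS
  obtain ⟨n, q, φ, hφ⟩ := exists_interpolation (evalState (P := P))
    (fun v hv => by
      ext j x
      exact hv (j, x)) (Submodule.span ℝ S)
  have hφ' : ∀ v ∈ S, combine φ (sample q v) = v := fun v hv => hφ v (Submodule.subset_span hv)
  have hcV : ∀ k < p + 1, combine φ (sample q (c k ())) = c k () := fun k hk =>
    hφ' _ (Or.inl (by simp only [mem_iUnion]; exact ⟨k, by simpa using hk, rfl⟩))
  have heV : ∀ i, ∀ k < p + 1, combine φ (sample q (e i k ())) = e i k () := fun i k hk =>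
    hφ' _ (Or.inr (by simp only [mem_iUnion]; exact ⟨i, k, by simpa using hk, rfl⟩))
  have hz₀ : combine φ (sample q z₀) = z₀ := by rw [← hc0, hcV 0 (Nat.succ_pos p)]
  -- The interpolated vector fields, to which the order hypothesis will be applied; they are smooth
  -- because tame operators preserve smooth dependence on parameters.
  set fV : (Fin n → ℝ) → Fin n → ℝ := fun y => sample q (f (combine φ y))
  set gV : (Fin n → ℝ) → Fin n → ℝ := fun y => sample q (g (combine φ y))
  have hfV' : ContDiff ℝ ∞ fV := contDiff_sample hf
  have hgV' : ContDiff ℝ ∞ gV := contDiff_sample hg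
  set y₀ := sample q z₀
  obtain ⟨y, hy0, ε, hε, hy⟩ :=
    ((hfV'.add hgV').contDiffAt.of_le (by simp) :
      ContDiffAt ℝ 1 (fun y => fV y + gV y) y₀).exists_forall_mem_closedBall_exists_eq_forall_mem_Ioo_hasDerivAt₀ 0
  have hyd : ∀ t ∈ Icc 0 (ε / 2), HasDerivWithinAt y (fV (y t) + gV (y t)) (Icc 0 (ε / 2)) t :=
    fun t ht => (hy t ⟨by linarith [ht.1], by linarith [ht.2]⟩).hasDerivWithinAt
  let G : (Fin s → Fin n → ℝ) → Fin s → Fin n → ℝ := fun Y i =>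
    ∑ j, M.A i j • fV (Y j) + ∑ j, M.Abar i j • gV (Y j)
  have hG : ContDiff ℝ ∞ G := by
    refine contDiff_pi.2 fun i => ContDiff.add ?_ ?_
    · exact ContDiff.sum fun j _ => (hfV'.comp (contDiff_apply ℝ _ j)).const_smul _
    · exact ContDiff.sum fun j _ => (hgV'.comp (contDiff_apply ℝ _ j)).const_smul _
  -- The order hypothesis speaks about given stages that tend to the initial value, so such stages
  -- must be produced.
  obtain ⟨Y, hYt, hYe⟩ := exists_small_solution hG fun _ => y₀
  have hYt' : ∀ i, Tendsto (fun τ => Y τ i) (𝓝[>] 0) (𝓝 y₀) := fun i =>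
    (tendsto_pi_nhds.1 hYt i).mono_left nhdsWithin_le_nhds
  have hord := hM (Fin n → ℝ) fV gV univ (ε / 2) y Y isOpen_univ hfV'.contDiffOn
    hgV'.contDiffOn (by positivity) (fun t ht => ⟨trivial, hyd t ht⟩)
    (fun i => by rw [hy0]; exact hYt' i)
    ((hYe.filter_mono nhdsWithin_le_nhds).mono fun τ hτ i => by
      rw [hy0]
      have := congrFun hτ i
      simpa only [G, Pi.add_apply, Pi.smul_apply, smul_add, ← add_assoc] using this)
  let Y' : ℝ → Option (Fin s) → Fin n → ℝ := fun τ i => match i with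
    | none => y₀ + τ • (∑ i, M.b i • fV (Y τ i)) + τ • (∑ i, M.bbar i • gV (Y τ i))
    | some i => Y τ i
  have htend : ∀ i, Tendsto (fun τ => Y' τ i) (𝓝[>] 0) (𝓝 y₀) := by
    intro i
    cases i with
    | some i => exact hYt' i
    | none =>
      have h0 : Tendsto (fun τ : ℝ => τ) (𝓝[>] 0) (𝓝 0) := tendsto_id.mono_left nhdsWithin_le_nhds
      have h1 : Tendsto (fun τ => ∑ i, M.b i • fV (Y τ i)) (𝓝[>] 0) (𝓝 (∑ i, M.b i • fV y₀)) :=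
        tendsto_finsetSum _ fun i _ => ((hfV'.continuous.tendsto y₀).comp (hYt' i)).const_smul _
      have h2 : Tendsto (fun τ => ∑ i, M.bbar i • gV (Y τ i)) (𝓝[>] 0)
          (𝓝 (∑ i, M.bbar i • gV y₀)) :=
        tendsto_finsetSum _ fun i _ => ((hgV'.continuous.tendsto y₀).comp (hYt' i)).const_smul _
      simpa using (tendsto_const_nhds (x := y₀)).add (h0.smul h1) |>.add (h0.smul h2)
  have hstage := combine_sub_poly_isO hf hg (A := M.fullA) (A' := M.fullAbar) he her hz₀ heV
    (Y := Y') (fun i => ((htend i).comp tendsto_snd_smallStep).isBigO_one ℝ)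
    ((tendsto_snd_smallStep.eventually (hYe.filter_mono nhdsWithin_le_nhds)).mono
      fun z hz i => by
        rw [sample_stageMap, Fintype.sum_option, Fintype.sum_option]
        cases i with
        | none =>
          simp only [IMEXTableau.fullA, IMEXTableau.fullAbar, zero_smul, zero_add, smul_add,
            ← add_assoc]
          rfl
        | some i =>
          have := congrFun hz i
          simp only [IMEXTableau.fullA, IMEXTableau.fullAbar, zero_smul, zero_add]
          exact this) none j
  have hsol := combine_sub_poly_isO_of_hasDeriv (h := fun v => f v + g v)
    (fun j => (hf j).add (hg j)) hc hcr hcV (y := y) (half_pos hε) (by rw [hy0, hc0])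
    (fun t ht => by simpa only [map_add] using hyd t ht) j
  have hdiff : IsO (smallStep Unit) (fun z => z.2 ^ (p + 1)) fun z =>
      combine φ (y z.2 - Y' z.2 none) j := by
    rw [hy0] at hord
    exact isO_combine (hord.comp_tendsto (tendsto_snd_smallStep (β := Unit))) j
  -- With `y` the interpolated solution, `Y'` the interpolated update, `c` and `e` the two
  -- polynomials: `e - c = (y - c) - (Y' - e) - (y - Y')`. The last difference is small by the order
  -- hypothesis.
  refine ((hsol.sub hstage).sub hdiff).congr' (.of_forall fun z => ?_)
  simp only [map_sub, Pi.sub_apply]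
  abel

end PhaseField

end

/-! ### Agreement of the formal expansions; the phase field operators -/

noncomputable section

lemma coeff_eq_zero_of_isBigO (N : ℕ) (a : ℕ → ℝ)
    (h : (fun τ : ℝ => ∑ k ∈ Finset.range N, τ ^ k * a k) =O[𝓝[>] 0] fun τ => τ ^ N) :
    ∀ k < N, a k = 0 := by
  induction N generalizing a with
  | zero => simp
  | succ N ih =>
    have h0 : a 0 = 0 := by
      have h1 : Tendsto (fun τ : ℝ => ∑ k ∈ Finset.range (N + 1), τ ^ k * a k) (𝓝[>] 0) (𝓝 (a 0)) := by
        have : Continuous fun τ : ℝ => ∑ k ∈ Finset.range (N + 1), τ ^ k * a k := by fun_prop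
        have := (this.tendsto 0).mono_left (nhdsWithin_le_nhds (s := Ioi 0))
        simpa [Finset.sum_range_succ'] using this
      have h2 : Tendsto (fun τ : ℝ => τ ^ (N + 1)) (𝓝[>] 0) (𝓝 0) := by
        have : Continuous fun τ : ℝ => τ ^ (N + 1) := by fun_prop
        have := (this.tendsto 0).mono_left (nhdsWithin_le_nhds (s := Ioi 0))
        simpa using this
      exact tendsto_nhds_unique h1 (h.trans_tendsto h2)
    have h1 : (fun τ : ℝ => ∑ k ∈ Finset.range N, τ ^ k * a (k + 1)) =O[𝓝[>] 0] fun τ => τ ^ N := by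
      have := (Asymptotics.isBigO_refl (fun τ : ℝ => τ⁻¹) (𝓝[>] 0)).mul h
      refine this.congr' ?_ ?_
      · filter_upwards [self_mem_nhdsWithin] with τ hτ
        rw [Finset.sum_range_succ', h0, mul_zero, add_zero, Finset.mul_sum]
        refine Finset.sum_congr rfl fun k _ => ?_
        rw [pow_succ', mul_assoc, inv_mul_cancel_left₀ (ne_of_gt hτ)]
      · filter_upwards [self_mem_nhdsWithin] with τ hτ
        rw [pow_succ', inv_mul_cancel_left₀ (ne_of_gt hτ)]
    intro k hk
    cases k with
    | zero => exact h0
    | succ k => exact ih _ h1 k (by omega)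

/-- A smooth function on the real line that is the inverse square root on `[δ, ∞)`. -/
lemma exists_smooth_inv_sqrt {δ : ℝ} (hδ : 0 < δ) :
    ∃ G : ℝ → ℝ, ContDiff ℝ ∞ G ∧ ∀ s, δ ≤ s → G s = 1 / √s := by
  -- The cutoff vanishes for `s ≤ δ / 2`, away from which the inverse square root is smooth, and
  -- equals one for `s ≥ δ`.
  refine ⟨fun s => Real.smoothTransition ((s - δ / 2) / (δ / 2)) * (1 / √s), ?_, fun s hs => ?_⟩
  · refine contDiff_iff_contDiffAt.2 fun s => ?_
    rcases lt_or_ge s (δ / 2) with h | h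
    · have : (fun s => Real.smoothTransition ((s - δ / 2) / (δ / 2)) * (1 / √s)) =ᶠ[𝓝 s]
          fun _ => 0 := by
        filter_upwards [Iio_mem_nhds h] with s hs
        have hs' : s < δ / 2 := hs
        rw [Real.smoothTransition.zero_of_nonpos, zero_mul]
        exact div_nonpos_of_nonpos_of_nonneg (by linarith) (by linarith)
      exact contDiffAt_const.congr_of_eventuallyEq this
    · have hs : s ≠ 0 := by linarith
      refine ContDiffAt.mul ?_ ?_
      · exact Real.smoothTransition.contDiffAt.comp s
          ((contDiffAt_id.sub contDiffAt_const).div_const _)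
      · exact contDiffAt_const.div (Real.contDiffAt_sqrt hs)
          (Real.sqrt_ne_zero'.2 (by linarith))
  · dsimp only
    rw [Real.smoothTransition.one_of_one_le, one_mul]
    rw [le_div_iff₀ (by linarith)]
    linarith

namespace PhaseField

variable {d : ℕ} {P : PhaseField d} {β : Type}

/-- Formal expansions of the exact solution and of the stages; the expansion of the exact solution
is the one of the final update. -/
lemma exists_formal_step {s : ℕ} {M : IMEXTableau s} {p : ℕ} (hM : M.HasOrder p)
    {f g : P.State → P.State} (hf : ∀ j, Tame fun v => f v j) (hg : ∀ j, Tame fun v => g v j)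
    {z₀ : β → P.State} (hz₀ : ∀ j, IsO ⊤ (fun _ => (1 : ℝ)) fun b => z₀ b j) :
    ∃ (c : ℕ → β → P.State) (e : Option (Fin s) → ℕ → β → P.State),
      BddCoeffs c ∧ (∀ i, BddCoeffs (e i)) ∧ c 0 = z₀ ∧
      (∀ j, IsO (smallStep β) (fun z => z.2 ^ p) fun z =>
        polyDeriv p c z j - (f (poly (p + 1) c z) + g (poly (p + 1) c z)) j) ∧
      (∀ i j, IsO (smallStep β) (fun z => z.2 ^ (p + 1)) fun z => poly (p + 1) (e i) z j -
        (z₀ z.1 j + z.2 • stageMap M.fullA M.fullAbar f g (fun k => poly (p + 1) (e k) z) i j)) ∧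
      ∀ z, poly (p + 1) (e none) z = poly (p + 1) c z := by
  obtain ⟨c, hc, hc0, hcr⟩ := exists_formal_solution (h := fun v => f v + g v)
    (fun j => (hf j).add (hg j)) hz₀ p
  obtain ⟨e, he, her⟩ := exists_formal_stages (A := M.fullA) (A' := M.fullAbar) hf hg hz₀ (p + 1)
  refine ⟨c, e, hc, he, hc0, hcr, her, fun z => ?_⟩
  -- The order is used for one fixed parameter `b`, so its implied constant may depend on `b`. A
  -- polynomial of degree at most `p` that is `O(τ^(p+1))` is zero, so what results is an identity
  -- of coefficients for every `b`.
  obtain ⟨b, τ⟩ := z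
  have ht : Tendsto (fun z : Unit × ℝ => (b, z.2)) (smallStep Unit) (smallStep β) :=
    tendsto_comap_iff.2 tendsto_snd_smallStep
  have hcb : ∀ {c : ℕ → β → P.State}, BddCoeffs (β := Unit) fun k _ => c k b :=
    fun k j => IsO.const _
  have h1 := fun j => poly_sub_poly_isO hM hf hg (z₀ := z₀ b) (c := fun k _ => c k b)
    (e := fun i k _ => e i k b) hcb (by rw [hc0]) (fun j => (hcr j).comp_tendsto ht) (fun i => hcb)
    (fun i j => (her i j).comp_tendsto ht) j
  refine Finset.sum_congr rfl fun k hk => ?_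
  congr 1
  ext j x
  have h2 := (h1 j).apply fun _ => x
  have h3 : Tendsto (fun τ : ℝ => (((), τ) : Unit × ℝ)) (𝓝[>] 0) (smallStep Unit) :=
    tendsto_comap_iff.2 tendsto_id
  have h4 := coeff_eq_zero_of_isBigO (p + 1) (fun k => e none k b j x - c k b j x)
    ((h2.comp_tendsto h3).congr_left fun τ => by
      simp only [Function.comp, poly_apply, coe_sub_apply, coe_sum_apply, coe_smul_apply, mul_sub,
        Finset.sum_sub_distrib])
    k (Finset.mem_range.1 hk)
  exact sub_eq_zero.1 h4

variable (P) in
/-- The operator `𝒢` on smooth periodic functions. -/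
def mob : P.smoothPeriodic →ₗ[ℝ] P.smoothPeriodic :=
  match P.mobility with
  | .allenCahn => -LinearMap.id
  | .cahnHilliard => P.lap

lemma mob_cases : P.mob = -LinearMap.id ∨ P.mob = P.lap := by
  unfold mob
  split
  · exact .inl rfl
  · exact .inr rfl

lemma op_coe (v : P.smoothPeriodic) : P.mobility.op (v : Euc d → ℝ) = P.mob v := by
  unfold mob
  split <;> rename_i h <;> rw [h]
  · rfl
  · exact laplacian_coe v

variable (P) in
/-- The linear part on smooth periodic functions. -/
def linOp : P.smoothPeriodic →ₗ[ℝ] P.smoothPeriodic := P.mob ∘ₗ ((-P.ε ^ 2) • P.lap)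

lemma linOp_apply (v : P.smoothPeriodic) : P.linOp v = P.mob ((-P.ε ^ 2) • P.lap v) := rfl

lemma L_coe (v : P.smoothPeriodic) : P.L (v : Euc d → ℝ) = P.linOp v := by
  rw [linOp_apply, ← op_coe, L, laplacian_coe]
  rfl

lemma mob_pderiv (i : Fin d) (v : P.smoothPeriodic) :
    P.mob (P.pderiv i v) = P.pderiv i (P.mob v) := by
  rcases mob_cases (P := P) with h | h <;> rw [h]
  · simp
  · exact lap_pderiv i v

lemma linOp_pderiv (i : Fin d) (v : P.smoothPeriodic) :
    P.linOp (P.pderiv i v) = P.pderiv i (P.linOp v) := by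
  rw [linOp_apply, linOp_apply, lap_pderiv, ← map_smul, mob_pderiv]

lemma int_sum_sq_nonneg (v : P.smoothPeriodic) :
    0 ≤ ∑ i, P.int (P.pderiv i v * P.pderiv i v) :=
  Finset.sum_nonneg fun _ _ => int_nonneg fun _ => mul_self_nonneg _

/-- Integration by parts gives `-ε² ‖∇v‖²` for Allen-Cahn and `-ε² ‖Δv‖²` for Cahn-Hilliard. -/
lemma int_mul_linOp_nonpos (v : P.smoothPeriodic) : P.int (v * P.linOp v) ≤ 0 := by
  rw [linOp_apply, map_smul, mul_smul_comm, map_smul, smul_eq_mul]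
  have : 0 ≤ P.ε ^ 2 := sq_nonneg _
  rcases mob_cases (P := P) with h | h <;> rw [h]
  · have h1 := int_sum_sq_nonneg v
    have h2 := int_mul_lap v v
    have h3 : v * (-LinearMap.id : P.smoothPeriodic →ₗ[ℝ] P.smoothPeriodic) (P.lap v) =
        -(v * P.lap v) := by
      ext x; simp
    rw [h3, map_neg, h2]
    nlinarith
  · rw [int_mul_lap_comm]
    have h1 : 0 ≤ P.int (P.lap v * P.lap v) := int_nonneg fun _ => mul_self_nonneg _
    nlinarith

lemma Tame.mob {Ψ : P.State → P.smoothPeriodic} (h : Tame Ψ) : Tame fun v => P.mob (Ψ v) := by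
  rcases mob_cases (P := P) with h' | h' <;> rw [h']
  · exact h.neg
  · exact h.lap

lemma Tame.linOp {Ψ : P.State → P.smoothPeriodic} (h : Tame Ψ) : Tame fun v => P.linOp (Ψ v) :=
  (h.lap.const_smul _).mob

lemma IsO.linOp {ι : Type} {l : Filter ι} {g : ι → ℝ} {v : ι → P.smoothPeriodic} (h : IsO l g v) :
    IsO l g fun i => P.linOp (v i) := by
  simp only [linOp_apply]
  rcases mob_cases (P := P) with h' | h' <;> rw [h']
  · exact (h.lap.const_smul _).neg
  · exact (h.lap.const_smul _).lap

/-- A smooth function that replaces the inverse square root. -/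
structure InvSqrt where
  toFun : ℝ → ℝ
  smooth : ContDiff ℝ ∞ toFun

variable (G : InvSqrt)

/-- The shifted energy as a constant function. -/
def energyOp (v : P.State) : P.smoothPeriodic :=
  algebraMap ℝ _ (P.int (comp P.F P.F_smooth (v 0))) + algebraMap ℝ _ P.C0

/-- The nonlinear part. -/
def nonlinOp (v : P.State) : P.smoothPeriodic :=
  P.mob (v 1 * comp G.toFun G.smooth (energyOp v) *
    comp (deriv P.F) (contDiff_deriv P.F_smooth) (v 0))

/-- The right-hand side of the equation of the auxiliary variable. -/
def auxOp (v : P.State) : P.smoothPeriodic :=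
  (1 / 2 : ℝ) • (comp G.toFun G.smooth (energyOp v) * algebraMap ℝ _
    (P.int (comp (deriv P.F) (contDiff_deriv P.F_smooth) (v 0) * (P.linOp (v 0) + nonlinOp G v))))

/-- The implicit part of the system, augmented with the modified energy. -/
def implicitPart (v : P.State) : P.State :=
  ![P.linOp (v 0), 0, algebraMap ℝ _ (P.int ((-P.ε ^ 2) • (P.lap (v 0) * P.linOp (v 0))))]

/-- The explicit part of the system, augmented with the modified energy. -/
def explicitPart (v : P.State) : P.State :=
  ![nonlinOp G v, auxOp G v,
    algebraMap ℝ _ (P.int ((-P.ε ^ 2) • (P.lap (v 0) * nonlinOp G v))) + (2 : ℝ) • (v 1 * auxOp G v)]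

lemma tame_energyOp : Tame (energyOp (P := P)) :=
  ((Tame.proj 0).comp P.F_smooth).int.add (Tame.const _)

lemma tame_nonlinOp : Tame (nonlinOp (P := P) G) :=
  (((Tame.proj 1).mul (tame_energyOp.comp G.smooth)).mul
    ((Tame.proj 0).comp (contDiff_deriv P.F_smooth))).mob

lemma tame_auxOp : Tame (auxOp (P := P) G) :=
  ((tame_energyOp.comp G.smooth).mul (((Tame.proj 0).comp (contDiff_deriv P.F_smooth)).mul
    ((Tame.proj 0).linOp.add (tame_nonlinOp G))).int).const_smul _

lemma tame_implicitPart (j : Fin 3) : Tame fun v : P.State => implicitPart v j := by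
  fin_cases j
  · exact (Tame.proj 0).linOp
  · exact Tame.const 0
  · exact (((Tame.proj 0).lap.mul (Tame.proj 0).linOp).const_smul _).int

lemma tame_explicitPart (j : Fin 3) : Tame fun v : P.State => explicitPart G v j := by
  fin_cases j
  · exact tame_nonlinOp G
  · exact tame_auxOp G
  · exact (((Tame.proj 0).lap.mul (tame_nonlinOp G)).const_smul _).int.add
      (((Tame.proj 1).mul (tame_auxOp G)).const_smul _)

variable (P) in
/-- The modified energy `ε² / 2 ‖∇ v‖² + r²`. -/
def modEnergy (v : P.smoothPeriodic) (r : ℝ) : ℝ :=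
  P.ε ^ 2 / 2 * ∑ i, P.int (P.pderiv i v * P.pderiv i v) + r ^ 2

variable (P) in
/-- The state with the given function, auxiliary variable and energy. -/
def mkState (v : P.smoothPeriodic) (r e : ℝ) : P.State := ![v, algebraMap ℝ _ r, algebraMap ℝ _ e]

lemma energyOp_mkState (v : P.smoothPeriodic) (r e : ℝ) :
    energyOp (P.mkState v r e) = algebraMap ℝ _ (P.shiftedEnergy v) :=
  (map_add (algebraMap ℝ P.smoothPeriodic) _ _).symm

lemma comp_algebraMap {F : ℝ → ℝ} (hF : ContDiff ℝ ∞ F) (a : ℝ) :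
    comp F hF (algebraMap ℝ P.smoothPeriodic a) = algebraMap ℝ _ (F a) := rfl

lemma N_eq {v : P.smoothPeriodic} (r e : ℝ)
    (hG : G.toFun (P.shiftedEnergy v) = 1 / √(P.shiftedEnergy v)) :
    P.N (v : Euc d → ℝ) r = nonlinOp G (P.mkState v r e) := by
  rw [nonlinOp, energyOp_mkState, comp_algebraMap, ← op_coe, N, hG]
  congr 1
  ext x
  rw [div_eq_mul_one_div]
  rfl

lemma Ntilde_eq {v : P.smoothPeriodic} (r e : ℝ)
    (hG : G.toFun (P.shiftedEnergy v) = 1 / √(P.shiftedEnergy v)) :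
    algebraMap ℝ _ (P.Ntilde (v : Euc d → ℝ) r) = auxOp G (P.mkState v r e) := by
  rw [auxOp, energyOp_mkState, comp_algebraMap, hG, Ntilde, N_eq G r e hG, L_coe]
  ext x
  simp only [coe_algebraMap_apply, coe_smul_apply, coe_mul_apply]
  rw [← mul_assoc]
  congr 1
  rw [mul_comm 2, one_div_mul_one_div_rev]

end PhaseField

end

/-! ### The exact solution as a curve of smooth periodic functions -/

noncomputable section

namespace PhaseField

variable {d : ℕ} {P : PhaseField d} {T : ℝ}

/-- The curve `v` of smooth periodic functions is jointly smooth in time and space on `[0, T]`. -/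
def SmoothOn (T : ℝ) (v : ℝ → P.smoothPeriodic) : Prop :=
  ContDiffOn ℝ ∞ (fun z : ℝ × Euc d => v z.1 z.2) (Icc 0 T ×ˢ univ)

lemma uniqueDiffOn_slab (hT : 0 < T) : UniqueDiffOn ℝ (Icc 0 T ×ˢ (univ : Set (Euc d))) :=
  (uniqueDiffOn_Icc hT).prod uniqueDiffOn_univ

lemma SmoothOn.pderiv_eq {v : ℝ → P.smoothPeriodic} (hv : SmoothOn T v)
    (i : Fin d) {t : ℝ} (ht : t ∈ Icc 0 T) (x : Euc d) :
    P.pderiv i (v t) x = fderivWithin ℝ (fun z : ℝ × Euc d => v z.1 z.2) (Icc 0 T ×ˢ univ) (t, x)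
      (0, EuclideanSpace.single i 1) := by
  have h1 := ((hv.differentiableOn (by simp)) (t, x) ⟨ht, trivial⟩).hasFDerivWithinAt
  have h2 : HasFDerivAt (fun x : Euc d => (t, x)) (.inr ℝ ℝ (Euc d)) x := hasFDerivAt_prodMk_right t x
  have h3 := (h1.comp x (s := univ) h2.hasFDerivWithinAt
    (fun y _ => ⟨ht, trivial⟩)).hasFDerivAt univ_mem
  rw [pderiv_apply]
  exact congrArg (fun f => f (EuclideanSpace.single i 1)) h3.fderiv

lemma SmoothOn.pderiv (hT : 0 < T) {v : ℝ → P.smoothPeriodic} (hv : SmoothOn T v) (i : Fin d) :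
    SmoothOn T fun t => P.pderiv i (v t) := by
  refine ContDiffOn.congr (f := fun z => fderivWithin ℝ (fun z : ℝ × Euc d => v z.1 z.2)
    (Icc 0 T ×ˢ univ) z (0, EuclideanSpace.single i 1)) ?_ fun z hz => hv.pderiv_eq i hz.1 z.2
  exact (hv.fderivWithin (uniqueDiffOn_slab hT) (by simp)).clm_apply contDiffOn_const

/-- Symmetry of the second derivative within the slab `[0, T] × ℝ ^ d`. It holds up to the end times
because the slab has unique derivatives and is the closure of its interior. -/
lemma SmoothOn.hasDerivWithinAt_pderiv (hT : 0 < T) {v v' : ℝ → P.smoothPeriodic}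
    (hv : SmoothOn T v)
    (h : ∀ t ∈ Icc 0 T, ∀ x, HasDerivWithinAt (fun t => v t x) (v' t x) (Icc 0 T) t) (i : Fin d) :
    ∀ t ∈ Icc 0 T, ∀ x,
      HasDerivWithinAt (fun t => P.pderiv i (v t) x) (P.pderiv i (v' t) x) (Icc 0 T) t := by
  intro t ht x
  set W : ℝ × Euc d → ℝ := fun z => v z.1 z.2 with hW
  set S : Set (ℝ × Euc d) := Icc 0 T ×ˢ univ with hS
  have hSu : UniqueDiffOn ℝ S := uniqueDiffOn_slab hT
  have hW' : ContDiffOn ℝ ∞ (fderivWithin ℝ W S) S := hv.fderivWithin hSu (by simp)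
  have hd : ∀ z ∈ S, HasFDerivWithinAt (fderivWithin ℝ W S)
      (fderivWithin ℝ (fderivWithin ℝ W S) S z) S z := fun z hz =>
    (hW'.differentiableOn (by simp) z hz).hasFDerivWithinAt
  have hmem : ∀ x, (t, x) ∈ S := fun x => ⟨ht, trivial⟩
  have hcurve : HasDerivWithinAt (fun t' => (t', x)) ((1 : ℝ), (0 : Euc d)) (Icc 0 T) t :=
    (hasDerivAt_id t).hasDerivWithinAt.prodMk (hasDerivWithinAt_const _ _ _)
  have htime : ∀ y, v' t y = fderivWithin ℝ W S (t, y) (1, 0) := by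
    intro y
    have hcurve : HasDerivWithinAt (fun t' => (t', y)) ((1 : ℝ), (0 : Euc d)) (Icc 0 T) t :=
      (hasDerivAt_id t).hasDerivWithinAt.prodMk (hasDerivWithinAt_const _ _ _)
    have h1 := ((hv.differentiableOn (by simp)) (t, y) (hmem y)).hasFDerivWithinAt
    have h2 := h1.comp_hasDerivWithinAt (t := S) t hcurve fun t' ht' => ⟨ht', trivial⟩
    exact (uniqueDiffOn_Icc hT t ht).eq_deriv _ (h t ht y) h2
  have h1 : HasDerivWithinAt (fun t' => P.pderiv i (v t') x)
      (fderivWithin ℝ (fderivWithin ℝ W S) S (t, x) (1, 0) (0, EuclideanSpace.single i 1))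
      (Icc 0 T) t := by
    have h2 := (hd (t, x) (hmem x)).comp_hasDerivWithinAt (t := S) t hcurve
      fun t' ht' => ⟨ht', trivial⟩
    have h3 := h2.clm_apply (hasDerivWithinAt_const t (Icc 0 T)
      ((0 : ℝ), (EuclideanSpace.single i 1 : Euc d)))
    simp only [map_zero, add_zero] at h3
    exact h3.congr (fun t' ht' => hv.pderiv_eq i ht' x) (hv.pderiv_eq i ht x)
  have h2 : P.pderiv i (v' t) x =
      fderivWithin ℝ (fderivWithin ℝ W S) S (t, x) (0, EuclideanSpace.single i 1) (1, 0) := by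
    have h3 := ((hd (t, x) (hmem x)).comp x (s := univ)
      (hasFDerivAt_prodMk_right t x).hasFDerivWithinAt (fun y _ => hmem y)).hasFDerivAt univ_mem
    have h4 := h3.clm_apply (hasFDerivAt_const ((1 : ℝ), (0 : Euc d)) x)
    rw [pderiv_apply, show (v' t : Euc d → ℝ) = fun y => fderivWithin ℝ W S (t, y) (1, 0) from
      funext htime]
    have h5 := congrArg (fun f => f (EuclideanSpace.single i 1)) h4.fderiv
    simpa using h5
  rw [h2]
  convert h1 using 1
  have hsymm : IsSymmSndFDerivWithinAt ℝ W S (t, x) := by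
    refine (hv (t, x) (hmem x)).isSymmSndFDerivWithinAt (n := ∞)
      (by rw [minSmoothness_of_isRCLikeNormedField]; exact WithTop.coe_le_coe.2 (le_top : (2 : ℕ∞) ≤ ⊤))
      hSu ?_ (hmem x)
    rw [hS, interior_prod_eq, interior_univ, interior_Icc, closure_prod_eq, closure_univ,
      closure_Ioo hT.ne]
    exact hmem x
  exact hsymm _ _

lemma SmoothOn.isO (hT : 0 < T) {v : ℝ → P.smoothPeriodic} (hv : SmoothOn T v) :
    IsO ⊤ (fun _ => (1 : ℝ)) fun t : Icc 0 T => v t := by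
  have base : ∀ v : ℝ → P.smoothPeriodic, SmoothOn T v →
      (fun t : Icc 0 T => P.toBCF (v t)) =O[⊤] fun _ => (1 : ℝ) := by
    intro v hv
    obtain ⟨C, hC⟩ := ((isCompact_Icc (a := 0) (b := T)).prod
      P.isCompact_closedBox).exists_bound_of_continuousOn
      (hv.continuousOn.mono (prod_mono_right (subset_univ _)))
    refine Asymptotics.IsBigO.of_bound (max C 0) (.of_forall fun t => ?_)
    rw [norm_one, mul_one, BoundedContinuousFunction.norm_le (le_max_right _ _)]
    intro x
    obtain ⟨y, hy, hxy⟩ := P.exists_mem_closedBox x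
    rw [toBCF_apply, hxy _ (isPeriodic_coe _)]
    exact (hC (t.1, y) ⟨t.2, hy⟩).trans (le_max_left _ _)
  intro m
  induction m generalizing v with
  | zero => exact base v hv
  | succ m ih => exact ⟨base v hv, fun i => ih (hv.pderiv hT i)⟩

lemma SmoothOn.isTimeDeriv (hT : 0 < T) {v v' : ℝ → P.smoothPeriodic} (hv : SmoothOn T v)
    (h : ∀ t ∈ Icc 0 T, ∀ x, HasDerivWithinAt (fun t => v t x) (v' t x) (Icc 0 T) t) :
    IsTimeDeriv (fun t : Icc 0 T => T - t) (fun z => v (z.1 + z.2)) fun z => v' (z.1 + z.2) := by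
  have base : ∀ v v' : ℝ → P.smoothPeriodic,
      (∀ t ∈ Icc 0 T, ∀ x, HasDerivWithinAt (fun t => v t x) (v' t x) (Icc 0 T) t) →
      ∀ b : Icc 0 T, ∀ σ ∈ Icc 0 (T - b), ∀ x, HasDerivWithinAt (fun s => v (b + s) x)
        (v' (b + σ) x) (Icc 0 (T - b)) σ := by
    intro v v' h b σ hσ x
    have hmaps : MapsTo (fun s => (b : ℝ) + s) (Icc 0 (T - b)) (Icc 0 T) := fun s hs =>
      ⟨add_nonneg b.2.1 hs.1, by linarith [hs.2]⟩
    have h1 := (h (b + σ) (hmaps hσ) x).scomp σ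
      ((hasDerivAt_id σ).const_add (b : ℝ)).hasDerivWithinAt hmaps
    rw [one_smul] at h1
    exact h1
  intro m
  induction m generalizing v v' with
  | zero => exact base v v' h
  | succ m ih =>
    exact ⟨base v v' h, fun i => ih (hv.pderiv hT i) (hv.hasDerivWithinAt_pderiv hT h i)⟩

lemma isTimeDeriv_algebraMap {r r' : ℝ → ℝ}
    (h : ∀ t ∈ Icc 0 T, HasDerivWithinAt r (r' t) (Icc 0 T) t) :
    IsTimeDeriv (fun t : Icc 0 T => T - t)
      (fun z => algebraMap ℝ P.smoothPeriodic (r (z.1 + z.2)))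
      fun z => algebraMap ℝ P.smoothPeriodic (r' (z.1 + z.2)) := by
  have := IsTimeDeriv.sum_smul (P := P) (H := fun t : Icc 0 T => T - t) (Finset.univ : Finset Unit)
    (a := fun _ z => r (z.1 + z.2)) (a' := fun _ z => r' (z.1 + z.2)) (fun _ _ b σ hσ => by
      have hmaps : MapsTo (fun s => (b : ℝ) + s) (Icc 0 (T - b)) (Icc 0 T) := fun s hs =>
        ⟨add_nonneg b.2.1 hs.1, by linarith [hs.2]⟩
      have h1 := (h (b + σ) (hmaps hσ)).scomp σ
        ((hasDerivAt_id σ).const_add (b : ℝ)).hasDerivWithinAt hmaps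
      rw [one_smul] at h1
      exact h1) fun _ _ => 1
  simpa [Algebra.algebraMap_eq_smul_one] using this

open Classical in
variable (P) in
/-- A function as a smooth periodic function, if it is one. -/
def lift (v : Euc d → ℝ) : P.smoothPeriodic := if h : v ∈ P.smoothPeriodic then ⟨v, h⟩ else 0

lemma coe_lift {v : Euc d → ℝ} (h1 : ContDiff ℝ ∞ v) (h2 : P.IsPeriodic v) :
    (P.lift v : Euc d → ℝ) = v := by
  rw [lift, dif_pos (show v ∈ P.smoothPeriodic from ⟨h1, h2⟩)]

variable {u : ℝ → Euc d → ℝ} {r : ℝ → ℝ}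

namespace IsSolution

variable (hsol : P.IsSolution T u r)
include hsol

lemma coe_lift {t : ℝ} (ht : t ∈ Icc 0 T) : (P.lift (u t) : Euc d → ℝ) = u t := by
  refine PhaseField.coe_lift ?_ (hsol.periodic t ht)
  rw [← contDiffOn_univ]
  exact hsol.smooth.comp (contDiffOn_const.prodMk contDiffOn_id) fun x _ => ⟨ht, trivial⟩

lemma smoothOn : SmoothOn T fun t => P.lift (u t) :=
  hsol.smooth.congr fun z hz => by rw [hsol.coe_lift hz.1]

lemma r_bdd : (fun t : Icc 0 T => r t) =O[⊤] fun _ => (1 : ℝ) := by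
  obtain ⟨C, hC⟩ := (isCompact_Icc (a := 0) (b := T)).exists_bound_of_continuousOn
    fun t ht => (hsol.r_eq t ht).continuousWithinAt
  exact Asymptotics.IsBigO.of_bound C (.of_forall fun t => by simpa using hC t t.2)

lemma continuous_apply : Continuous fun z : Icc 0 T × Euc d => u z.1 z.2 :=
  hsol.smooth.continuousOn.comp_continuous ((continuous_subtype_val.comp continuous_fst).prodMk
    continuous_snd) fun z => ⟨z.1.2, trivial⟩

lemma continuous_shiftedEnergy : Continuous fun t : Icc 0 T => P.shiftedEnergy (u t) :=
  (continuous_setIntegral_Ω (P.F_smooth.continuous.comp hsol.continuous_apply)).add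
    continuous_const

/-- Positivity, continuity and compactness. The factor `2` leaves room for the stages, whose
energies only have to stay above `δ`. -/
lemma exists_energy_bound : ∃ δ > 0, ∀ t ∈ Icc 0 T, 2 * δ ≤ P.shiftedEnergy (u t) := by
  have hc := hsol.continuous_shiftedEnergy
  rcases isEmpty_or_nonempty (Icc 0 T) with he | he
  · exact ⟨1, one_pos, fun t ht => (he.false ⟨t, ht⟩).elim⟩
  · obtain ⟨t₀, -, ht₀⟩ := isCompact_univ.exists_isMinOn univ_nonempty hc.continuousOn
    refine ⟨P.shiftedEnergy (u t₀) / 2, half_pos (hsol.shiftedEnergy_pos _ t₀.2), fun t ht => ?_⟩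
    have h1 : P.shiftedEnergy (u t₀) ≤ P.shiftedEnergy (u t) := ht₀ (mem_univ (⟨t, ht⟩ : Icc 0 T))
    linarith

end IsSolution

end PhaseField

end

/-! ### The modified energy as a quadratic form -/

noncomputable section

namespace PhaseField

variable {d : ℕ} {P : PhaseField d} {β : Type}

variable (P) in
/-- The bilinear form of the modified energy. -/
def energyForm : P.State →ₗ[ℝ] P.State →ₗ[ℝ] P.smoothPeriodic :=
  LinearMap.mk₂ ℝ (fun v w => algebraMap ℝ P.smoothPeriodic
      (P.ε ^ 2 / 2 * ∑ i, P.int (P.pderiv i (v 0) * P.pderiv i (w 0))) + v 1 * w 1)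
    (fun v v' w => by
      simp only [Pi.add_apply, map_add, add_mul, Finset.sum_add_distrib, mul_add]
      ring)
    (fun c v w => by
      simp only [Pi.smul_apply, map_smul, smul_mul_assoc, smul_eq_mul, ← Finset.mul_sum, smul_add,
        mul_left_comm _ c]
      rw [map_mul, ← Algebra.smul_def])
    (fun v w w' => by
      simp only [Pi.add_apply, map_add, mul_add, Finset.sum_add_distrib]
      ring)
    (fun c v w => by
      simp only [Pi.smul_apply, map_smul, mul_smul_comm, smul_eq_mul, ← Finset.mul_sum, smul_add,
        mul_left_comm _ c]
      rw [map_mul, ← Algebra.smul_def])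

lemma energyForm_apply (v w : P.State) : P.energyForm v w = algebraMap ℝ P.smoothPeriodic
    (P.ε ^ 2 / 2 * ∑ i, P.int (P.pderiv i (v 0) * P.pderiv i (w 0))) + v 1 * w 1 := rfl

lemma energyForm_comm (v w : P.State) : P.energyForm v w = P.energyForm w v := by
  simp only [energyForm_apply, mul_comm]

lemma energyForm_mkState (v w : P.smoothPeriodic) (r q e e' : ℝ) :
    P.energyForm (P.mkState v r e) (P.mkState w q e') = algebraMap ℝ _
      (P.ε ^ 2 / 2 * ∑ i, P.int (P.pderiv i v * P.pderiv i w) + r * q) := by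
  rw [energyForm_apply, map_add, map_mul _ r q]
  rfl

lemma energyForm_mkState_self (v : P.smoothPeriodic) (r e : ℝ) :
    P.energyForm (P.mkState v r e) (P.mkState v r e) = algebraMap ℝ _ (P.modEnergy v r) := by
  rw [energyForm_mkState, ← sq]
  rfl

lemma IsO.energyForm {ι : Type} {l : Filter ι} {g₁ g₂ : ι → ℝ} {v w : ι → P.State}
    (hv : ∀ j, IsO l g₁ fun i => v i j) (hw : ∀ j, IsO l g₂ fun i => w i j) :
    IsO l (fun i => g₁ i * g₂ i) fun i => P.energyForm (v i) (w i) := by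
  simp only [energyForm_apply]
  refine (IsO.algebraMap (Asymptotics.IsBigO.const_mul_left ?_ _)).add ((hv 1).mul (hw 1))
  exact Asymptotics.IsBigO.fun_sum fun i _ => (((hv 0).pderiv i).mul ((hw 0).pderiv i)).int

/-- By symmetry, the difference is the form evaluated at `v - w` and `v + w`. -/
lemma IsO.energyForm_self_sub {ι : Type} {l : Filter ι} {g : ι → ℝ} {v w : ι → P.State}
    (hv : ∀ j, IsO l (fun _ => (1 : ℝ)) fun i => v i j)
    (hw : ∀ j, IsO l (fun _ => (1 : ℝ)) fun i => w i j)
    (h : ∀ j, IsO l g fun i => v i j - w i j) :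
    IsO l g fun i => P.energyForm (v i) (v i) - P.energyForm (w i) (w i) := by
  have := IsO.energyForm (v := fun i => v i - w i) (w := fun i => v i + w i) h
    fun j => (hv j).add (hw j)
  simp only [mul_one] at this
  refine this.congr' (.of_forall fun i => ?_)
  simp only [map_add, map_sub, LinearMap.sub_apply]
  rw [energyForm_comm (w i) (v i)]
  abel

lemma algebraMap_int_lap_mul (v w : P.smoothPeriodic) :
    algebraMap ℝ P.smoothPeriodic (P.int ((-P.ε ^ 2) • (P.lap v * w))) = (2 : ℝ) •
      algebraMap ℝ P.smoothPeriodic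
        (P.ε ^ 2 / 2 * ∑ i, P.int (P.pderiv i v * P.pderiv i w)) := by
  have h (a : ℝ) : (2 : ℝ) • algebraMap ℝ P.smoothPeriodic a = algebraMap ℝ _ (2 * a) := by
    rw [Algebra.smul_def, map_mul]
  rw [h, map_smul, ← int_mul_lap_comm, int_mul_lap, smul_eq_mul]
  congr 1
  ring

/-- The energy component of the implicit part. -/
lemma implicitPart_two (v : P.State) :
    implicitPart v 2 = (2 : ℝ) • P.energyForm v (implicitPart v) := by
  rw [energyForm_apply, smul_add, ← algebraMap_int_lap_mul]
  simp [implicitPart]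

/-- The energy component of the explicit part. -/
lemma explicitPart_two (G : InvSqrt) (v : P.State) :
    explicitPart G v 2 = (2 : ℝ) • P.energyForm v (explicitPart G v) := by
  rw [energyForm_apply, smul_add, ← algebraMap_int_lap_mul]
  rfl

/-- The form of two polynomials is a double sum of products of monomials; the product rule gives two
sums, equal by symmetry. -/
lemma isTimeDeriv_energyForm_poly (H : β → ℝ) (n : ℕ) (c : ℕ → β → P.State) :
    IsTimeDeriv H (fun z => P.energyForm (poly (n + 1) c z) (poly (n + 1) c z))
      fun z => (2 : ℝ) • P.energyForm (poly (n + 1) c z) (polyDeriv n c z) := by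
  have := IsTimeDeriv.sum_smul (P := P) (H := H) (Finset.range (n + 1) ×ˢ Finset.range (n + 1))
    (a := fun k z => z.2 ^ k.1 * z.2 ^ k.2)
    (a' := fun k z => k.1 * z.2 ^ (k.1 - 1) * z.2 ^ k.2 + z.2 ^ k.1 * (k.2 * z.2 ^ (k.2 - 1)))
    (fun k _ b σ _ => ((hasDerivAt_pow k.1 σ).mul (hasDerivAt_pow k.2 σ)).hasDerivWithinAt)
    fun k b => P.energyForm (c k.1 b) (c k.2 b)
  have hd : ∀ z, polyDeriv n c z = ∑ k ∈ Finset.range (n + 1), (k * z.2 ^ (k - 1)) • c k z.1 := by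
    intro z
    rw [Finset.sum_range_succ']
    simp [polyDeriv, smul_smul]
  convert this using 2 with z z
  · simp only [poly, map_sum, map_smul, LinearMap.sum_apply, LinearMap.smul_apply,
      Finset.sum_product, Finset.smul_sum, smul_smul]
    rw [Finset.sum_comm]
    simp only [mul_comm]
  · rw [two_smul]
    nth_rw 1 [energyForm_comm]
    simp only [add_smul, Finset.sum_add_distrib]
    congr 1
    · simp only [hd, poly, map_sum, map_smul, LinearMap.sum_apply, LinearMap.smul_apply,
        Finset.sum_product, Finset.smul_sum, smul_smul]
      rw [Finset.sum_comm]
      simp only [mul_comm]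
    · simp only [hd, poly, map_sum, map_smul, LinearMap.sum_apply, LinearMap.smul_apply,
        Finset.sum_product, Finset.smul_sum, smul_smul]
      rw [Finset.sum_comm]
      simp only [mul_comm]

/-- Along a formal solution, the third component is the energy. -/
lemma isO_poly_sub_energyForm (G : InvSqrt) {p : ℕ} {c : ℕ → β → P.State} (hc : BddCoeffs c)
    (h0 : ∀ b, c 0 b 2 = P.energyForm (c 0 b) (c 0 b))
    (hr : ∀ j, IsO (smallStep β) (fun z => z.2 ^ p) fun z =>
      polyDeriv p c z j - (implicitPart (poly (p + 1) c z) + explicitPart G (poly (p + 1) c z)) j) :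
    IsO (smallStep β) (fun z => z.2 ^ (p + 1)) fun z => poly (p + 1) c z 2 -
      P.energyForm (poly (p + 1) c z) (poly (p + 1) c z) := by
  have h1 := (isTimeDeriv_poly (fun _ => 1) p c 2).sub
    (isTimeDeriv_energyForm_poly (fun _ => 1) p c)
  refine (h1.isO (fun b => ?_) (IsO.mono ?_ inf_le_left)).mono smallStep_le_stepWithin_one
  · rw [poly_zero, h0, sub_self]
  -- On the vector field the third component is twice the form with the state. Hence the derivative
  -- of the defect is the third residual minus twice the form of the state with the residual.
  · have h2 := ((IsO.energyForm (v := fun z : β × ℝ => poly (p + 1) c z)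
      (w := fun z => polyDeriv p c z -
        (implicitPart (poly (p + 1) c z) + explicitPart G (poly (p + 1) c z)))
      (fun j => (hc.hasExp (p + 1) 0 j).bdd) hr).const_smul 2)
    simp only [one_mul] at h2
    refine ((hr 2).sub h2).congr' (.of_forall fun z => ?_)
    simp only [Pi.add_apply, implicitPart_two, explicitPart_two, map_sub, map_add, smul_sub,
      smul_add]
    abel

end PhaseField

end

/-! ### Approximation of the exact solution, and positivity of the dissipation -/

noncomputable section

namespace PhaseField

variable {d : ℕ} {P : PhaseField d} {T : ℝ} {u : ℝ → Euc d → ℝ} {r : ℝ → ℝ} (G : InvSqrt)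

lemma implicitPart_congr {v w : P.State} (h0 : v 0 = w 0) : implicitPart v = implicitPart w := by
  rw [implicitPart, implicitPart, h0]

lemma explicitPart_congr {v w : P.State} (h0 : v 0 = w 0) (h1 : v 1 = w 1) :
    explicitPart G v = explicitPart G w := by
  simp only [explicitPart, auxOp, nonlinOp, energyOp, h0, h1]

variable (P u r) in
/-- The solution as a curve of states. -/
def solState (t : ℝ) : P.State := P.mkState (P.lift (u t)) (r t) (P.modEnergy (P.lift (u t)) (r t))

/-- The right-hand side of the augmented system. -/
def rhs (v : P.State) : P.State := implicitPart v + explicitPart G v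

lemma tame_rhs (j : Fin 3) : Tame fun v : P.State => rhs G v j :=
  (tame_implicitPart j).add (tame_explicitPart G j)

lemma rhs_congr {v w : P.State} (h0 : v 0 = w 0) (h1 : v 1 = w 1) : rhs G v = rhs G w := by
  rw [rhs, rhs, implicitPart_congr h0, explicitPart_congr G h0 h1]

lemma SmoothOn.timeDeriv (hT : 0 < T) {v v' : ℝ → P.smoothPeriodic} (hv : SmoothOn T v)
    (h : ∀ t ∈ Icc 0 T, ∀ x, HasDerivWithinAt (fun t => v t x) (v' t x) (Icc 0 T) t) :
    SmoothOn T v' := by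
  refine ContDiffOn.congr (f := fun z => fderivWithin ℝ (fun z : ℝ × Euc d => v z.1 z.2)
    (Icc 0 T ×ˢ univ) z (1, 0)) ?_ fun z hz => ?_
  · exact (hv.fderivWithin (uniqueDiffOn_slab hT) (by simp)).clm_apply contDiffOn_const
  · have hcurve : HasDerivWithinAt (fun t' => (t', z.2)) ((1 : ℝ), (0 : Euc d)) (Icc 0 T) z.1 :=
      (hasDerivAt_id z.1).hasDerivWithinAt.prodMk (hasDerivWithinAt_const _ _ _)
    have h1 := ((hv.differentiableOn (by simp)) z hz).hasFDerivWithinAt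
    have h2 := h1.comp_hasDerivWithinAt (t := Icc 0 T ×ˢ univ) z.1 hcurve
      fun t' ht' => ⟨ht', trivial⟩
    exact (uniqueDiffOn_Icc hT z.1 hz.1).eq_deriv _ (h z.1 hz.1 z.2) h2

lemma SmoothOn.continuous {v : ℝ → P.smoothPeriodic} (hv : SmoothOn T v) :
    Continuous fun z : Icc 0 T × Euc d => v z.1 z.2 :=
  hv.continuousOn.comp_continuous ((continuous_subtype_val.comp continuous_fst).prodMk
    continuous_snd) fun z => ⟨z.1.2, trivial⟩

namespace IsSolution

variable (hsol : P.IsSolution T u r)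
include hsol

lemma bdd (hT : 0 < T) (j : Fin 3) :
    IsO ⊤ (fun _ => (1 : ℝ)) fun t : Icc 0 T => P.solState u r t j := by
  have h0 := hsol.smoothOn.isO hT
  have h1 := IsO.algebraMap (P := P) hsol.r_bdd
  fin_cases j
  · exact h0
  · exact h1
  · have := IsO.energyForm (l := ⊤) (v := fun t : Icc 0 T => P.mkState (P.lift (u t)) (r t) 0)
      (w := fun t : Icc 0 T => P.mkState (P.lift (u t)) (r t) 0) (g₁ := fun _ => 1)
      (g₂ := fun _ => 1) (fun j => by fin_cases j <;> [exact h0; exact h1; exact IsO.const _])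
      (fun j => by fin_cases j <;> [exact h0; exact h1; exact IsO.const _])
    simp only [energyForm_mkState_self, mul_one] at this
    exact this

variable {G} (hG : ∀ t ∈ Icc 0 T, G.toFun (P.shiftedEnergy (u t)) = 1 / √(P.shiftedEnergy (u t)))
include hG

lemma N_eq {t : ℝ} (ht : t ∈ Icc 0 T) :
    P.L (u t) + P.N (u t) (r t) = (rhs G (P.solState u r t) 0 : P.smoothPeriodic) := by
  have h := PhaseField.N_eq G (v := P.lift (u t)) (r t) (P.modEnergy (P.lift (u t)) (r t))
    (by rw [hsol.coe_lift ht]; exact hG t ht)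
  have h' := L_coe (P.lift (u t))
  rw [hsol.coe_lift ht] at h h'
  rw [h, h']
  rfl

lemma Ntilde_eq {t : ℝ} (ht : t ∈ Icc 0 T) :
    algebraMap ℝ _ (P.Ntilde (u t) (r t)) = rhs G (P.solState u r t) 1 := by
  have h := PhaseField.Ntilde_eq G (v := P.lift (u t)) (r t) (P.modEnergy (P.lift (u t)) (r t))
    (by rw [hsol.coe_lift ht]; exact hG t ht)
  rw [hsol.coe_lift ht] at h
  rw [h]
  exact (zero_add _).symm

lemma hasDerivWithinAt_lift : ∀ t ∈ Icc 0 T, ∀ x, HasDerivWithinAt (fun t => P.lift (u t) x)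
    ((rhs G (P.solState u r t) 0) x) (Icc 0 T) t := by
  intro t ht x
  have h := hsol.u_eq t ht x
  rw [show P.L (u t) x + P.N (u t) (r t) x = rhs G (P.solState u r t) 0 x from
    congrFun (hsol.N_eq hG ht) x] at h
  exact h.congr (fun t' ht' => by rw [hsol.coe_lift ht']) (by rw [hsol.coe_lift ht])

/-- A formal solution approximates the solution. -/
lemma isO_sub_poly (hT : 0 < T) {p : ℕ} {c : ℕ → Icc 0 T → P.State} (hc : BddCoeffs c)
    (h0 : c 0 = fun t : Icc 0 T => P.solState u r t)
    (hr : ∀ j, IsO (smallStep (Icc 0 T)) (fun z => z.2 ^ p) fun z =>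
      polyDeriv p c z j - rhs G (poly (p + 1) c z) j) :
    let l := stepWithin fun t : Icc 0 T => T - t
    IsO l (fun z => z.2 ^ (p + 1)) (fun z => P.lift (u (z.1 + z.2)) - poly (p + 1) c z 0) ∧
    IsO l (fun z => z.2 ^ (p + 1))
      (fun z => algebraMap ℝ _ (r (z.1 + z.2)) - poly (p + 1) c z 1) := by
  intro l
  have hl : l ≤ smallStep (Icc 0 T) := inf_le_left
  have hmem : ∀ᶠ z in l, (z.1 : ℝ) + z.2 ∈ Icc 0 T :=
    eventually_stepWithin.2 ⟨1, one_pos, fun b τ hτ hH => ⟨add_nonneg b.2.1 hτ.1.le, by linarith⟩⟩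
  -- The right-hand side does not read the third component, so that slot is filled with the
  -- polynomial itself and contributes no error.
  let w : Icc 0 T × ℝ → P.State := fun z => ![P.lift (u (z.1 + z.2)),
    algebraMap ℝ _ (r (z.1 + z.2)), poly (p + 1) c z 2]
  have hwrhs : ∀ z, rhs G (w z) = rhs G (P.solState u r (z.1 + z.2)) := fun z => rhs_congr G rfl rfl
  have hpoly : ∀ j, IsO l (fun _ => (1 : ℝ)) fun z => poly (p + 1) c z j := fun j =>
    (hc.hasExp (p + 1) 0 j).bdd.mono hl
  have hwbdd : ∀ j, IsO l (fun _ => (1 : ℝ)) fun z => w z j := by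
    have : ∀ j, IsO l (fun _ => (1 : ℝ)) fun z => P.solState u r (z.1 + z.2) j := fun j => by
      refine ((hsol.bdd hT j).comp_tendsto (l' := l)
        (k := fun z => projIcc 0 T hT.le (z.1 + z.2)) tendsto_top).congr' ?_
      filter_upwards [hmem] with z hz
      simp only [Function.comp_apply, projIcc_of_mem _ hz]
    intro j
    fin_cases j
    · exact this 0
    · exact this 1
    · exact hpoly 2
  have key : ∀ q ≤ p + 1, ∀ j, IsO l (fun z => z.2 ^ q) fun z => w z j - poly (p + 1) c z j := by
    intro q
    induction q with
    | zero =>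
      intro _ j
      simp only [pow_zero]
      exact (hwbdd j).sub (hpoly j)
    | succ q ih =>
      intro hq j
      have h1 : ∀ j, IsO l (fun z => z.2 ^ q) fun z =>
          rhs G (P.solState u r (z.1 + z.2)) j - polyDeriv p c z j := by
        intro j
        have h2 := (tame_rhs G j).lip ((snd_pow_isBigO_one q).mono hl) hwbdd hpoly
          (ih (by omega))
        have h3 := ((hr j).mono hl).trans ((snd_pow_isBigO_pow (r := q) (q := p) (by omega)).mono hl)
        refine (h2.sub h3).congr' (.of_forall fun z => ?_)
        simp only [hwrhs]
        abel
      fin_cases j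
      · refine (((hsol.smoothOn.isTimeDeriv hT (hsol.hasDerivWithinAt_lift hG)).sub
          (isTimeDeriv_poly _ p c 0)).isO (fun b => ?_) (h1 0))
        rw [poly_zero, h0]
        simp [solState, mkState]
      · have h2 := (isTimeDeriv_algebraMap (P := P) hsol.r_eq).sub (isTimeDeriv_poly _ p c 1)
        refine h2.isO (fun b => ?_) ((h1 1).congr' ?_)
        · rw [poly_zero, h0]
          simp [solState, mkState]
        · filter_upwards [hmem] with z hz
          rw [hsol.Ntilde_eq hG hz]
      · simpa [w] using IsO.zero
  exact ⟨key (p + 1) le_rfl 0, key (p + 1) le_rfl 1⟩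

lemma Ntilde_eq_int {t : ℝ} (ht : t ∈ Icc 0 T) :
    P.Ntilde (u t) (r t) = 1 / (2 * √(P.shiftedEnergy (u t))) *
      P.int (comp (deriv P.F) (contDiff_deriv P.F_smooth) (P.lift (u t)) *
        rhs G (P.solState u r t) 0) := by
  rw [Ntilde, ip, int_apply]
  congr 2
  ext x
  rw [coe_mul_apply, comp_apply, hsol.coe_lift ht, ← hsol.N_eq hG ht]
  rfl

/-- The time derivative of the solution is again smooth on the slab, and parametric integrals of
continuous functions are continuous. -/
lemma continuous_dissipation (hT : 0 < T) : Continuous fun t : Icc 0 T =>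
    P.energyForm (rhs G (P.solState u r t)) (rhs G (P.solState u r t)) 0 := by
  have hv : SmoothOn T fun t => rhs G (P.solState u r t) 0 :=
    hsol.smoothOn.timeDeriv hT (hsol.hasDerivWithinAt_lift hG)
  have h1 : Continuous fun t : Icc 0 T => P.Ntilde (u t) (r t) := by
    simp only [fun t : Icc 0 T => hsol.Ntilde_eq_int hG t.2]
    refine Continuous.mul (continuous_const.div (continuous_const.mul
      hsol.continuous_shiftedEnergy.sqrt) fun t => ?_) ?_
    · have := Real.sqrt_pos.2 (hsol.shiftedEnergy_pos t t.2)
      positivity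
    · refine continuous_setIntegral_Ω (P := P) (f := fun z : Icc 0 T × Euc d =>
        (comp (deriv P.F) (contDiff_deriv P.F_smooth) (P.lift (u z.1)) *
          rhs G (P.solState u r z.1) 0 : P.smoothPeriodic) z.2) ?_
      exact ((contDiff_deriv P.F_smooth).continuous.comp hsol.smoothOn.continuous).mul hv.continuous
  have h2 : (fun t : Icc 0 T =>
      P.energyForm (rhs G (P.solState u r t)) (rhs G (P.solState u r t)) 0) = fun t : Icc 0 T =>
      P.ε ^ 2 / 2 * ∑ i, P.int (P.pderiv i (rhs G (P.solState u r t) 0) *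
        P.pderiv i (rhs G (P.solState u r t) 0)) +
      P.Ntilde (u t) (r t) * P.Ntilde (u t) (r t) := by
    ext t
    rw [energyForm_apply, ← hsol.Ntilde_eq hG t.2]
    rfl
  rw [h2]
  refine (continuous_const.mul (continuous_finsetSum _ fun i _ => ?_)).add (h1.mul h1)
  refine continuous_setIntegral_Ω (P := P) (f := fun z : Icc 0 T × Euc d =>
    (P.pderiv i (rhs G (P.solState u r z.1) 0) *
        P.pderiv i (rhs G (P.solState u r z.1) 0) : P.smoothPeriodic) z.2) ?_
  exact (hv.pderiv hT i).continuous.mul (hv.pderiv hT i).continuous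

/-- If the form vanishes at `v = u_t`, then `∇v = 0` and `⟨F' u, v⟩ = 0`. For Allen-Cahn `v = ε² Δu
- a F' u` with a number `a`, so `‖v‖² = -ε² ⟨∇v, ∇u⟩ - a ⟨F' u, v⟩ = 0`. For Cahn-Hilliard `v = Δw`,
so `‖v‖² = -⟨∇v, ∇w⟩ = 0`. Either way `v = 0`, contrary to the absence of steady states. -/
lemma dissipation_pos {t : ℝ} (ht : t ∈ Icc 0 T)
    (hnonstat : ∃ x, P.L (u t) x + P.N (u t) (r t) x ≠ 0) :
    0 < P.energyForm (rhs G (P.solState u r t)) (rhs G (P.solState u r t)) 0 := by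
  set v := rhs G (P.solState u r t) 0 with hv
  set U := P.lift (u t) with hU
  set f' := comp (deriv P.F) (contDiff_deriv P.F_smooth) U with hf'
  have heq : P.energyForm (rhs G (P.solState u r t)) (rhs G (P.solState u r t)) 0 =
      P.ε ^ 2 / 2 * ∑ i, P.int (P.pderiv i v * P.pderiv i v) + P.Ntilde (u t) (r t) ^ 2 := by
    rw [energyForm_apply, ← hsol.Ntilde_eq hG ht, sq (P.Ntilde _ _)]
    rfl
  have hε := P.ε_pos
  have hsum := int_sum_sq_nonneg v
  rw [heq]
  refine lt_of_le_of_ne (by positivity) fun h => ?_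
  have h1 : ∑ i, P.int (P.pderiv i v * P.pderiv i v) = 0 := by
    by_contra h0
    have : 0 < ∑ i, P.int (P.pderiv i v * P.pderiv i v) := lt_of_le_of_ne hsum (Ne.symm h0)
    have : 0 < P.ε ^ 2 / 2 * ∑ i, P.int (P.pderiv i v * P.pderiv i v) := by positivity
    nlinarith [sq_nonneg (P.Ntilde (u t) (r t))]
  have h2 : P.Ntilde (u t) (r t) = 0 := by
    rw [h1, mul_zero, zero_add] at h
    exact pow_eq_zero_iff two_ne_zero |>.1 h.symm
  have h3 : P.int (f' * v) = 0 := by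
    rw [hsol.Ntilde_eq_int hG ht] at h2
    have := Real.sqrt_pos.2 (hsol.shiftedEnergy_pos t ht)
    exact (mul_eq_zero.1 h2).resolve_left (by positivity)
  have h4 : ∀ i, P.pderiv i v = 0 := fun i => by
    have h5 := (Finset.sum_eq_zero_iff_of_nonneg fun i _ =>
      int_nonneg (v := P.pderiv i v * P.pderiv i v) fun x => mul_self_nonneg _).1 h1 i
        (Finset.mem_univ _)
    have h6 := eq_zero_of_int_eq_zero (fun x => mul_self_nonneg _) h5
    ext x
    exact mul_self_eq_zero.1 (congrArg (fun w : P.smoothPeriodic => w x) h6)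
  have hdecomp : v = P.mob ((-P.ε ^ 2) • P.lap U + (r t * G.toFun (P.shiftedEnergy U)) • f') := by
    rw [map_add, hv, rhs]
    refine congrArg₂ (· + ·) (linOp_apply _) ?_
    change nonlinOp G (P.solState u r t) = _
    rw [nonlinOp, solState, energyOp_mkState, comp_algebraMap, Algebra.smul_def,
      map_mul (algebraMap ℝ P.smoothPeriodic)]
    rfl
  have h5 : P.int (v * v) = 0 := by
    rcases mob_cases (P := P) with hm | hm
    · have h6 : v * v = P.ε ^ 2 • (v * P.lap U) -
          (r t * G.toFun (P.shiftedEnergy U)) • (f' * v) := by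
        nth_rw 2 [hdecomp]
        rw [hm]
        ext x
        simp
        ring
      rw [h6, map_sub, map_smul, map_smul, h3, int_mul_lap]
      simp [h4]
    · nth_rw 2 [hdecomp]
      rw [hm, int_mul_lap]
      simp [h4]
  have h6 := eq_zero_of_int_eq_zero (fun x => mul_self_nonneg _) h5
  obtain ⟨x, hx⟩ := hnonstat
  refine hx ?_
  rw [show P.L (u t) x + P.N (u t) (r t) x = v x from congrFun (hsol.N_eq hG ht) x]
  exact mul_self_eq_zero.1 (congrArg (fun w : P.smoothPeriodic => w x) h6)

lemma exists_dissipation_bound (hT : 0 < T)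
    (hnonstat : ∀ t ∈ Icc 0 T, ∃ x, P.L (u t) x + P.N (u t) (r t) x ≠ 0) :
    ∃ c > 0, ∀ t : Icc 0 T, c ≤ P.energyForm (rhs G (P.solState u r t))
      (rhs G (P.solState u r t)) 0 := by
  obtain ⟨t₀, -, ht₀⟩ := isCompact_univ.exists_isMinOn (⟨⟨0, le_rfl, hT.le⟩, trivial⟩ :
    (univ : Set (Icc 0 T)).Nonempty) (hsol.continuous_dissipation hG hT).continuousOn
  exact ⟨_, hsol.dissipation_pos hG t₀.2 (hnonstat t₀ t₀.2), fun t => ht₀ (mem_univ t)⟩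

end IsSolution

end PhaseField

end

/-! ### The stages and the unrelaxed update -/

noncomputable section

namespace PhaseField

variable {d s : ℕ} {P : PhaseField d} {T : ℝ} {u : ℝ → Euc d → ℝ} {r : ℝ → ℝ} {M : IMEXTableau s}
  {G : InvSqrt} {δ : ℝ}

variable (P u r) in
/-- The stages of a step started at time `t`, as states. -/
def stageState (t : ℝ) (U : Fin s → P.smoothPeriodic) (R : Fin s → ℝ) (k : Fin s) : P.State :=
  P.mkState (U k) (R k) (P.modEnergy (P.lift (u t)) (r t))

variable (M G) in
/-- The increment of a step with the given stages. -/
def increment (Y : Fin s → P.State) : P.State :=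
  ∑ k, (M.b k • implicitPart (Y k) + M.bbar k • explicitPart G (Y k))

lemma N_eq_stageState (hG : ∀ e, δ ≤ e → G.toFun e = 1 / √e) {t : ℝ} {U : Fin s → P.smoothPeriodic}
    {R : Fin s → ℝ} {k : Fin s} (hE : δ ≤ P.shiftedEnergy (U k)) :
    P.N (U k : Euc d → ℝ) (R k) = (explicitPart G (P.stageState u r t U R k) 0 : P.smoothPeriodic) :=
  N_eq G _ _ (hG _ hE)

lemma Ntilde_eq_stageState (hG : ∀ e, δ ≤ e → G.toFun e = 1 / √e) {t : ℝ}
    {U : Fin s → P.smoothPeriodic} {R : Fin s → ℝ} {k : Fin s} (hE : δ ≤ P.shiftedEnergy (U k)) :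
    algebraMap ℝ _ (P.Ntilde (U k : Euc d → ℝ) (R k)) =
      explicitPart G (P.stageState u r t U R k) 1 :=
  Ntilde_eq G _ _ (hG _ hE)

lemma L_eq_stageState {t : ℝ} {U : Fin s → P.smoothPeriodic} {R : Fin s → ℝ} {k : Fin s} :
    P.L (U k : Euc d → ℝ) = (implicitPart (P.stageState u r t U R k) 0 : P.smoothPeriodic) :=
  L_coe _

lemma dirU_eq (hG : ∀ e, δ ≤ e → G.toFun e = 1 / √e) {t : ℝ} {U : Fin s → P.smoothPeriodic}
    {R : Fin s → ℝ} (hE : ∀ k, δ ≤ P.shiftedEnergy (U k)) :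
    P.dirU M (fun k => U k) R =
      (increment M G (P.stageState u r t U R) 0 : P.smoothPeriodic) := by
  ext x
  simp only [dirU, increment, Finset.sum_apply, Pi.add_apply, Pi.smul_apply, coe_sum_apply,
    coe_add_apply, coe_smul_apply, Finset.sum_add_distrib]
  congr 1 <;> refine Finset.sum_congr rfl fun k _ => ?_
  · rw [L_eq_stageState (u := u) (r := r) (t := t) (R := R)]
  · rw [N_eq_stageState hG (hE k)]

lemma dirR_eq (hG : ∀ e, δ ≤ e → G.toFun e = 1 / √e) {t : ℝ} {U : Fin s → P.smoothPeriodic}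
    {R : Fin s → ℝ} (hE : ∀ k, δ ≤ P.shiftedEnergy (U k)) :
    algebraMap ℝ _ (P.dirR M (fun k => U k) R) = increment M G (P.stageState u r t U R) 1 := by
  simp only [dirR, increment, Finset.sum_apply, Pi.add_apply, Pi.smul_apply, map_sum]
  refine Finset.sum_congr rfl fun k _ => ?_
  rw [← Ntilde_eq_stageState hG (hE k), map_mul, ← Algebra.smul_def]
  exact (zero_add _).symm.trans (congrArg (· + _) (smul_zero _).symm)

section Stage

variable (hsol : P.IsSolution T u r) (hG : ∀ e, δ ≤ e → G.toFun e = 1 / √e)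
include hsol hG

/-- The third component of `stageState` is a placeholder, hence `c ≠ 2`. Energies are needed only
for `j < k`, since the nonlinear terms of the other stages have coefficient zero in the explicit
tableau. -/
lemma stage_eq {t τ : ℝ} (ht : t ∈ Icc 0 T) {U : Fin s → P.smoothPeriodic} {R : Fin s → ℝ}
    (hst : P.IsStages M τ (u t) (r t) (fun k => U k) R) {k : Fin s}
    (hE : ∀ j < k, δ ≤ P.shiftedEnergy (U j)) (c : Fin 3) (hc : c ≠ 2) :
    P.stageState u r t U R k c = P.solState u r t c + τ • ∑ j,
      (M.A k j • implicitPart (P.stageState u r t U R j) c +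
        M.Abar k j • explicitPart G (P.stageState u r t U R j) c) := by
  fin_cases c
  · ext x
    have h := hst.U_eq k x
    change U k x = P.lift (u t) x + (τ • ∑ j,
      (M.A k j • implicitPart (P.stageState u r t U R j) 0 +
        M.Abar k j • explicitPart G (P.stageState u r t U R j) 0) : P.smoothPeriodic) x
    rw [h, hsol.coe_lift ht, add_assoc, ← mul_add, ← Finset.sum_add_distrib, coe_smul_apply,
      coe_sum_apply]
    congr 2
    refine Finset.sum_congr rfl fun j _ => ?_
    rw [L_eq_stageState (u := u) (r := r) (t := t) (R := R), coe_add_apply, coe_smul_apply,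
      coe_smul_apply]
    congr 1
    rcases lt_or_ge j k with hj | hj
    · rw [N_eq_stageState hG (hE j hj)]
    · rw [M.Abar_eq_zero k j hj, zero_mul, zero_mul]
  · have h := hst.R_eq k
    change algebraMap ℝ P.smoothPeriodic (R k) = algebraMap ℝ _ (r t) + τ • ∑ j,
      (M.A k j • (0 : P.smoothPeriodic) +
        M.Abar k j • explicitPart G (P.stageState u r t U R j) 1)
    rw [h, map_add, map_mul, ← Algebra.smul_def, map_sum]
    congr 2
    refine Finset.sum_congr rfl fun j _ => ?_
    rw [smul_zero, zero_add, map_mul, ← Algebra.smul_def]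
    rcases lt_or_ge j k with hj | hj
    · rw [Ntilde_eq_stageState hG (hE j hj)]
    · rw [M.Abar_eq_zero k j hj, zero_smul, zero_smul]
  · exact absurd rfl hc

variable {ι : Type} {l : Filter ι} {tt : ι → Icc 0 T} {τ : ι → ℝ}
  {U : ι → Fin s → P.smoothPeriodic} {R : ι → Fin s → ℝ}
  (hτ : Tendsto (fun i => (tt i, τ i)) l (smallStep (Icc 0 T)))
include hτ

omit hG hτ in
lemma isO_solState_comp (hT : 0 < T) (c : Fin 3) :
    IsO l (fun _ => (1 : ℝ)) fun i => P.solState u r (tt i) c :=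
  (hsol.bdd hT c).comp_tendsto (k := tt) tendsto_top

-- The integral of `F V - F u` is `O(τ)`, so the bound `2 δ` on the solution leaves `δ` for `V`.
omit hG in
lemma eventually_le_shiftedEnergy (hT : 0 < T) (hδ : 0 < δ)
    (hE : ∀ t ∈ Icc 0 T, 2 * δ ≤ P.shiftedEnergy (u t)) {V : ι → P.smoothPeriodic}
    (hV : IsO l τ fun i => V i - P.lift (u (tt i))) : ∀ᶠ i in l, δ ≤ P.shiftedEnergy (V i) := by
  have h1 := (IsO.comp_sub_comp P.F_smooth (isO_solState_comp hsol hT 0)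
    (snd_isBigO_one.comp_tendsto hτ) hV).int
  have h2 : Tendsto τ l (𝓝 0) :=
    (tendsto_snd_smallStep.mono_right nhdsWithin_le_nhds).comp hτ
  filter_upwards [(h1.trans_tendsto h2).eventually (eventually_gt_nhds (neg_lt_zero.2 hδ))] with i hi
  have h3 := hE (tt i) (tt i).2
  rw [map_sub] at hi
  change -δ < _ - P.int (comp P.F P.F_smooth (P.lift (u (tt i)))) at hi
  have h4 : P.shiftedEnergy (u (tt i)) = P.int (comp P.F P.F_smooth (P.lift (u (tt i)))) + P.C0 := by
    rw [int_apply, shiftedEnergy]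
    simp only [comp_apply, hsol.coe_lift (tt i).2]
  have h5 : P.shiftedEnergy (V i) = P.int (comp P.F P.F_smooth (V i)) + P.C0 := rfl
  linarith

/-- Induction along the stages. The nonlinear terms and the implicit terms below the diagonal
involve earlier stages, already bounded with all derivatives. Only the diagonal term `τ a_kk L U_k`
contains the unknown; the resolvent estimate absorbs it, since `a_kk ≥ 0`. Any stages whatsoever are
controlled in this way, not only those close to the initial value by assumption. -/
lemma isO_stage_sub (hT : 0 < T) (hδ : 0 < δ) (hdiag : ∀ k, 0 ≤ M.A k k)
    (hE : ∀ t ∈ Icc 0 T, 2 * δ ≤ P.shiftedEnergy (u t))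
    (hst : ∀ i, P.IsStages M (τ i) (u (tt i)) (r (tt i)) (fun k => U i k) (R i))
    (k : Fin s) : ∀ c : Fin 3,
    IsO l τ fun i => P.stageState u r (tt i) (U i) (R i) k c - P.solState u r (tt i) c := by
  induction k using WellFoundedLT.induction with
  | ind k ih =>
  have hτ1 : τ =O[l] fun _ => (1 : ℝ) := snd_isBigO_one.comp_tendsto hτ
  have hz := isO_solState_comp (l := l) (tt := tt) hsol hT
  have hbdd : ∀ j < k, ∀ c, IsO l (fun _ => (1 : ℝ)) fun i =>
      P.stageState u r (tt i) (U i) (R i) j c := fun j hj c =>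
    (((ih j hj c).trans hτ1).add (hz c)).congr' (.of_forall fun i => sub_add_cancel _ _)
  have hEk : ∀ᶠ i in l, ∀ j < k, δ ≤ P.shiftedEnergy (U i j) := by
    refine eventually_all.2 fun j => ?_
    by_cases hj : j < k
    · exact (eventually_le_shiftedEnergy hsol hτ hT hδ hE (ih j hj 0)).mono fun i hi _ => hi
    · exact .of_forall fun i h => absurd h hj
  have heq : ∀ᶠ i in l, ∀ c : Fin 3, c ≠ 2 → _ := hEk.mono fun i hi =>
    stage_eq hsol hG (tt i).2 (hst i) hi
  have hexp : ∀ c, IsO l (fun _ => (1 : ℝ)) fun i => ∑ j,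
      M.Abar k j • explicitPart G (P.stageState u r (tt i) (U i) (R i) j) c := by
    intro c
    refine IsO.sum _ fun j _ => ?_
    rcases lt_or_ge j k with hj | hj
    · exact ((tame_explicitPart G c).bdd (hbdd j hj)).const_smul _
    · simp only [M.Abar_eq_zero k j hj, zero_smul]
      exact IsO.zero
  have hsmul : ∀ {v : ι → P.smoothPeriodic}, IsO l (fun _ => (1 : ℝ)) v →
      IsO l τ fun i => τ i • v i := fun hv => by
    simpa only [mul_one] using IsO.smul (Asymptotics.isBigO_refl τ l) hv
  have h0 : IsO l τ fun i => U i k - P.lift (u (tt i)) := by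
    -- The unknown is `e = U_k - u`; replacing `L U_k` by `L e + L u` puts `τ a_kk L u` among the
    -- data.
    refine IsO.resolvent (L := P.linOp) (κ := fun i => τ i * M.A k k) int_mul_linOp_nonpos
      (fun i v => linOp_pderiv i v) ?_ ?_ (hsmul ((((hz 0).linOp.const_smul (M.A k k)).add
        (IsO.sum (Finset.univ.erase k) (v := fun j i => M.A k j • P.linOp (U i j))
          fun j _ => ?_)).add (hexp 0)))
    · filter_upwards [hτ.eventually eventually_pos] with i hi
      exact mul_nonneg hi.le (hdiag k)
    · filter_upwards [heq] with i hi
      have h := hi 0 (by decide)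
      change U i k = P.lift (u (tt i)) + τ i • ∑ j, (M.A k j • P.linOp (U i j) +
        M.Abar k j • explicitPart G (P.stageState u r (tt i) (U i) (R i) j) 0) at h
      rw [Finset.sum_add_distrib, ← Finset.add_sum_erase _ _ (Finset.mem_univ k)] at h
      change _ = τ i • (M.A k k • P.linOp (P.lift (u (tt i))) + _ + _)
      rw [map_sub, smul_sub, mul_smul]
      generalize P.linOp (U i k) = w at h ⊢
      rw [h]
      simp only [smul_add, mul_smul]
      abel
    · rcases lt_or_ge j k with hj | hj
      · exact (hbdd j hj 0).linOp.const_smul _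
      · rcases hj.lt_or_eq with hj | rfl
        · simp only [M.A_eq_zero k j hj, zero_smul]
          exact IsO.zero
        · simp_all
  have h1 : IsO l τ fun i =>
      algebraMap ℝ P.smoothPeriodic (R i k) - algebraMap ℝ _ (r (tt i)) := by
    refine (hsmul (hexp 1)).congr' ?_
    filter_upwards [heq] with i hi
    have h := hi 1 (by decide)
    change algebraMap ℝ P.smoothPeriodic (R i k) = algebraMap ℝ _ (r (tt i)) + τ i • ∑ j,
      (M.A k j • (0 : P.smoothPeriodic) +
        M.Abar k j • explicitPart G (P.stageState u r (tt i) (U i) (R i) j) 1) at h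
    rw [h]
    simp
  intro c
  fin_cases c
  · exact h0
  · exact h1
  · simp only [stageState, solState, mkState]
    simpa using IsO.zero

/-- All stages are `O(τ)` close to the initial state, and both weight vectors sum to one. -/
lemma isO_increment_sub (hT : 0 < T) (hδ : 0 < δ) (hdiag : ∀ k, 0 ≤ M.A k k)
    (hE : ∀ t ∈ Icc 0 T, 2 * δ ≤ P.shiftedEnergy (u t))
    (hst : ∀ i, P.IsStages M (τ i) (u (tt i)) (r (tt i)) (fun k => U i k) (R i)) (c : Fin 3) :
    IsO l τ fun i => increment M G (P.stageState u r (tt i) (U i) (R i)) c -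
      rhs G (P.solState u r (tt i)) c := by
  have hτ1 : τ =O[l] fun _ => (1 : ℝ) := snd_isBigO_one.comp_tendsto hτ
  have hz := isO_solState_comp (l := l) (tt := tt) hsol hT
  have hY := isO_stage_sub hsol hG hτ hT hδ hdiag hE hst
  have hbdd : ∀ k c, IsO l (fun _ => (1 : ℝ)) fun i =>
      P.stageState u r (tt i) (U i) (R i) k c := fun k c =>
    (((hY k c).trans hτ1).add (hz c)).congr' (.of_forall fun i => sub_add_cancel _ _)
  have := IsO.sum Finset.univ fun k _ =>
    (((tame_implicitPart c).lip hτ1 (hbdd k) hz (hY k)).const_smul (M.b k)).add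
      (((tame_explicitPart G c).lip hτ1 (hbdd k) hz (hY k)).const_smul (M.bbar k))
  refine this.congr' (.of_forall fun i => ?_)
  have h1 : rhs G (P.solState u r (tt i)) c =
      ∑ k, (M.b k • implicitPart (P.solState u r (tt i)) c +
        M.bbar k • explicitPart G (P.solState u r (tt i)) c) := by
    rw [Finset.sum_add_distrib, ← Finset.sum_smul, ← Finset.sum_smul, M.sum_b, M.sum_bbar,
      one_smul, one_smul]
    rfl
  beta_reduce
  rw [h1, increment, Finset.sum_apply, ← Finset.sum_sub_distrib]
  refine Finset.sum_congr rfl fun k _ => ?_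
  simp only [Pi.add_apply, Pi.smul_apply, smul_sub]
  abel

/-- Polynomials that satisfy the stage equations approximate the update. -/
lemma isO_update_sub_poly (hT : 0 < T) (hδ : 0 < δ) (hdiag : ∀ k, 0 ≤ M.A k k)
    (hE : ∀ t ∈ Icc 0 T, 2 * δ ≤ P.shiftedEnergy (u t))
    (hst : ∀ i, P.IsStages M (τ i) (u (tt i)) (r (tt i)) (fun k => U i k) (R i)) {n : ℕ}
    {e : Option (Fin s) → ℕ → Icc 0 T → P.State} (he : ∀ k, BddCoeffs (e k))
    (hr : ∀ k j, IsO (smallStep (Icc 0 T)) (fun z => z.2 ^ n) fun z => poly n (e k) z j -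
      (P.solState u r z.1 j + z.2 • stageMap M.fullA M.fullAbar implicitPart (explicitPart G)
        (fun k => poly n (e k) z) k j)) (c : Fin 3) :
    IsO l (fun i => τ i ^ n) fun i => P.solState u r (tt i) c +
      τ i • increment M G (P.stageState u r (tt i) (U i) (R i)) c -
      poly n (e none) (tt i, τ i) c := by
  have hτ1 : τ =O[l] fun _ => (1 : ℝ) := snd_isBigO_one.comp_tendsto hτ
  have hz := isO_solState_comp (l := l) (tt := tt) hsol hT
  have hY := isO_stage_sub hsol hG hτ hT hδ hdiag hE hst
  -- The value at `none` is immaterial, since the column of `none` is zero in both extended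
  -- tableaux.
  let Y : Option (Fin s) → ι → P.State := fun k i =>
    k.elim (P.solState u r (tt i)) (P.stageState u r (tt i) (U i) (R i))
  let S : Option (Fin s) → ι → P.State := fun k i =>
    stageMap M.fullA M.fullAbar implicitPart (explicitPart G) (fun k => Y k i) k
  -- Same stages with the correct third component. As the vector fields read only the first two,
  -- these are exact stages of the augmented system, with the update at `none`.
  let Z : Option (Fin s) → ι → P.State := fun k i => P.solState u r (tt i) + τ i • S k i
  have hYbdd : ∀ k c, IsO l (fun _ => (1 : ℝ)) fun i => Y k i c := fun k c => by
    cases k with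
    | none => exact hz c
    | some k =>
      exact (((hY k c).trans hτ1).add (hz c)).congr' (.of_forall fun i => sub_add_cancel _ _)
  have hSbdd : ∀ k c, IsO l (fun _ => (1 : ℝ)) fun i => S k i c := fun k c => by
    simp only [S, stageMap_apply]
    exact IsO.sum _ fun j _ => (((tame_implicitPart c).bdd (hYbdd j)).const_smul _).add
      (((tame_explicitPart G c).bdd (hYbdd j)).const_smul _)
  have hZbdd : ∀ k c, IsO l (fun _ => (1 : ℝ)) fun i => Z k i c := fun k c =>
    (hz c).add ((IsO.smul hτ1 (hSbdd k c)).trans (by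
      simpa only [mul_one] using Asymptotics.isBigO_refl (fun _ : ι => (1 : ℝ)) l))
  have hpoly : ∀ k c, IsO l (fun _ => (1 : ℝ)) fun i => poly n (e k) (tt i, τ i) c := fun k c =>
    ((he k).hasExp n 0 c).bdd.comp_tendsto hτ
  have hEk : ∀ᶠ i in l, ∀ k, δ ≤ P.shiftedEnergy (U i k) := eventually_all.2 fun k =>
    eventually_le_shiftedEnergy hsol hτ hT hδ hE (hY k 0)
  have hZS : ∀ᶠ i in l, ∀ k, S k i =
      stageMap M.fullA M.fullAbar implicitPart (explicitPart G) (fun k => Z k i) k := by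
    filter_upwards [hEk] with i hi k
    have hYZ : ∀ k, ∀ c : Fin 3, c ≠ 2 → Y (some k) i c = Z (some k) i c := fun k c hc => by
      have h := stage_eq hsol hG (tt i).2 (hst i) (k := k) (fun j _ => hi j) c hc
      simp only [Z, S, Pi.add_apply, Pi.smul_apply, stageMap_apply, Fintype.sum_option]
      simpa [IMEXTableau.fullA, IMEXTableau.fullAbar, Y] using h
    simp only [S, stageMap, Fintype.sum_option]
    refine congrArg₂ (· + ·) ?_ (Finset.sum_congr rfl fun j _ => ?_)
    · cases k <;> simp [IMEXTableau.fullA, IMEXTableau.fullAbar]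
    · rw [implicitPart_congr (hYZ j 0 (by decide)),
        explicitPart_congr G (hYZ j 0 (by decide)) (hYZ j 1 (by decide))]
  have key : ∀ q ≤ n, ∀ k c, IsO l (fun i => τ i ^ q) fun i =>
      Z k i c - poly n (e k) (tt i, τ i) c := by
    intro q
    induction q with
    | zero =>
      intro _ k c
      simp only [pow_zero]
      exact (hZbdd k c).sub (hpoly k c)
    | succ q ih =>
      intro hq k c
      have h1 := stageMap_lip (A := M.fullA) (A' := M.fullAbar) tame_implicitPart
        (tame_explicitPart G) ((snd_pow_isBigO_one q).comp_tendsto hτ) hZbdd hpoly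
        (ih (by omega)) k c
      have h2 := IsO.smul (Asymptotics.isBigO_refl τ l) h1
      have h3 := ((hr k c).trans (snd_pow_isBigO_pow hq)).comp_tendsto hτ
      refine ((h2.trans ?_).sub h3).congr' ?_
      · simp only [pow_succ']
        exact Asymptotics.isBigO_refl _ _
      · filter_upwards [hZS] with i hi
        have h := congrFun (hi k) c
        change _ = P.solState u r (tt i) c + τ i • S k i c - _
        rw [h, smul_sub]
        simp only [Function.comp_apply]
        abel
  refine (key n le_rfl none c).congr' (.of_forall fun i => ?_)
  simp only [Z, S, Pi.add_apply, Pi.smul_apply]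
  congr 3
  simp [stageMap, increment, Fintype.sum_option, IMEXTableau.fullA, IMEXTableau.fullAbar, Y]

end Stage

end PhaseField

end

/-! ### The relaxation coefficient and the energy defect -/

noncomputable section

namespace PhaseField

variable {d s : ℕ} {P : PhaseField d} {T : ℝ} {u : ℝ → Euc d → ℝ} {r : ℝ → ℝ} {M : IMEXTableau s}
  {G : InvSqrt} {δ : ℝ}

lemma gradNormSq_coe (v : P.smoothPeriodic) :
    P.gradNormSq v = ∑ i, P.int (P.pderiv i v * P.pderiv i v) := by
  rw [gradNormSq, ← map_sum, int_apply]
  simp only [norm_gradient_sq]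

lemma relaxDen_eq (hG : ∀ e, δ ≤ e → G.toFun e = 1 / √e) (t : ℝ) {U : Fin s → P.smoothPeriodic}
    {R : Fin s → ℝ} (hE : ∀ k, δ ≤ P.shiftedEnergy (U k)) :
    algebraMap ℝ _ (P.relaxDen M (fun k => U k) R) =
      P.energyForm (increment M G (P.stageState u r t U R))
        (increment M G (P.stageState u r t U R)) := by
  rw [energyForm_apply, relaxDen, ← dirR_eq (u := u) (r := r) (t := t) hG hE,
    dirU_eq (u := u) (r := r) (t := t) hG hE, gradNormSq_coe, map_add, sq (P.dirR _ _ _),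
    map_mul _ (P.dirR _ _ _)]

/-- Integration by parts turns `ε² ⟨u - U_k, Δa⟩` into `ε² ⟨∇(U_k - u), ∇a⟩`, the gradient part of
twice the form. -/
lemma relaxNum_eq (hsol : P.IsSolution T u r) (hG : ∀ e, δ ≤ e → G.toFun e = 1 / √e) {t : ℝ}
    (ht : t ∈ Icc 0 T) {U : Fin s → P.smoothPeriodic} {R : Fin s → ℝ}
    (hE : ∀ k, δ ≤ P.shiftedEnergy (U k)) :
    algebraMap ℝ _ (P.relaxNum M (u t) (r t) (fun k => U k) R) = ∑ k, (2 : ℝ) •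
      P.energyForm (P.stageState u r t U R k - P.solState u r t)
        (M.b k • implicitPart (P.stageState u r t U R k) +
          M.bbar k • explicitPart G (P.stageState u r t U R k)) := by
  rw [relaxNum, map_sum]
  refine Finset.sum_congr rfl fun k _ => ?_
  set a := (M.b k • implicitPart (P.stageState u r t U R k) +
    M.bbar k • explicitPart G (P.stageState u r t U R k)) with ha
  have h0 : (fun x => M.b k * P.L (U k) x + M.bbar k * P.N (U k) (R k) x) =
      (a 0 : P.smoothPeriodic) := by
    rw [L_eq_stageState (u := u) (r := r) (t := t) (R := R), N_eq_stageState hG (hE k)]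
    rfl
  have h1 : algebraMap ℝ _ (M.bbar k * P.Ntilde (U k) (R k)) = a 1 := by
    rw [map_mul, Ntilde_eq_stageState (u := u) (r := r) (t := t) hG (hE k), ← Algebra.smul_def]
    exact (zero_add _).symm.trans
      (congrArg (· + _) (smul_zero (M.b k) (A := P.smoothPeriodic)).symm)
  have h2 : P.ip (fun x => u t x - U k x)
      (Laplacian.laplacian (a 0 : Euc d → ℝ)) =
        ∑ i, P.int (P.pderiv i (U k - P.lift (u t)) * P.pderiv i (a 0)) := by
    have h3 : P.int ((P.lift (u t) - U k) * P.lap (a 0)) =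
        ∑ i, P.int (P.pderiv i (U k - P.lift (u t)) * P.pderiv i (a 0)) := by
      rw [int_mul_lap, ← Finset.sum_neg_distrib]
      refine Finset.sum_congr rfl fun i _ => ?_
      simp only [map_sub, sub_mul, neg_sub]
    rw [laplacian_coe, ip, ← h3, int_apply]
    simp only [coe_mul_apply, coe_sub_apply, hsol.coe_lift ht]
  rw [h0, h2, energyForm_apply]
  change _ = (2 : ℝ) • (algebraMap ℝ P.smoothPeriodic
    (P.ε ^ 2 / 2 * ∑ i, P.int (P.pderiv i (U k - P.lift (u t)) * P.pderiv i (a 0))) +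
      (algebraMap ℝ _ (R k) - algebraMap ℝ _ (r t)) * a 1)
  rw [← h1, ← map_sub, ← map_mul, ← map_add, Algebra.smul_def, ← map_mul]
  congr 1
  ring

/-- The energy defect of the unrelaxed update determines the relaxation coefficient. -/
lemma energy_defect (hsol : P.IsSolution T u r) (hG : ∀ e, δ ≤ e → G.toFun e = 1 / √e) {t τ : ℝ}
    (ht : t ∈ Icc 0 T) {U : Fin s → P.smoothPeriodic} {R : Fin s → ℝ}
    (hE : ∀ k, δ ≤ P.shiftedEnergy (U k)) :
    let v := P.solState u r t + τ • increment M G (P.stageState u r t U R)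
    v 2 - P.energyForm v v = algebraMap ℝ _ (τ * P.relaxNum M (u t) (r t) (fun k => U k) R -
      τ ^ 2 * P.relaxDen M (fun k => U k) R) := by
  intro v
  have h0 : v = P.solState u r t + τ • increment M G (P.stageState u r t U R) := rfl
  have h1 : P.solState u r t 2 = P.energyForm (P.solState u r t) (P.solState u r t) :=
    (energyForm_mkState_self _ _ _).symm
  have h2 : increment M G (P.stageState u r t U R) 2 =
      ∑ k, (2 : ℝ) • P.energyForm (P.stageState u r t U R k)
        (M.b k • implicitPart (P.stageState u r t U R k) +
          M.bbar k • explicitPart G (P.stageState u r t U R k)) := by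
    rw [increment, Finset.sum_apply]
    refine Finset.sum_congr rfl fun k _ => ?_
    simp only [Pi.add_apply, Pi.smul_apply, implicitPart_two, explicitPart_two, map_add, map_smul,
      smul_add, smul_comm (2 : ℝ)]
  -- The energy increment pairs the vector fields with the stages, and the linear term of the
  -- quadratic form pairs them with the initial state; the numerator is the difference.
  have h3 : algebraMap ℝ _ (P.relaxNum M (u t) (r t) (fun k => U k) R) =
      increment M G (P.stageState u r t U R) 2 -
        (2 : ℝ) • P.energyForm (P.solState u r t) (increment M G (P.stageState u r t U R)) := by
    rw [relaxNum_eq hsol hG ht hE, h2, increment, map_sum, Finset.smul_sum,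
      ← Finset.sum_sub_distrib]
    refine Finset.sum_congr rfl fun k _ => ?_
    rw [map_sub, LinearMap.sub_apply, smul_sub]
  rw [map_sub, map_mul, map_mul, ← Algebra.smul_def, ← Algebra.smul_def, h3,
    relaxDen_eq (u := u) (r := r) hG t hE, h0]
  generalize increment M G (P.stageState u r t U R) = D
  simp only [Pi.add_apply, Pi.smul_apply, map_add, map_smul, LinearMap.add_apply,
    LinearMap.smul_apply, h1, energyForm_comm D (P.solState u r t), smul_sub, two_smul, smul_add,
    sq, mul_smul]
  abel

end PhaseField

end

/-! ### Size of the relaxation coefficient and local errors -/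

noncomputable section

namespace PhaseField

variable {d s : ℕ} {P : PhaseField d} {T : ℝ} {u : ℝ → Euc d → ℝ} {r : ℝ → ℝ} {M : IMEXTableau s}
  {G : InvSqrt} {δ : ℝ} {ι : Type} {l : Filter ι} {tt : ι → Icc 0 T} {τ : ι → ℝ}
  {U : ι → Fin s → P.smoothPeriodic} {R : ι → Fin s → ℝ} {q : ℕ} {c : ℕ → Icc 0 T → P.State}

lemma isO_increment (hsol : P.IsSolution T u r) (hG : ∀ e, δ ≤ e → G.toFun e = 1 / √e)
    (hτ : Tendsto (fun i => (tt i, τ i)) l (smallStep (Icc 0 T)))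
    (hT : 0 < T) (hδ : 0 < δ) (hdiag : ∀ k, 0 ≤ M.A k k)
    (hE : ∀ t ∈ Icc 0 T, 2 * δ ≤ P.shiftedEnergy (u t))
    (hst : ∀ i, P.IsStages M (τ i) (u (tt i)) (r (tt i)) (fun k => U i k) (R i)) (j : Fin 3) :
    IsO l (fun _ => (1 : ℝ)) fun i => increment M G (P.stageState u r (tt i) (U i) (R i)) j := by
  have h1 := (isO_increment_sub hsol hG hτ hT hδ hdiag hE hst j).trans
    (snd_isBigO_one.comp_tendsto hτ)
  have h2 := (tame_rhs G j).bdd (isO_solState_comp (l := l) (tt := tt) hsol hT)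
  exact (h1.add h2).congr' (.of_forall fun i => sub_add_cancel _ _)

/-- The bracket is the form at the increment, which is `O(τ)` close to the form at the right-hand
side, hence eventually above half of its lower bound. -/
lemma eventually_le_relaxDen (hsol : P.IsSolution T u r) (hG : ∀ e, δ ≤ e → G.toFun e = 1 / √e)
    (hτ : Tendsto (fun i => (tt i, τ i)) l (smallStep (Icc 0 T)))
    (hT : 0 < T) (hδ : 0 < δ) (hdiag : ∀ k, 0 ≤ M.A k k)
    (hE : ∀ t ∈ Icc 0 T, 2 * δ ≤ P.shiftedEnergy (u t))
    (hst : ∀ i, P.IsStages M (τ i) (u (tt i)) (r (tt i)) (fun k => U i k) (R i)) {κ : ℝ}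
    (hκ : 0 < κ) (hdiss : ∀ t : Icc 0 T, κ ≤ P.energyForm (rhs G (P.solState u r t))
      (rhs G (P.solState u r t)) 0) :
    ∀ᶠ i in l, κ / 2 ≤ P.relaxDen M (fun k => U i k) (R i) := by
  have hEk : ∀ᶠ i in l, ∀ k, δ ≤ P.shiftedEnergy (U i k) := eventually_all.2 fun k =>
    eventually_le_shiftedEnergy hsol hτ hT hδ hE (isO_stage_sub hsol hG hτ hT hδ hdiag hE hst k 0)
  have h1 := (IsO.energyForm_self_sub (isO_increment hsol hG hτ hT hδ hdiag hE hst)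
    (fun j => (tame_rhs G j).bdd (isO_solState_comp (l := l) (tt := tt) hsol hT))
    (isO_increment_sub hsol hG hτ hT hδ hdiag hE hst)).apply fun _ => 0
  have h2 : Tendsto τ l (𝓝 0) :=
    (tendsto_snd_smallStep.mono_right nhdsWithin_le_nhds).comp hτ
  filter_upwards [hEk, (h1.trans_tendsto h2).eventually
    (eventually_gt_nhds (show -(κ / 2) < 0 by linarith))] with i hi h3
  rw [coe_sub_apply, ← relaxDen_eq (M := M) (u := u) (r := r) hG (tt i) hi,
    coe_algebraMap_apply] at h3
  linarith [hdiss (tt i)]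

/-- Solution and update share the polynomial `c`, along which the third component is the energy up
to `O(τ^(q+2))`. So the energy defect of the update is of this size, and division by `τ²` times the
bracket leaves `O(τ^q)`. -/
lemma isO_relaxCoeff_sub_one (hsol : P.IsSolution T u r) (hG : ∀ e, δ ≤ e → G.toFun e = 1 / √e)
    (hτ : Tendsto (fun i => (tt i, τ i)) l (smallStep (Icc 0 T)))
    (hT : 0 < T) (hδ : 0 < δ) (hdiag : ∀ k, 0 ≤ M.A k k)
    (hE : ∀ t ∈ Icc 0 T, 2 * δ ≤ P.shiftedEnergy (u t))
    (hst : ∀ i, P.IsStages M (τ i) (u (tt i)) (r (tt i)) (fun k => U i k) (R i)) {κ : ℝ}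
    (hκ : 0 < κ) (hdiss : ∀ t : Icc 0 T, κ ≤ P.energyForm (rhs G (P.solState u r t))
      (rhs G (P.solState u r t)) 0)
    (hc : BddCoeffs c) (h0 : c 0 = fun t : Icc 0 T => P.solState u r t)
    (hcr : ∀ j, IsO (smallStep (Icc 0 T)) (fun z => z.2 ^ (q + 1)) fun z =>
      polyDeriv (q + 1) c z j - rhs G (poly (q + 2) c z) j)
    (hup : ∀ j, IsO l (fun i => τ i ^ (q + 2)) fun i => P.solState u r (tt i) j +
      τ i • increment M G (P.stageState u r (tt i) (U i) (R i)) j - poly (q + 2) c (tt i, τ i) j) :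
    (fun i => P.relaxCoeff M (τ i) (u (tt i)) (r (tt i)) (fun k => U i k) (R i) - 1) =O[l]
      fun i => τ i ^ q := by
  have hEk : ∀ᶠ i in l, ∀ k, δ ≤ P.shiftedEnergy (U i k) := eventually_all.2 fun k =>
    eventually_le_shiftedEnergy hsol hτ hT hδ hE (isO_stage_sub hsol hG hτ hT hδ hdiag hE hst k 0)
  have hpoly : ∀ j, IsO l (fun _ => (1 : ℝ)) fun i => poly (q + 2) c (tt i, τ i) j := fun j =>
    (hc.hasExp (q + 2) 0 j).bdd.comp_tendsto hτ
  have hpow : (fun i => τ i ^ (q + 2)) =O[l] fun _ => (1 : ℝ) :=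
    (snd_pow_isBigO_one (q + 2)).comp_tendsto hτ
  have hv : ∀ j, IsO l (fun _ => (1 : ℝ)) fun i => (P.solState u r (tt i) +
      τ i • increment M G (P.stageState u r (tt i) (U i) (R i))) j := fun j =>
    (((hup j).trans hpow).add (hpoly j)).congr' (.of_forall fun i => sub_add_cancel _ _)
  have h1 := (isO_poly_sub_energyForm G hc
    (fun b => by rw [h0]; exact (energyForm_mkState_self _ _ _).symm) hcr).comp_tendsto hτ
  have h2 := IsO.energyForm_self_sub hv hpoly hup
  have h3 := (((hup 2).add h1).sub h2).apply fun _ => 0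
  have h4 : (fun i => τ i * P.relaxNum M (u (tt i)) (r (tt i)) (fun k => U i k) (R i) -
      τ i ^ 2 * P.relaxDen M (fun k => U i k) (R i)) =O[l] fun i => τ i ^ (q + 2) := by
    refine h3.congr' ?_ .rfl
    filter_upwards [hEk] with i hi
    have h5 := congrArg (fun v : P.smoothPeriodic => v 0)
      (energy_defect (M := M) (τ := τ i) (R := R i) hsol hG (tt i).2 hi)
    rw [← coe_algebraMap_apply (P := P) (_ - _) 0, ← h5]
    simp only [Function.comp_apply, Pi.add_apply, Pi.smul_apply, coe_sub_apply, coe_add_apply]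
    abel
  obtain ⟨K, hK0, hK⟩ := h4.exists_nonneg
  refine Asymptotics.IsBigO.of_bound (K / (κ / 2)) ?_
  filter_upwards [hK.bound, hτ.eventually eventually_pos,
    eventually_le_relaxDen hsol hG hτ hT hδ hdiag hE hst hκ hdiss] with i hi hpos hden
  have hd : 0 < P.relaxDen M (fun k => U i k) (R i) := by linarith
  have hpos' : 0 < τ i := hpos
  -- The bracket is positive here, so the default value `1` plays no role.
  have h5 : P.relaxCoeff M (τ i) (u (tt i)) (r (tt i)) (fun k => U i k) (R i) - 1 =
      (τ i * P.relaxNum M (u (tt i)) (r (tt i)) (fun k => U i k) (R i) -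
        τ i ^ 2 * P.relaxDen M (fun k => U i k) (R i)) /
          (τ i ^ 2 * P.relaxDen M (fun k => U i k) (R i)) := by
    rw [relaxCoeff, if_pos hd.ne']
    field_simp
  rw [h5, norm_div, Real.norm_of_nonneg (by positivity : 0 ≤ τ i ^ 2 * _),
    div_le_iff₀ (by positivity)]
  refine hi.trans ?_
  rw [Real.norm_of_nonneg (by positivity), Real.norm_of_nonneg (by positivity)]
  calc K * τ i ^ (q + 2) = K / (κ / 2) * τ i ^ q * (τ i ^ 2 * (κ / 2)) := by
        field_simp
        ring
    _ ≤ _ := by gcongr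

/-- The difference is the sum of `(γ^k - γ) τ^k c_k`. It has no term with `k = 1`, and for `k ≥ 2`
the two factors are `O(τ^q)` and `O(τ²)`. This cancellation is the order that relaxation recovers.
-/
lemma isO_poly_rescale (hτ : Tendsto (fun i => (tt i, τ i)) l (smallStep (Icc 0 T)))
    (hc : BddCoeffs c) {γ : ι → ℝ} (hγ : (fun i => γ i - 1) =O[l] fun i => τ i ^ q) (j : Fin 3) :
    IsO l (fun i => τ i ^ (q + 2)) fun i => poly (q + 2) c (tt i, γ i * τ i) j - c 0 (tt i) j -
      γ i • (poly (q + 2) c (tt i, τ i) j - c 0 (tt i) j) := by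
  have hpow : (fun i => τ i ^ q) =O[l] fun _ => (1 : ℝ) :=
    (snd_pow_isBigO_one q).comp_tendsto hτ
  have hγ1 : γ =O[l] fun _ => (1 : ℝ) := by
    simpa using (hγ.trans hpow).add (Asymptotics.isBigO_refl (fun _ : ι => (1 : ℝ)) l)
  have h1 : ∀ k, (fun i => γ i ^ (k + 1) - γ i) =O[l] fun i => τ i ^ q := by
    intro k
    induction k with
    | zero => simpa using Asymptotics.isBigO_zero _ _
    | succ k ih =>
      have := (hγ1.mul ih).add (hγ1.mul hγ)
      simp only [one_mul] at this
      refine this.congr_left fun i => ?_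
      ring
  have h2 : ∀ k ∈ Finset.range (q + 1), IsO l (fun i => τ i ^ (q + 2)) fun i =>
      ((γ i ^ (k + 1) - γ i) * τ i ^ (k + 1)) • c (k + 1) (tt i) j := by
    intro k _
    cases k with
    | zero => simpa using IsO.zero
    | succ k =>
      have h3 : (fun i => τ i ^ (k + 1 + 1)) =O[l] fun i => τ i ^ 2 :=
        (snd_pow_isBigO_pow (by omega)).comp_tendsto hτ
      have h4 := IsO.smul ((h1 (k + 1)).mul h3) ((hc (k + 2) j).comp_tendsto (k := tt) tendsto_top)
      refine h4.trans (Asymptotics.isBigO_of_le _ fun i => ?_)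
      simp [pow_add]
  refine (IsO.sum _ h2).congr' (.of_forall fun i => ?_)
  simp only [poly_apply, Finset.sum_range_succ' _ (q + 1), pow_zero, one_smul, add_sub_cancel_right,
    Finset.smul_sum, ← Finset.sum_sub_distrib, smul_smul, ← sub_smul]
  refine Finset.sum_congr rfl fun k _ => ?_
  congr 1
  ring

section Combine

variable {γ : ι → ℝ} {w z D : ι → P.smoothPeriodic} {j : Fin 3}
  (hτ : Tendsto (fun i => (tt i, τ i)) l (smallStep (Icc 0 T)))
  (hγ : (fun i => γ i - 1) =O[l] fun i => τ i ^ q)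
  (hup : IsO l (fun i => τ i ^ (q + 2)) fun i => z i + τ i • D i - poly (q + 2) c (tt i, τ i) j)
include hτ hγ hup

/-- The local error of the incremental direction technique. -/
lemma isO_incremental (hD : IsO l (fun _ => (1 : ℝ)) D)
    (hw : IsO l (fun i => τ i ^ (q + 2)) fun i => w i - poly (q + 2) c (tt i, τ i) j) :
    IsO l (fun i => τ i ^ (q + 1)) fun i => w i - (z i + (γ i * τ i) • D i) := by
  have h1 : (fun i => τ i ^ (q + 2)) =O[l] fun i => τ i ^ (q + 1) :=
    (snd_pow_isBigO_pow (by omega)).comp_tendsto hτ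
  -- The term `(γ - 1) τ D`, the only one that is not `O(τ^(q+2))`.
  have h2 := IsO.smul (hγ.mul (Asymptotics.isBigO_refl τ l)) hD
  simp only [mul_one, ← pow_succ] at h2
  refine (((hw.sub hup).trans h1).sub h2).congr' (.of_forall fun i => ?_)
  simp only [sub_mul, sub_smul, one_mul]
  abel

/-- The local error of the relaxation technique. -/
lemma isO_relaxation (hc : BddCoeffs c) (hz : ∀ i, z i = c 0 (tt i) j)
    (hw : IsO l (fun i => τ i ^ (q + 2)) fun i => w i - poly (q + 2) c (tt i, γ i * τ i) j) :
    IsO l (fun i => τ i ^ (q + 2)) fun i => w i - (z i + (γ i * τ i) • D i) := by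
  have hγ1 : γ =O[l] fun _ => (1 : ℝ) := by
    have hpow : (fun i => τ i ^ q) =O[l] fun _ => (1 : ℝ) :=
      (snd_pow_isBigO_one q).comp_tendsto hτ
    simpa using (hγ.trans hpow).add (Asymptotics.isBigO_refl (fun _ : ι => (1 : ℝ)) l)
  have h1 := IsO.smul hγ1 hup
  simp only [one_mul] at h1
  -- Three errors: the solution against its polynomial at `γ τ`, the rescaling of the polynomial,
  -- and `γ` times the error of the unrelaxed update.
  refine ((hw.add (isO_poly_rescale hτ hc hγ j)).sub h1).congr' (.of_forall fun i => ?_)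
  simp only [hz, smul_sub, smul_add, mul_smul]
  abel

end Combine

lemma IsO.exists_bound {S : Set ι} {n : ℕ} {v : ι → P.smoothPeriodic}
    (hpos : ∀ᶠ i in l, 0 < τ i) (h : IsO (l ⊓ 𝓟 S) (fun i => τ i ^ n) v) :
    ∃ C, ∀ᶠ i in l, i ∈ S → ∀ x, |v i x| ≤ C * τ i ^ n := by
  obtain ⟨C, hC⟩ := h.base.bound
  refine ⟨C, ?_⟩
  filter_upwards [hpos, eventually_inf_principal.1 hC] with i hi hCi hS x
  have h1 := ((P.toBCF (v i)).norm_coe_le_norm x).trans (hCi hS)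
  rwa [Real.norm_of_nonneg (pow_nonneg hi.le n)] at h1

end PhaseField

end

/-! ### Assembly -/

namespace PhaseField

lemma exists_local_error_bound {d s : ℕ} {P : PhaseField d} {M : IMEXTableau s}
    (hdiag : ∀ i, 0 ≤ M.A i i) {q : ℕ} (hq : q ≠ 0) (horder : M.HasOrder (q + 1))
    {T : ℝ} (hT : 0 < T) {u : ℝ → Euc d → ℝ} {r : ℝ → ℝ} (hsol : P.IsSolution T u r)
    (hnonstat : ∀ t ∈ Icc 0 T, ∃ x, P.L (u t) x + P.N (u t) (r t) x ≠ 0)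
    {ι : Type} {l : Filter ι} {tt : ι → Icc 0 T} {τ : ι → ℝ}
    {U : ι → Fin s → P.smoothPeriodic} {R : ι → Fin s → ℝ}
    (hτ : Tendsto (fun i => (tt i, τ i)) l (smallStep (Icc 0 T)))
    (hst : ∀ i, P.IsStages M (τ i) (u (tt i)) (r (tt i)) (fun k => U i k) (R i)) :
    ∃ C, ∀ᶠ i in l,
      ((tt i : ℝ) + τ i ≤ T →
        (∀ x, |u (tt i + τ i) x - P.stepU M (τ i) (u (tt i)) (r (tt i)) (fun k => U i k) (R i) x| ≤
          C * τ i ^ (q + 1)) ∧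
        |r (tt i + τ i) - P.stepR M (τ i) (u (tt i)) (r (tt i)) (fun k => U i k) (R i)| ≤
          C * τ i ^ (q + 1)) ∧
      ((tt i : ℝ) + P.relaxCoeff M (τ i) (u (tt i)) (r (tt i)) (fun k => U i k) (R i) * τ i ≤ T →
        (∀ x, |u (tt i + P.relaxCoeff M (τ i) (u (tt i)) (r (tt i)) (fun k => U i k) (R i) * τ i) x -
            P.stepU M (τ i) (u (tt i)) (r (tt i)) (fun k => U i k) (R i) x| ≤ C * τ i ^ (q + 2)) ∧
        |r (tt i + P.relaxCoeff M (τ i) (u (tt i)) (r (tt i)) (fun k => U i k) (R i) * τ i) -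
            P.stepR M (τ i) (u (tt i)) (r (tt i)) (fun k => U i k) (R i)| ≤ C * τ i ^ (q + 2)) := by
  obtain ⟨δ, hδ, hE⟩ := hsol.exists_energy_bound
  obtain ⟨G₀, hG₀, hG⟩ := exists_smooth_inv_sqrt hδ
  let G : InvSqrt := ⟨G₀, hG₀⟩
  replace hG : ∀ e, δ ≤ e → G.toFun e = 1 / √e := hG
  have hG' : ∀ t ∈ Icc 0 T, G.toFun (P.shiftedEnergy (u t)) = 1 / √(P.shiftedEnergy (u t)) :=
    fun t ht => hG _ (by linarith [hE t ht])
  obtain ⟨κ, hκ, hdiss⟩ := hsol.exists_dissipation_bound hG' hT hnonstat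
  obtain ⟨c, e, hc, he, h0, hcr, her, hnone⟩ := exists_formal_step horder tame_implicitPart
    (tame_explicitPart G) (z₀ := fun t : Icc 0 T => P.solState u r t) (hsol.bdd hT)
  have hpos : ∀ᶠ i in l, 0 < τ i := hτ.eventually eventually_pos
  have hτ0 : Tendsto τ l (𝓝 0) := (tendsto_snd_smallStep.mono_right nhdsWithin_le_nhds).comp hτ
  let D : ι → P.State := fun i => increment M G (P.stageState u r (tt i) (U i) (R i))
  let γ : ι → ℝ := fun i => P.relaxCoeff M (τ i) (u (tt i)) (r (tt i)) (fun k => U i k) (R i)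
  have hup : ∀ j, IsO l (fun i => τ i ^ (q + 2)) fun i => P.solState u r (tt i) j +
      τ i • D i j - poly (q + 2) c (tt i, τ i) j := fun j => by
    simpa only [hnone] using isO_update_sub_poly hsol hG hτ hT hδ hdiag hE hst he her j
  have hD := isO_increment hsol hG hτ hT hδ hdiag hE hst
  have hEk : ∀ᶠ i in l, ∀ k, δ ≤ P.shiftedEnergy (U i k) := eventually_all.2 fun k =>
    eventually_le_shiftedEnergy hsol hτ hT hδ hE (isO_stage_sub hsol hG hτ hT hδ hdiag hE hst k 0)
  have hγ : (fun i => γ i - 1) =O[l] fun i => τ i ^ q :=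
    isO_relaxCoeff_sub_one hsol hG hτ hT hδ hdiag hE hst hκ hdiss hc h0 hcr hup
  -- Here `p ≥ 2` is needed, in the form `q ≠ 0`.
  have hγ1 : Tendsto γ l (𝓝 1) := by
    have h1 : Tendsto (fun i => τ i ^ q) l (𝓝 0) := by
      simpa [hq] using hτ0.pow q
    simpa using (hγ.trans_tendsto h1).add_const 1
  have hγpos : ∀ᶠ i in l, 0 < γ i := hγ1.eventually (lt_mem_nhds one_pos)
  -- As `γ → 1`, the relaxed step `γ τ` is itself a small positive step, so the expansion of the
  -- solution may be evaluated there.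
  have hσ : Tendsto (fun i => (tt i, γ i * τ i)) l (smallStep (Icc 0 T)) := by
    refine tendsto_comap_iff.2 (tendsto_nhdsWithin_iff.2 ⟨?_, ?_⟩)
    · have h1 := hγ1.mul hτ0
      rw [mul_zero] at h1
      exact h1
    · filter_upwards [hpos, hγpos] with i h1 h2
      exact mul_pos h2 h1
  let S₁ : Set ι := {i | (tt i : ℝ) + τ i ≤ T}
  let S₂ : Set ι := {i | (tt i : ℝ) + γ i * τ i ≤ T}
  have hτ₁ : Tendsto (fun i => (tt i, τ i)) (l ⊓ 𝓟 S₁) (stepWithin fun t : Icc 0 T => T - t) :=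
    tendsto_inf.2 ⟨hτ.mono_left inf_le_left, tendsto_principal.2 <|
      eventually_inf_principal.2 <| .of_forall fun i hi => by
        have h1 : _ ≤ T := hi
        exact le_sub_iff_add_le'.2 h1⟩
  have hσ₂ : Tendsto (fun i => (tt i, γ i * τ i)) (l ⊓ 𝓟 S₂)
      (stepWithin fun t : Icc 0 T => T - t) :=
    tendsto_inf.2 ⟨hσ.mono_left inf_le_left, tendsto_principal.2 <|
      eventually_inf_principal.2 <| .of_forall fun i hi => by
        have h1 : _ ≤ T := hi
        exact le_sub_iff_add_le'.2 h1⟩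
  obtain ⟨hexu, hexr⟩ := hsol.isO_sub_poly hG' hT hc h0 hcr
  have hσO : (fun i => (γ i * τ i) ^ (q + 2)) =O[l ⊓ 𝓟 S₂] fun i => τ i ^ (q + 2) := by
    have h1 : γ =O[l] fun _ => (1 : ℝ) := hγ1.isBigO_one ℝ
    simpa using ((h1.mul (Asymptotics.isBigO_refl τ l)).pow (q + 2)).mono inf_le_left
  have hinc : ∀ j {w : ι → P.smoothPeriodic}, IsO (l ⊓ 𝓟 S₁) (fun i => τ i ^ (q + 2))
      (fun i => w i - poly (q + 2) c (tt i, τ i) j) → _ := fun j w hw =>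
    (isO_incremental (hτ.mono_left inf_le_left) (hγ.mono inf_le_left) ((hup j).mono inf_le_left)
      ((hD j).mono inf_le_left) hw).exists_bound hpos
  have hrel : ∀ j {w : ι → P.smoothPeriodic}, IsO (l ⊓ 𝓟 S₂) (fun i => τ i ^ (q + 2))
      (fun i => w i - poly (q + 2) c (tt i, γ i * τ i) j) → _ := fun j w hw =>
    (isO_relaxation (hτ.mono_left inf_le_left) (hγ.mono inf_le_left) ((hup j).mono inf_le_left)
      hc (fun i => by rw [h0]) hw).exists_bound hpos
  obtain ⟨C₁, hC₁⟩ := hinc 0 (hexu.comp_tendsto hτ₁)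
  obtain ⟨C₂, hC₂⟩ := hinc 1 (hexr.comp_tendsto hτ₁)
  obtain ⟨C₃, hC₃⟩ := hrel 0 ((hexu.comp_tendsto hσ₂).trans hσO)
  obtain ⟨C₄, hC₄⟩ := hrel 1 ((hexr.comp_tendsto hσ₂).trans hσO)
  let C := max (max C₁ C₂) (max C₃ C₄)
  refine ⟨C, ?_⟩
  filter_upwards [hEk, hpos, hγpos, hC₁, hC₂, hC₃, hC₄] with i h1 h2 h3 h4 h5 h6 h7
  have hdU : P.dirU M (fun k => U i k) (R i) = (D i 0 : P.smoothPeriodic) := dirU_eq hG h1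
  have hdR : algebraMap ℝ _ (P.dirR M (fun k => U i k) (R i)) = D i 1 := dirR_eq hG h1
  have hCle : ∀ {K : ℝ} {n : ℕ} {a : ℝ}, a ≤ K * τ i ^ n → K ≤ C → a ≤ C * τ i ^ n := fun h h' =>
    h.trans (mul_le_mul_of_nonneg_right h' (pow_nonneg h2.le _))
  have hfinal : ∀ {K θ : ℝ} {n : ℕ}, 0 < θ → tt i + θ ≤ T → K ≤ C →
      (∀ x, |(P.lift (u (tt i + θ)) - (P.solState u r (tt i) 0 + (γ i * τ i) • D i 0) :
        P.smoothPeriodic) x| ≤ K * τ i ^ n) →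
      ∀ x, |u (tt i + θ) x - P.stepU M (τ i) (u (tt i)) (r (tt i)) (fun k => U i k) (R i) x| ≤
        C * τ i ^ n := by
    intro K θ n hθ hle hK h x
    refine hCle ?_ hK
    have h8 := h x
    rw [coe_sub_apply, coe_add_apply, coe_smul_apply,
      hsol.coe_lift ⟨by linarith [(tt i).2.1], hle⟩, ← hdU] at h8
    change |u (tt i + θ) x - (P.lift (u (tt i)) x + _)| ≤ _ at h8
    rwa [hsol.coe_lift (tt i).2] at h8
  have hfinal' : ∀ {K θ : ℝ} {n : ℕ}, K ≤ C →
      (∀ x, |(algebraMap ℝ _ (r (tt i + θ)) - (P.solState u r (tt i) 1 + (γ i * τ i) • D i 1) :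
        P.smoothPeriodic) x| ≤ K * τ i ^ n) →
      |r (tt i + θ) - P.stepR M (τ i) (u (tt i)) (r (tt i)) (fun k => U i k) (R i)| ≤
        C * τ i ^ n := by
    intro K θ n hK h
    have h8 := h 0
    rw [← hdR] at h8
    exact hCle h8 hK
  exact ⟨fun h => ⟨hfinal h2 h (le_max_of_le_left (le_max_left _ _)) (h4 h),
      hfinal' (le_max_of_le_left (le_max_right _ _)) (h5 h)⟩,
    fun h => ⟨hfinal (mul_pos h3 h2) h (le_max_of_le_right (le_max_left _ _)) (h6 h),
      hfinal' (le_max_of_le_right (le_max_right _ _)) (h7 h)⟩⟩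

end PhaseField

theorem mainTheorem3 {d s : ℕ} (P : PhaseField d) (M : IMEXTableau s)
    (hdiag : ∀ i, 0 ≤ M.A i i) (p : ℕ) (hp : 2 ≤ p) (horder : M.HasOrder p)
    (T : ℝ) (hT : 0 < T) (u : ℝ → EuclideanSpace ℝ (Fin d) → ℝ) (r : ℝ → ℝ)
    (hsol : P.IsSolution T u r)
    (hnonstat : ∀ t ∈ Set.Icc 0 T, ∃ x, P.L (u t) x + P.N (u t) (r t) x ≠ 0) :
    ∃ C τ₀ : ℝ, 0 < τ₀ ∧
      ∀ τ ∈ Set.Ioc 0 τ₀, ∀ t ∈ Set.Icc 0 T,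
      ∀ (U : Fin s → EuclideanSpace ℝ (Fin d) → ℝ) (R : Fin s → ℝ),
        P.IsStages M τ (u t) (r t) U R →
        -- incremental direction technique
        (t + τ ≤ T →
          (∀ x, |u (t + τ) x - P.stepU M τ (u t) (r t) U R x| ≤ C * τ ^ p) ∧
          |r (t + τ) - P.stepR M τ (u t) (r t) U R| ≤ C * τ ^ p) ∧
        -- relaxation technique
        (t + P.relaxCoeff M τ (u t) (r t) U R * τ ≤ T →
          (∀ x, |u (t + P.relaxCoeff M τ (u t) (r t) U R * τ) x
              - P.stepU M τ (u t) (r t) U R x| ≤ C * τ ^ (p + 1)) ∧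
          |r (t + P.relaxCoeff M τ (u t) (r t) U R * τ)
              - P.stepR M τ (u t) (r t) U R| ≤ C * τ ^ (p + 1)) := by
  obtain ⟨q, rfl⟩ : ∃ q, p = q + 1 := ⟨p - 1, by omega⟩
  -- The index runs over all starting times, step sizes and stages that satisfy the stage equations,
  -- and the filter only forces `τ → 0+`; so `C` and `τ₀` are uniform in all the rest.
  obtain ⟨C, hC⟩ := PhaseField.exists_local_error_bound hdiag (q := q) (by omega) horder hT hsol hnonstat
    (ι := {i : Icc 0 T × ℝ × (Fin s → P.smoothPeriodic) × (Fin s → ℝ) //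
      P.IsStages M i.2.1 (u i.1) (r i.1) (fun k => i.2.2.1 k) i.2.2.2})
    (tt := fun i => i.1.1) (τ := fun i => i.1.2.1) tendsto_comap fun i => i.2
  obtain ⟨τ₀, hτ₀, hsub⟩ := mem_nhdsGT_iff_exists_Ioc_subset.1
    (eventually_comap.1 (eventually_comap.1 hC))
  exact ⟨C, τ₀, hτ₀, fun τ hτ t ht U R hU => hsub hτ (⟨t, ht⟩, τ) rfl
    ⟨(⟨t, ht⟩, τ, fun k => ⟨U k, hU.smooth k, hU.periodic k⟩, R), hU⟩ rfl⟩
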